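/- Let $n\ge 3$ and $\ell\ge 2$ be integers, let $\zeta\in\mathbb{C}$ be a primitive $\ell$-th root of unity, and let $t=(t_1,\dots,t_n)\in\mathbb{C}^n$. All subscripts are read modulo $n$. Let $V=\mathbb{C}^n$ with standard basis $x_1,\dots,x_n$ and let $G\subset SL_n(\mathbb{C})$ be the group of all diagonal matrices $g$ with $g^\ell=1$. For $1\le i\le n$ let $g_i\in G$ be the element with $g_i(x_i)=\zeta x_i$, $g_i(x_{i+1})=\zeta^{-1}x_{i+1}$ and $g_i(x_j)=x_j$ for the other $j$; every element of $G$ can be written as $g_1^{i_1}\cdots g_{n-1}^{i_{n-1}}$ with exponents unique modulo $\ell$. Let $\alpha$ be the $2$-cocycle \[ \alpha\big(g_1^{i_1}\cdots g_{n-1}^{i_{n-1}},\,g_1^{j_1}\cdots g_{n-1}^{j_{n-1}}\big)=\zeta^{-i_1j_2-i_2j_3-\dots-i_{n-2}j_{n-1}} . \] Let $TV\#_\alpha G$ be the crossed product of the tensor algebra $TV$ with $G$, that is, the vector space $TV\otimes\mathbb{C}G$ with product $(r\otimes g)(s\otimes h)=\alpha(g,h)\,r\,(g\cdot s)\otimes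 gh$; the product of $g,h\in G$ in it is written $g*h=\alpha(g,h)gh$. Let $\mathsf{H}$ be the quotient of $TV\#_\alpha G$ by the relations \[ x_ix_{i+1}-x_{i+1}x_i=t_ig_i\quad(1\le i\le n),\qquad x_ix_j-x_jx_i=0\quad\text{if } |i-j|\notin\{1,n-1\}, \] and let $\mathsf{Z}$ be its center. Let $J$ be the set of all subsets $\{i_1<\dots<i_k\}$ ($k\ge 0$) of $\{1,\dots,n\}$ such that $|i_r-i_s|\notin\{1,n-1\}$ for all $r,s$. In $\mathbb{Z}^n$ put $\delta=(1,\dots,1)$, and let $\varepsilon_i$ have entries $1$ at the positions $i$ and $i+1$ and $0$ elsewhere; write $\omega^p=\omega_1^{p_1}\cdots\omega_n^{p_n}$, with the factors in this order. Set $\tau_i=\frac{t_i}{\zeta-1}$ and $\widetilde\tau_i=\tau_i^\ell$ for $1\le i\le n-1$, $\tau_n=\frac{\zeta t_n}{\zeta-1}$ and $\widetilde\tau_n=(-1)^{n(\ell-1)}\tau_n^\ell$, and $\nu_r=(-1)^r\frac{\ell}{\ell-r}\binom{\ell-r}{r}$ for $0\le r\le\lfloor\ell/2\rfloor$. Define \[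 w=\sum_{\{i_1<\dots<i_k\}\in J}\tau_{i_1}\cdots\tau_{i_k}\,x^{\delta-\varepsilon_{i_1}-\dots-\varepsilon_{i_k}}\,g_{i_1}*\cdots*g_{i_k}\in\mathsf{H} \] and the polynomial $F\in\mathbb{C}[a_1,\dots,a_n,b]$ by \[ F=\sum_{\{i_1<\dots<i_k\}\in J}\widetilde\tau_{i_1}\cdots\widetilde\tau_{i_k}\,a^{\delta-\varepsilon_{i_1}-\dots-\varepsilon_{i_k}}-\sum_{r=0}^{\lfloor\ell/2\rfloor}(-1)^{nr}\zeta^{(n-2)r}\nu_r(\tau_1\cdots\tau_n)^r\,b^{\ell-2r}. \] Then the assignment $a_i\mapsto x_i^\ell$ ($i=1,\dots,n$), $b\mapsto w$ defines an isomorphism of $\mathbb{C}$-algebras \[ \mathbb{C}[a_1,\dots,a_n,b]/(F)\ \overset{\sim}{\longrightarrow}\ \mathsf{Z}. \] Moreover, if $t_1=\dots=t_n=0$, then $F=a_1\cdots a_n-b^\ell$. -/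

import Mathlib

noncomputable section

/-- A normalized `2`-cocycle of a group `G` with values in the units of `k` (trivial action). -/
structure NormalizedCocycle (k G : Type*) [CommRing k] [Group G] where
  toFun : G → G → kˣ
  map_one_left : ∀ g, toFun 1 g = 1
  map_one_right : ∀ g, toFun g 1 = 1
  cocycle : ∀ g h m, toFun g h * toFun (g * h) m = toFun h m * toFun g (h * m)

/-- The crossed product `E #_α G` of a `k`-algebra `E` with an action `ρ : G → Aut(E)` and a
`2`-cocycle `α`. As a `k`-module it is `E ⊗ kG`, realized as `G →₀ E`. -/
@[ext]
structure CrossedProduct {k E G : Type*} [CommRing k] [Ring E] [Algebra k E] [Group G]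
    (ρ : G →* (E ≃ₐ[k] E)) (α : NormalizedCocycle k G) where
  coeff : G →₀ E

namespace CrossedProduct

variable {k E G : Type*} [CommRing k] [Ring E] [Algebra k E] [Group G]
  {ρ : G →* (E ≃ₐ[k] E)} {α : NormalizedCocycle k G}

/-- The underlying `k`-module of the crossed product is `G →₀ E`. -/
def coeffEquiv : CrossedProduct ρ α ≃ (G →₀ E) where
  toFun := coeff
  invFun := mk

instance : AddCommGroup (CrossedProduct ρ α) := coeffEquiv.addCommGroup

instance : Module k (CrossedProduct ρ α) := coeffEquiv.module k

/-- The element `r ⊗ g`. -/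
def single (g : G) (r : E) : CrossedProduct ρ α := ⟨Finsupp.single g r⟩

/-- `(r ⊗ g) (s ⊗ h) = α(g, h) r (g · s) ⊗ g h`, extended biadditively. -/
instance : Mul (CrossedProduct ρ α) :=
  ⟨fun a b => ⟨a.coeff.sum fun g r => b.coeff.sum fun h s =>
    Finsupp.single (g * h) (α.toFun g h • (r * ρ g s))⟩⟩

instance : One (CrossedProduct ρ α) := ⟨single 1 1⟩

theorem coeff_add (a b : CrossedProduct ρ α) : (a + b).coeff = a.coeff + b.coeff := rfl

theorem coeff_zero : (0 : CrossedProduct ρ α).coeff = 0 := rfl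

theorem coeff_smul (c : k) (a : CrossedProduct ρ α) : (c • a).coeff = c • a.coeff := rfl

theorem coeff_mul (a b : CrossedProduct ρ α) :
    (a * b).coeff = a.coeff.sum fun g r => b.coeff.sum fun h s =>
      Finsupp.single (g * h) (α.toFun g h • (r * ρ g s)) := rfl

theorem one_def : (1 : CrossedProduct ρ α) = single 1 1 := rfl

theorem single_add (g : G) (r s : E) :
    (single g (r + s) : CrossedProduct ρ α) = single g r + single g s := by
  ext1; simp [single, coeff_add]

theorem single_zero (g : G) : (single g 0 : CrossedProduct ρ α) = 0 := by
  ext1; simp [single, coeff_zero]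

theorem smul_single (c : k) (g : G) (r : E) :
    c • (single g r : CrossedProduct ρ α) = single g (c • r) := by
  ext1; simp [single, coeff_smul]

theorem single_mul_single (g h : G) (r s : E) :
    (single g r * single h s : CrossedProduct ρ α) =
      single (g * h) (α.toFun g h • (r * ρ g s)) := by
  ext1
  rw [coeff_mul]
  simp [single]

@[elab_as_elim]
theorem induction_on {p : CrossedProduct ρ α → Prop} (a : CrossedProduct ρ α)
    (h0 : p 0) (hs : ∀ g r, p (single g r)) (hadd : ∀ a b, p a → p b → p (a + b)) : p a := by
  obtain ⟨f⟩ := a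
  induction f using Finsupp.induction_linear with
  | zero => exact h0
  | add f g hf hg => exact hadd _ _ hf hg
  | single g r => exact hs g r

theorem mul_add_aux (a b c : CrossedProduct ρ α) : a * (b + c) = a * b + a * c := by
  classical
  ext1
  simp only [coeff_mul, coeff_add]
  rw [← Finsupp.sum_add]
  congr 1
  funext g r
  rw [Finsupp.sum_add_index'] <;> intros <;> simp [mul_add]

theorem add_mul_aux (a b c : CrossedProduct ρ α) : (a + b) * c = a * c + b * c := by
  classical
  ext1
  simp only [coeff_mul, coeff_add]
  rw [Finsupp.sum_add_index'] <;> intros <;> simp [add_mul, Finsupp.sum_add]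

theorem zero_mul_aux (a : CrossedProduct ρ α) : 0 * a = 0 := by
  ext1; simp [coeff_mul, coeff_zero]

theorem mul_zero_aux (a : CrossedProduct ρ α) : a * 0 = 0 := by
  ext1; simp [coeff_mul, coeff_zero]

instance : Ring (CrossedProduct ρ α) where
  __ := (inferInstance : AddCommGroup (CrossedProduct ρ α))
  left_distrib := mul_add_aux
  right_distrib := add_mul_aux
  zero_mul := zero_mul_aux
  mul_zero := mul_zero_aux
  mul_assoc a b c := by
    induction a using induction_on with
    | h0 => simp only [zero_mul_aux]
    | hadd a a' h h' => simp only [add_mul_aux, h, h']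
    | hs g r =>
    induction b using induction_on with
    | h0 => simp only [zero_mul_aux, mul_zero_aux]
    | hadd a a' h h' => simp only [add_mul_aux, mul_add_aux, h, h']
    | hs h s =>
    induction c using induction_on with
    | h0 => simp only [mul_zero_aux]
    | hadd a a' h h' => simp only [mul_add_aux, h, h']
    | hs m u =>
      simp only [single_mul_single, mul_assoc]
      congr 1
      simp only [Units.smul_def, map_smul, map_mul, smul_mul_assoc, mul_smul_comm, smul_smul,
        AlgEquiv.mul_apply, mul_assoc]
      congr 1
      have := congrArg Units.val (α.cocycle g h m)
      simp only [Units.val_mul] at this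
      rw [mul_comm, this, mul_comm]
  one_mul a := by
    induction a using induction_on with
    | h0 => simp only [mul_zero_aux]
    | hadd a a' h h' => simp only [mul_add_aux, h, h']
    | hs g r => simp [one_def, single_mul_single, α.map_one_left]
  mul_one a := by
    induction a using induction_on with
    | h0 => simp only [zero_mul_aux]
    | hadd a a' h h' => simp only [add_mul_aux, h, h']
    | hs g r => simp [one_def, single_mul_single, α.map_one_right]

instance : Algebra k (CrossedProduct ρ α) :=
  Algebra.ofModule
    (fun c a b => by
      induction a using induction_on with
      | h0 => simp
      | hadd a a' h h' => simp only [add_mul, smul_add, h, h']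
      | hs g r =>
      induction b using induction_on with
      | h0 => simp
      | hadd a a' h h' => simp only [mul_add, smul_add, h, h']
      | hs h s => simp [smul_single, single_mul_single, smul_comm c])
    (fun c a b => by
      induction a using induction_on with
      | h0 => simp
      | hadd a a' h h' => simp only [add_mul, smul_add, h, h']
      | hs g r =>
      induction b using induction_on with
      | h0 => simp
      | hadd a a' h h' => simp only [mul_add, smul_add, h, h']
      | hs h s => simp [smul_single, single_mul_single, smul_comm c])

end CrossedProduct

namespace TwistedHecke

open Matrix

/-- The group `G` of all diagonal matrices `g` in `SL_n(ℂ)` with `g ^ ℓ = 1`. -/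
def diagGroup (n ℓ : ℕ) : Subgroup (SpecialLinearGroup (Fin n) ℂ) where
  carrier := {g | (g : Matrix (Fin n) (Fin n) ℂ).IsDiag ∧ g ^ ℓ = 1}
  one_mem' := ⟨by simp, one_pow _⟩
  mul_mem' := by
    rintro a b ⟨ha, ha'⟩ ⟨hb, hb'⟩
    have hc : Commute a b := by
      apply Subtype.ext
      change (a : Matrix (Fin n) (Fin n) ℂ) * b = b * a
      rw [← ha.diagonal_diag, ← hb.diagonal_diag]
      simp [mul_comm]
    refine ⟨?_, by rw [hc.mul_pow, ha', hb', one_mul]⟩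
    change ((a : Matrix (Fin n) (Fin n) ℂ) * b).IsDiag
    rw [← ha.diagonal_diag, ← hb.diagonal_diag, diagonal_mul_diagonal]
    exact isDiag_diagonal _
  inv_mem' := by
    rintro a ⟨ha, ha'⟩
    refine ⟨?_, by rw [inv_pow, ha', inv_one]⟩
    change (adjugate (a : Matrix (Fin n) (Fin n) ℂ)).IsDiag
    rw [← ha.diagonal_diag, adjugate_diagonal]
    exact isDiag_diagonal _

variable {n ℓ : ℕ}

/-- The `j`-th diagonal entry of `g`. -/
def entry (g : diagGroup n ℓ) (j : Fin n) : ℂ := (g : SpecialLinearGroup (Fin n) ℂ) j j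

theorem coe_eq_diagonal (g : diagGroup n ℓ) :
    ((g : SpecialLinearGroup (Fin n) ℂ) : Matrix (Fin n) (Fin n) ℂ) = diagonal (entry g) :=
  g.2.1.diagonal_diag.symm

theorem entry_one (j : Fin n) : entry (1 : diagGroup n ℓ) j = 1 := by
  simp [entry]

theorem entry_mul (g h : diagGroup n ℓ) (j : Fin n) : entry (g * h) j = entry g j * entry h j := by
  have : ((g * h : diagGroup n ℓ) : SpecialLinearGroup (Fin n) ℂ).1 =
      diagonal (entry g) * diagonal (entry h) := by
    rw [← coe_eq_diagonal, ← coe_eq_diagonal]; rfl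
  rw [diagonal_mul_diagonal] at this
  have h2 := congrFun (congrFun this j) j
  rwa [diagonal_apply_eq] at h2

theorem ext_entry {g h : diagGroup n ℓ} (H : ∀ j, entry g j = entry h j) : g = h := by
  apply Subtype.ext
  apply Subtype.ext
  rw [coe_eq_diagonal, coe_eq_diagonal, funext H]

instance : CommGroup (diagGroup n ℓ) where
  mul_comm g h := ext_entry fun j => by rw [entry_mul, entry_mul, mul_comm]

theorem entry_pow (g : diagGroup n ℓ) (m : ℕ) (j : Fin n) : entry (g ^ m) j = entry g j ^ m := by
  induction m with
  | zero => simp [entry_one]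
  | succ m ih => rw [pow_succ, entry_mul, ih, pow_succ]

theorem entry_pow_card (g : diagGroup n ℓ) (j : Fin n) : entry g j ^ ℓ = 1 := by
  have : g ^ ℓ = 1 := Subtype.ext g.2.2
  rw [← entry_pow, this, entry_one]

/-- The product of the first `k + 1` diagonal entries of `g`. -/
def partialProd (g : diagGroup n ℓ) (k : ℕ) : ℂ :=
  ∏ j : Fin n with j.val ≤ k, entry g j

theorem partialProd_one (k : ℕ) : partialProd (1 : diagGroup n ℓ) k = 1 := by
  simp [partialProd, entry_one]

theorem partialProd_mul (g h : diagGroup n ℓ) (k : ℕ) :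
    partialProd (g * h) k = partialProd g k * partialProd h k := by
  simp [partialProd, entry_mul, Finset.prod_mul_distrib]

theorem partialProd_pow_card (g : diagGroup n ℓ) (k : ℕ) : partialProd g k ^ ℓ = 1 := by
  simp [partialProd, ← Finset.prod_pow, entry_pow_card]

/-- The action of `G` on the tensor algebra `TV` of `V = ℂ^n` induced by the action on `V`. -/
def tensorAction (n ℓ : ℕ) : diagGroup n ℓ →*
    (TensorAlgebra ℂ (Fin n → ℂ) ≃ₐ[ℂ] TensorAlgebra ℂ (Fin n → ℂ)) :=
  let f : diagGroup n ℓ → (TensorAlgebra ℂ (Fin n → ℂ) →ₐ[ℂ] TensorAlgebra ℂ (Fin n → ℂ)) :=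
    fun g => TensorAlgebra.lift ℂ ((TensorAlgebra.ι ℂ).comp
      (SpecialLinearGroup.toLin' (g : SpecialLinearGroup (Fin n) ℂ)).toLinearMap)
  have hmul : ∀ g h, f (g * h) = (f g).comp (f h) := fun g h => by
    apply TensorAlgebra.hom_ext
    refine LinearMap.ext fun v => ?_
    simp [f]
  have hone : f 1 = AlgHom.id ℂ _ := by
    apply TensorAlgebra.hom_ext
    refine LinearMap.ext fun v => ?_
    simp [f]
  { toFun := fun g => AlgEquiv.ofAlgHom (f g) (f g⁻¹)
      (by rw [← hmul, mul_inv_cancel, hone]) (by rw [← hmul, inv_mul_cancel, hone])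
    map_one' := by
      ext a
      exact DFunLike.congr_fun hone a
    map_mul' := fun g h => by
      ext a
      exact DFunLike.congr_fun (hmul g h) a }

theorem tensorAction_ι (g : diagGroup n ℓ) (v : Fin n → ℂ) :
    tensorAction n ℓ g (TensorAlgebra.ι ℂ v) = TensorAlgebra.ι ℂ
      (((g : SpecialLinearGroup (Fin n) ℂ) : Matrix (Fin n) (Fin n) ℂ) *ᵥ v) := by
  simp [tensorAction, SpecialLinearGroup.toLin'_apply]

variable [NeZero ℓ] {ζ : ℂ}

/-- `ζ` as a unit of `ℂ`. -/
def zetaUnit (hζ : IsPrimitiveRoot ζ ℓ) : ℂˣ := Units.mk0 ζ (hζ.ne_zero (NeZero.ne ℓ))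

theorem coe_zetaUnit (hζ : IsPrimitiveRoot ζ ℓ) : (zetaUnit hζ : ℂ) = ζ := rfl

theorem exists_exponent (hζ : IsPrimitiveRoot ζ ℓ) (g : diagGroup n ℓ) (k : ℕ) :
    ∃ i : ℕ, ζ ^ i = partialProd g k := by
  obtain ⟨i, -, hi⟩ := hζ.eq_pow_of_pow_eq_one (partialProd_pow_card g k)
  exact ⟨i, hi⟩

/-- The exponent (unique modulo `ℓ`) of `g_k` in the expression of `g` as a product of powers of
`g_0, …, g_{n-2}`. It is read off the diagonal entries: the product of the first `k + 1` diagonal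
entries of `g_0 ^ {i_0} ⋯ g_{n-2} ^ {i_{n-2}}` is `ζ ^ {i_k}`. See `prod_gen_pow_exponent`. -/
def exponent (hζ : IsPrimitiveRoot ζ ℓ) (g : diagGroup n ℓ) (k : ℕ) : ℕ :=
  (exists_exponent hζ g k).choose

theorem zeta_pow_exponent (hζ : IsPrimitiveRoot ζ ℓ) (g : diagGroup n ℓ) (k : ℕ) :
    ζ ^ exponent hζ g k = partialProd g k := (exists_exponent hζ g k).choose_spec

theorem zetaUnit_pow_exponent_one (hζ : IsPrimitiveRoot ζ ℓ) (k : ℕ) :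
    zetaUnit hζ ^ exponent hζ (1 : diagGroup n ℓ) k = 1 := by
  apply Units.ext
  rw [Units.val_pow_eq_pow_val, coe_zetaUnit, zeta_pow_exponent, partialProd_one, Units.val_one]

theorem zetaUnit_pow_exponent_mul (hζ : IsPrimitiveRoot ζ ℓ) (g h : diagGroup n ℓ) (k : ℕ) :
    zetaUnit hζ ^ exponent hζ (g * h) k =
      zetaUnit hζ ^ exponent hζ g k * zetaUnit hζ ^ exponent hζ h k := by
  apply Units.ext
  simp only [Units.val_mul, Units.val_pow_eq_pow_val, coe_zetaUnit, zeta_pow_exponent,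
    partialProd_mul]

/-- `α(g_0^{i_0} ⋯ g_{n-2}^{i_{n-2}}, g_0^{j_0} ⋯ g_{n-2}^{j_{n-2}})
  = ζ ^ (- i_0 j_1 - i_1 j_2 - ⋯ - i_{n-3} j_{n-2})`, with indices starting at `0`. -/
def cocycleFun (hζ : IsPrimitiveRoot ζ ℓ) (g h : diagGroup n ℓ) : ℂˣ :=
  zetaUnit hζ ^
    (-∑ k ∈ Finset.range (n - 2), (exponent hζ g k : ℤ) * (exponent hζ h (k + 1) : ℤ))

theorem cocycleFun_eq (hζ : IsPrimitiveRoot ζ ℓ) (g h : diagGroup n ℓ) :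
    cocycleFun hζ g h = (∏ k ∈ Finset.range (n - 2),
      zetaUnit hζ ^ (exponent hζ g k * exponent hζ h (k + 1)))⁻¹ := by
  rw [cocycleFun, _root_.zpow_neg, Finset.prod_pow_eq_pow_sum, ← zpow_natCast]
  push_cast
  rfl

theorem cocycleFun_mul_left (hζ : IsPrimitiveRoot ζ ℓ) (g g' h : diagGroup n ℓ) :
    cocycleFun hζ (g * g') h = cocycleFun hζ g h * cocycleFun hζ g' h := by
  simp only [cocycleFun_eq, pow_mul, zetaUnit_pow_exponent_mul, mul_pow, Finset.prod_mul_distrib,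
    mul_inv]

theorem cocycleFun_mul_right (hζ : IsPrimitiveRoot ζ ℓ) (g h h' : diagGroup n ℓ) :
    cocycleFun hζ g (h * h') = cocycleFun hζ g h * cocycleFun hζ g h' := by
  simp only [cocycleFun_eq, pow_mul', zetaUnit_pow_exponent_mul, mul_pow,
    Finset.prod_mul_distrib, mul_inv]

/-- The `2`-cocycle `α` of `G`. -/
def cocycle (n : ℕ) (hζ : IsPrimitiveRoot ζ ℓ) : NormalizedCocycle ℂ (diagGroup n ℓ) where
  toFun := cocycleFun hζ
  map_one_left g := by
    simp only [cocycleFun_eq, pow_mul, zetaUnit_pow_exponent_one, one_pow, Finset.prod_const_one,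
      inv_one]
  map_one_right g := by
    simp only [cocycleFun_eq, pow_mul', zetaUnit_pow_exponent_one, one_pow, Finset.prod_const_one,
      inv_one]
  cocycle g h m := by
    rw [cocycleFun_mul_left, cocycleFun_mul_right, ← mul_assoc, mul_comm]

/-- The crossed product `TV #_α G`. -/
abbrev TensorCrossed (n : ℕ) (hζ : IsPrimitiveRoot ζ ℓ) : Type :=
  CrossedProduct (tensorAction n ℓ) (cocycle n hζ)

/-- `x_i`, the `i`-th standard basis vector of `V`, in `TV #_α G`. -/
def preX (hζ : IsPrimitiveRoot ζ ℓ) (i : Fin n) : TensorCrossed n hζ :=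
  CrossedProduct.single 1 (TensorAlgebra.ι ℂ (Pi.single i 1))

/-- A group element `g` in `TV #_α G`. -/
def preG (hζ : IsPrimitiveRoot ζ ℓ) (g : diagGroup n ℓ) : TensorCrossed n hζ :=
  CrossedProduct.single g 1

variable [NeZero n]

/-- The element `g_i` of `G`: it multiplies `x_i` by `ζ`, `x_{i+1}` by `ζ⁻¹`, and fixes the other
`x_j`. Indices are elements of `Fin n = {0, …, n - 1}`, and `i + 1` is taken modulo `n`. -/
def gen (hζ : IsPrimitiveRoot ζ ℓ) (i : Fin n) : diagGroup n ℓ :=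
  ⟨(⟨diagonal fun j => (if j = i then ζ else 1) * (if j = i + 1 then ζ⁻¹ else 1), by
      rw [det_diagonal, Finset.prod_mul_distrib]
      simp [hζ.ne_zero (NeZero.ne ℓ)]⟩ : SpecialLinearGroup (Fin n) ℂ), isDiag_diagonal _, by
      apply Subtype.ext
      change (diagonal _ : Matrix (Fin n) (Fin n) ℂ) ^ ℓ = 1
      rw [diagonal_pow, ← diagonal_one]
      congr 1
      funext j
      simp only [Pi.pow_apply, mul_pow, ite_pow, inv_pow, hζ.pow_eq_one]
      simp⟩

theorem entry_gen (hζ : IsPrimitiveRoot ζ ℓ) (i j : Fin n) :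
    entry (gen hζ i) j = (if j = i then ζ else 1) * (if j = i + 1 then ζ⁻¹ else 1) :=
  diagonal_apply_eq _ _

theorem partialProd_gen (hζ : IsPrimitiveRoot ζ ℓ) {k : ℕ} (hk : k + 1 < n) (m : ℕ) :
    partialProd (gen hζ (Fin.ofNat n k)) m = if m = k then ζ else 1 := by
  have h0 := hζ.ne_zero (NeZero.ne ℓ)
  have hk1 : (Fin.ofNat n k).val = k := Nat.mod_eq_of_lt (by omega)
  have hk2 : (Fin.ofNat n k + 1).val = k + 1 := by
    rw [Fin.val_add, hk1, Fin.val_one', Nat.add_mod_mod, Nat.mod_eq_of_lt hk]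
  simp only [partialProd, entry_gen, Finset.prod_mul_distrib, Finset.prod_ite_eq',
    Finset.mem_filter, Finset.mem_univ, true_and, hk1, hk2]
  split_ifs <;> first | omega | simp [h0]

theorem partialProd_prod_gen (hζ : IsPrimitiveRoot ζ ℓ) (i : ℕ → ℤ) {m : ℕ} (hm : m + 1 < n) :
    partialProd (∏ k ∈ Finset.range (n - 1), gen hζ (Fin.ofNat n k) ^ i k) m = ζ ^ i m := by
  let f : diagGroup n ℓ →* ℂ :=
    { toFun := fun g => partialProd g m
      map_one' := partialProd_one m
      map_mul' := fun g h => partialProd_mul g h m }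
  change f _ = _
  rw [map_prod, Finset.prod_eq_single m]
  · rw [map_zpow]
    change partialProd _ m ^ _ = _
    rw [partialProd_gen hζ hm, if_pos rfl]
  · intro k hk hkm
    rw [Finset.mem_range] at hk
    rw [map_zpow]
    change partialProd _ m ^ _ = _
    rw [partialProd_gen hζ (by omega), if_neg (Ne.symm hkm), _root_.one_zpow]
  · intro h
    rw [Finset.mem_range] at h
    omega

theorem zetaUnit_pow_exponent_prod_gen (hζ : IsPrimitiveRoot ζ ℓ) (i : ℕ → ℤ) {m : ℕ}
    (hm : m + 1 < n) :
    zetaUnit hζ ^ exponent hζ (∏ k ∈ Finset.range (n - 1), gen hζ (Fin.ofNat n k) ^ i k) m =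
      zetaUnit hζ ^ i m := by
  apply Units.ext
  rw [Units.val_pow_eq_pow_val, Units.val_zpow_eq_zpow_val, coe_zetaUnit, zeta_pow_exponent,
    partialProd_prod_gen hζ i hm]

/-- The expression of `g` as a product of powers of `g_0, …, g_{n-2}`. -/
theorem prod_gen_pow_exponent (hζ : IsPrimitiveRoot ζ ℓ) (g : diagGroup n ℓ) :
    ∏ k ∈ Finset.range (n - 1), gen hζ (Fin.ofNat n k) ^ exponent hζ g k = g := by
  set h := ∏ k ∈ Finset.range (n - 1), gen hζ (Fin.ofNat n k) ^ exponent hζ g k with hh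
  have hlast : ∀ u : diagGroup n ℓ, partialProd u (n - 1) = 1 := fun u => by
    have h1 := (u : SpecialLinearGroup (Fin n) ℂ).2
    rw [coe_eq_diagonal, det_diagonal] at h1
    rw [partialProd, Finset.filter_true_of_mem (fun j _ => by omega), h1]
  have key : ∀ m < n, partialProd h m = partialProd g m := fun m hm => by
    rcases Nat.lt_or_ge (m + 1) n with hm' | hm'
    · have h1 := partialProd_prod_gen hζ (fun k => (exponent hζ g k : ℤ)) hm'
      simp only [zpow_natCast] at h1
      rw [hh, h1, zeta_pow_exponent]
    · obtain rfl : m = n - 1 := by omega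
      rw [hlast, hlast]
  have hsucc : ∀ (u : diagGroup n ℓ) (m : ℕ) (hm : m + 1 < n),
      partialProd u (m + 1) = entry u ⟨m + 1, hm⟩ * partialProd u m := fun u m hm => by
    rw [partialProd, partialProd, ← Finset.prod_insert (by simp)]
    congr 1
    ext j
    simp [Fin.ext_iff]
    omega
  apply ext_entry
  rintro ⟨m, hm⟩
  cases m with
  | zero =>
    have hz : ∀ u : diagGroup n ℓ, partialProd u 0 = entry u ⟨0, hm⟩ := fun u => by
      rw [partialProd, Finset.prod_eq_single ⟨0, hm⟩]
      · intro j hj hj'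
        exact absurd (Fin.ext (Nat.le_zero.mp (Finset.mem_filter.mp hj).2)) hj'
      · simp
    rw [← hz, ← hz, key 0 hm]
  | succ m =>
    have h1 := key (m + 1) hm
    rw [hsucc h m hm, hsucc g m hm, key m (by omega)] at h1
    refine mul_right_cancel₀ (fun h0 => ?_) h1
    have h2 := partialProd_pow_card g m
    rw [h0, zero_pow (NeZero.ne ℓ)] at h2
    exact zero_ne_one h2

/-- The defining formula of the cocycle `α`. -/
theorem cocycleFun_prod_gen (hζ : IsPrimitiveRoot ζ ℓ) (i j : ℕ → ℤ) :
    cocycleFun hζ (∏ k ∈ Finset.range (n - 1), gen hζ (Fin.ofNat n k) ^ i k)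
      (∏ k ∈ Finset.range (n - 1), gen hζ (Fin.ofNat n k) ^ j k) =
    zetaUnit hζ ^ (-∑ k ∈ Finset.range (n - 2), i k * j (k + 1)) := by
  rw [cocycleFun_eq, _root_.zpow_neg]
  congr 1
  have hsum : ∀ (s : Finset ℕ) (f : ℕ → ℤ),
      zetaUnit hζ ^ (∑ k ∈ s, f k) = ∏ k ∈ s, zetaUnit hζ ^ f k := fun s f => by
    classical
    induction s using Finset.induction_on with
    | empty => simp
    | insert a s ha ih => rw [Finset.sum_insert ha, Finset.prod_insert ha, _root_.zpow_add, ih]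
  rw [hsum]
  refine Finset.prod_congr rfl fun k hk => ?_
  rw [Finset.mem_range] at hk
  rw [pow_mul, zetaUnit_pow_exponent_prod_gen hζ i (by omega), ← zpow_natCast, ← _root_.zpow_mul,
    mul_comm, _root_.zpow_mul, zpow_natCast, zetaUnit_pow_exponent_prod_gen hζ j (by omega),
    ← _root_.zpow_mul, mul_comm]

/-- `|i - j| ∉ {1, n - 1}`. -/
def NonAdjacent (i j : Fin n) : Prop :=
  |(i : ℤ) - (j : ℤ)| ≠ 1 ∧ |(i : ℤ) - (j : ℤ)| ≠ (n : ℤ) - 1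

instance (i j : Fin n) : Decidable (NonAdjacent i j) := by
  unfold NonAdjacent; infer_instance

/-- The defining relations of `H`. -/
inductive HeckeRel (hζ : IsPrimitiveRoot ζ ℓ) (t : Fin n → ℂ) :
    TensorCrossed n hζ → TensorCrossed n hζ → Prop
  | adjacent (i : Fin n) : HeckeRel hζ t
      (preX hζ i * preX hζ (i + 1) - preX hζ (i + 1) * preX hζ i) (t i • preG hζ (gen hζ i))
  | nonAdjacent (i j : Fin n) (h : NonAdjacent i j) : HeckeRel hζ t
      (preX hζ i * preX hζ j - preX hζ j * preX hζ i) 0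

/-- The twisted graded Hecke algebra `H`, the quotient of `TV #_α G` by the relations. -/
abbrev Hecke (hζ : IsPrimitiveRoot ζ ℓ) (t : Fin n → ℂ) : Type := RingQuot (HeckeRel hζ t)

/-- The image of `x_i` in `H`. -/
def heckeX (hζ : IsPrimitiveRoot ζ ℓ) (t : Fin n → ℂ) (i : Fin n) : Hecke hζ t :=
  RingQuot.mkAlgHom ℂ (HeckeRel hζ t) (preX hζ i)

/-- The image of `g_i` in `H`. -/
def heckeG (hζ : IsPrimitiveRoot ζ ℓ) (t : Fin n → ℂ) (i : Fin n) : Hecke hζ t :=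
  RingQuot.mkAlgHom ℂ (HeckeRel hζ t) (preG hζ (gen hζ i))

/-- The set `J` of subsets of the index set without two cyclically adjacent elements. -/
def indexJ (n : ℕ) [NeZero n] : Finset (Finset (Fin n)) :=
  Finset.univ.filter fun S => ∀ r ∈ S, ∀ s ∈ S, NonAdjacent r s

/-- `ε_i`, the integer vector with entries `1` at `i` and `i + 1` (modulo `n`), `0` elsewhere. -/
def epsilon (i : Fin n) : Fin n → ℤ := fun j => if j = i ∨ j = i + 1 then 1 else 0

/-- The vector `δ - ∑_{i ∈ S} ε_i`. -/
def deltaSub (S : Finset (Fin n)) : Fin n → ℤ := fun j => 1 - ∑ i ∈ S, epsilon i j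

theorem deltaSub_nonneg {S : Finset (Fin n)} (hS : S ∈ indexJ n) (j : Fin n) :
    0 ≤ deltaSub S j := by
  have hS' : ∀ r ∈ S, ∀ s ∈ S, NonAdjacent r s := (Finset.mem_filter.mp hS).2
  have hcard : (S.filter fun i => j = i ∨ j = i + 1).card ≤ 1 := by
    rw [Finset.card_le_one]
    have hadj : ∀ i : Fin n, i + 1 = i ∨ ¬ NonAdjacent (i + 1) i := fun i => by
      have hi := i.2
      have hv : (i + 1).val = (i.val + 1) % n := by
        rw [Fin.val_add, Fin.val_one', Nat.add_mod_mod]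
      rcases Nat.lt_or_ge (i.val + 1) n with h | h
      · right
        rw [Nat.mod_eq_of_lt h] at hv
        rintro ⟨h1, -⟩
        apply h1
        rw [hv]
        simp
      · have h' : i.val + 1 = n := by omega
        rw [h', Nat.mod_self] at hv
        right
        rintro ⟨-, h2⟩
        apply h2
        rw [hv, abs_sub_comm, abs_of_nonneg] <;> omega
    intro a ha b hb
    rw [Finset.mem_filter] at ha hb
    obtain ⟨haS, ha⟩ := ha
    obtain ⟨hbS, hb⟩ := hb
    rcases ha with rfl | ha <;> rcases hb with rfl | hb
    · rfl
    · rcases hadj b with h | h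
      · rw [hb, h]
      · exact absurd (hS' _ (hb ▸ haS) _ hbS) h
    · rcases hadj a with h | h
      · rw [ha, h]
      · exact absurd (hS' _ (ha ▸ hbS) _ haS) h
    · exact add_right_cancel (ha.symm.trans hb)
  have hsum : ∑ i ∈ S, epsilon i j = ((S.filter fun i => j = i ∨ j = i + 1).card : ℤ) := by
    simp [epsilon]
  rw [deltaSub, hsum]
  omega

/-- `τ_i = t_i / (ζ - 1)`, except that the last one is `ζ t_i / (ζ - 1)`. -/
def tau (ζ : ℂ) (t : Fin n → ℂ) (i : Fin n) : ℂ :=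
  if (i : ℕ) + 1 = n then ζ * t i / (ζ - 1) else t i / (ζ - 1)

/-- `τ̃_i = τ_i ^ ℓ`, except that the last one is `(-1) ^ (n (ℓ - 1)) τ_i ^ ℓ`. -/
def tauTilde (ℓ : ℕ) (ζ : ℂ) (t : Fin n → ℂ) (i : Fin n) : ℂ :=
  if (i : ℕ) + 1 = n then (-1) ^ (n * (ℓ - 1)) * tau ζ t i ^ ℓ else tau ζ t i ^ ℓ

/-- `ν_r = (-1) ^ r (ℓ / (ℓ - r)) binom(ℓ - r, r)` for `0 ≤ r ≤ ℓ / 2`. -/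
def nu (ℓ r : ℕ) : ℂ := (-1) ^ r * ((ℓ : ℂ) / ((ℓ : ℂ) - (r : ℂ))) * ((ℓ - r).choose r : ℂ)

/-- The element `w = ∑_{S ∈ J} (∏_{i ∈ S} τ_i) x ^ (δ - ∑_{i ∈ S} ε_i) g_{i_1} * ⋯ * g_{i_k}` of
`H`. Both products of noncommuting factors are taken in increasing order of the indices; the
exponents are nonnegative, see `deltaSub_nonneg`. -/
def heckeW (hζ : IsPrimitiveRoot ζ ℓ) (t : Fin n → ℂ) : Hecke hζ t :=
  ∑ S ∈ indexJ n, (∏ i ∈ S, tau ζ t i) •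
    ((List.ofFn fun j => heckeX hζ t j ^ (deltaSub S j).toNat).prod *
      (S.sort.map (heckeG hζ t)).prod)

/-- The polynomial `F`; the variable `a_i` is `X (some i)`, the variable `b` is `X none`. -/
def relF (ℓ : ℕ) (ζ : ℂ) (t : Fin n → ℂ) : MvPolynomial (Option (Fin n)) ℂ :=
  (∑ S ∈ indexJ n, MvPolynomial.C (∏ i ∈ S, tauTilde ℓ ζ t i) *
      ∏ j, MvPolynomial.X (some j) ^ (deltaSub S j).toNat) -
    ∑ r ∈ Finset.range (ℓ / 2 + 1),
      MvPolynomial.C ((-1) ^ (n * r) * ζ ^ ((n - 2) * r) * nu ℓ r * (∏ i, tau ζ t i) ^ r) *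
        MvPolynomial.X none ^ (ℓ - 2 * r)

end TwistedHecke

end

/-! The Hecke algebra H embeds in a quantum torus, and there both the relation and the center become
visible. The torus is the twisted group algebra of ℤⁿ × G: Laurent monomials X^p times group
elements, where g moved past X^q produces the eigenvalue of g on X^q and group elements multiply
through α. Put Y_i = t_i/(ζ-1) · X_i⁻¹ g_i. The X_i commute, the cocycle α is such that the Y_i
commute as well, and Y_i commutes with every X_j except X_i and X_{i+1}. Hence x_i ↦ X_i - Y_{i-1},
g ↦ g respects the relations of H: only mixed terms survive in a commutator (`heckeToTorus`).

The sum defining w is a continuant: it runs over the matchings of an n-cycle, with weight x_j on a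
free vertex j and τ_i g_i on an edge i = {i, i+1}. In the torus τ_i g_i = X_i Y_i, except for the
closing edge, where it is Y_i X_i; this explains the additional ζ in the last τ. With x_{i+1} =
X_{i+1} - Y_i the continuant telescopes to ∏ X_i + (-1)ⁿ ∏ Y_i (`cyclicContinuant_factor`), so that
w ↦ X^δ + c X^(-δ) with c = (-1)ⁿ ζ^(n-2) ∏ τ_i.

A product formula over the ℓ-th roots of unity gives x_{i+1}^ℓ ↦ X_{i+1}^ℓ - τ̃_i X_i^(-ℓ)
(`torusGen_pow`). These elements have the same shape as the x_i, so the same factorization, now in a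
commutative ring, shows that the continuant of the a_i with edge weights τ̃_i is U^ℓ + (cV)^ℓ, where
U = X^δ and V = X^(-δ). The Girard-Waring formula with the coefficients ν_r writes U^ℓ + (cV)^ℓ as a
polynomial in U + cV, the image of b, and UcV = c. This is the relation F = 0 (`map_relF_eq_zero`).

Everything else is a leading term argument for the total degree, where x_i has leading term X_i. The
monomials in the x_i times group elements span H, and their images have distinct leading terms, so H
embeds (`heckeToTorus_injective`). A monomial a^m b^k has leading exponent ℓm + kδ, and these are
distinct for k < ℓ; since -F is monic of degree ℓ in b, division by it shows that the kernel is (F)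
(`ker_polyToCenter`). Finally, the top degree part of a central element involves only the identity
of G and exponents p that are nonnegative and have all entries congruent modulo ℓ. Such p are
leading exponents of monomials in the a_i and b, and induction on the degree gives surjectivity
(`mem_range_of_map_mem_fil`). -/

namespace TwistedHecke

/-! ### Continuants of paths with noncommuting weights. -/

section Continuant

/-- Sets of edges `{i, i + 1}` (encoded by `i`) of the path with vertices `a, …, a + m - 1` without
common vertices. -/
def pathMatchings (a : ℕ) : ℕ → Finset (Finset ℕ)
  | 0 => {∅}
  | 1 => {∅}
  | m + 2 => pathMatchings a (m + 1) ∪ (pathMatchings a m).image (insert (a + m))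

theorem mem_pathMatchings (a : ℕ) : ∀ (m : ℕ) (S : Finset ℕ), S ∈ pathMatchings a m ↔
    (∀ i ∈ S, a ≤ i ∧ i + 1 < a + m) ∧ ∀ i ∈ S, i + 1 ∉ S
  | 0, S => by
    simp only [pathMatchings, Finset.mem_singleton]
    constructor
    · rintro rfl; simp
    · rintro ⟨h, -⟩
      exact Finset.eq_empty_of_forall_notMem fun i hi => by have := h i hi; omega
  | 1, S => by
    simp only [pathMatchings, Finset.mem_singleton]
    constructor
    · rintro rfl; simp
    · rintro ⟨h, -⟩
      exact Finset.eq_empty_of_forall_notMem fun i hi => by have := h i hi; omega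
  | m + 2, S => by
    simp only [pathMatchings, Finset.mem_union, Finset.mem_image, mem_pathMatchings a (m + 1),
      mem_pathMatchings a m]
    constructor
    · rintro (⟨h1, h2⟩ | ⟨T, ⟨h1, h2⟩, rfl⟩)
      · exact ⟨fun i hi => by have := h1 i hi; omega, h2⟩
      · refine ⟨fun i hi => ?_, fun i hi hi' => ?_⟩
        · rcases Finset.mem_insert.1 hi with rfl | hi
          · omega
          · have := h1 i hi; omega
        · rcases Finset.mem_insert.1 hi with rfl | hi
          · rcases Finset.mem_insert.1 hi' with h | hi'
            · omega
            · have := h1 _ hi'; omega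
          · have := h1 i hi
            rcases Finset.mem_insert.1 hi' with h | hi'
            · omega
            · exact h2 i hi hi'
    · rintro ⟨h1, h2⟩
      by_cases hm : a + m ∈ S
      · right
        refine ⟨S.erase (a + m), ⟨fun i hi => ?_, fun i hi hi' => ?_⟩, Finset.insert_erase hm⟩
        · have hi' := Finset.mem_of_mem_erase hi
          have h3 := h1 i hi'
          have h4 := Finset.ne_of_mem_erase hi
          have h5 : i + 1 ≠ a + m := fun h => h2 i hi' (h ▸ hm)
          omega
        · exact h2 i (Finset.mem_of_mem_erase hi) (Finset.mem_of_mem_erase hi')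
      · left
        refine ⟨fun i hi => ?_, h2⟩
        have h3 := h1 i hi
        have h4 : i ≠ a + m := fun h => hm (h ▸ hi)
        omega

variable {R : Type*} [Ring R]

/-- The ordered product of the `x j` over the vertices `j = a, …, a + m - 1` not on an edge of
`S`. -/
def vertexProd (x : ℕ → R) (a m : ℕ) (S : Finset ℕ) : R :=
  ((List.range m).map fun j => if a + j ∈ S ∨ ∃ i ∈ S, i + 1 = a + j then 1 else x (a + j)).prod

/-- The ordered product of the `s i` over `i ∈ S` with `a ≤ i < a + m`. -/
def edgeProd (s : ℕ → R) (a m : ℕ) (S : Finset ℕ) : R :=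
  ((List.range m).map fun j => if a + j ∈ S then s (a + j) else 1).prod

theorem vertexProd_succ (x : ℕ → R) (a m : ℕ) (S : Finset ℕ) :
    vertexProd x a (m + 1) S = vertexProd x a m S *
      if a + m ∈ S ∨ ∃ i ∈ S, i + 1 = a + m then 1 else x (a + m) := by
  simp [vertexProd, List.range_succ]

theorem edgeProd_succ (s : ℕ → R) (a m : ℕ) (S : Finset ℕ) :
    edgeProd s a (m + 1) S = edgeProd s a m S * if a + m ∈ S then s (a + m) else 1 := by
  simp [edgeProd, List.range_succ]

theorem vertexProd_congr (x : ℕ → R) {a m : ℕ} {S T : Finset ℕ}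
    (h : ∀ i < a + m, i ∈ S ↔ i ∈ T) : vertexProd x a m S = vertexProd x a m T := by
  unfold vertexProd
  congr 1
  refine List.map_congr_left fun j hj => ?_
  rw [List.mem_range] at hj
  refine if_congr (or_congr (h _ (by omega)) ?_) rfl rfl
  constructor
  · rintro ⟨i, hi, hi'⟩; exact ⟨i, (h i (by omega)).1 hi, hi'⟩
  · rintro ⟨i, hi, hi'⟩; exact ⟨i, (h i (by omega)).2 hi, hi'⟩

theorem edgeProd_congr (s : ℕ → R) {a m : ℕ} {S T : Finset ℕ}
    (h : ∀ i < a + m, a ≤ i → (i ∈ S ↔ i ∈ T)) : edgeProd s a m S = edgeProd s a m T := by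
  unfold edgeProd
  congr 1
  refine List.map_congr_left fun j hj => ?_
  rw [List.mem_range] at hj
  exact if_congr (h _ (by omega) (by omega)) rfl rfl

theorem commute_edgeProd {s : ℕ → R} {y : R} {a m : ℕ} {S : Finset ℕ}
    (h : ∀ i ∈ S, Commute (s i) y) : Commute (edgeProd s a m S) y := by
  induction m with
  | zero => simp [edgeProd]
  | succ m ih =>
    rw [edgeProd_succ]
    refine ih.mul_left ?_
    split_ifs with hm
    · exact h _ hm
    · exact Commute.one_left _

/-- The continuant of the path with vertices `a, …, a + m - 1`: the sum over its matchings of the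
product of the weights of the free vertices and of the edges. -/
def pathContinuant (x s : ℕ → R) (a m : ℕ) : R :=
  ∑ S ∈ pathMatchings a m, vertexProd x a m S * edgeProd s a m S

theorem pathContinuant_zero (x s : ℕ → R) (a : ℕ) : pathContinuant x s a 0 = 1 := by
  simp [pathContinuant, pathMatchings, vertexProd, edgeProd]

theorem pathContinuant_one (x s : ℕ → R) (a : ℕ) : pathContinuant x s a 1 = x a := by
  simp [pathContinuant, pathMatchings, vertexProd, edgeProd]

/-- The usual continuant recursion: either the last vertex is free, or it lies on the last edge `a +
m`. The commutation hypothesis moves the weight of the free last vertex to the right of all the edge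
weights. -/
theorem pathContinuant_add_two {x s : ℕ → R} (hc : ∀ i j, i + 1 < j → Commute (s i) (x j))
    (a m : ℕ) : pathContinuant x s a (m + 2) =
      pathContinuant x s a (m + 1) * x (a + m + 1) + pathContinuant x s a m * s (a + m) := by
  have hdisj : Disjoint (pathMatchings a (m + 1))
      ((pathMatchings a m).image (insert (a + m))) := by
    rw [Finset.disjoint_left]
    rintro S hS hS'
    obtain ⟨T, -, rfl⟩ := Finset.mem_image.1 hS'
    have := ((mem_pathMatchings _ _ _).1 hS).1 (a + m) (Finset.mem_insert_self _ _)
    omega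
  have hinj : Set.InjOn (insert (a + m)) (pathMatchings a m : Set (Finset ℕ)) := by
    intro S hS T hT h
    have hnot : ∀ U ∈ pathMatchings a m, a + m ∉ U := fun U hU hm => by
      have := ((mem_pathMatchings _ _ _).1 hU).1 _ hm; omega
    rw [← Finset.erase_insert (hnot S hS), ← Finset.erase_insert (hnot T hT)]
    exact congrArg (fun U => Finset.erase U (a + m)) h
  rw [pathContinuant, pathMatchings, Finset.sum_union hdisj, Finset.sum_image hinj,
    pathContinuant, pathContinuant, Finset.sum_mul, Finset.sum_mul]
  congr 1
  · refine Finset.sum_congr rfl fun S hS => ?_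
    obtain ⟨h1, h2⟩ := (mem_pathMatchings _ _ _).1 hS
    have hn1 : ¬ (a + (m + 1) ∈ S ∨ ∃ i ∈ S, i + 1 = a + (m + 1)) := by
      rintro (h | ⟨i, hi, h⟩)
      · have := h1 _ h; omega
      · have := h1 _ hi; omega
    have hn2 : a + (m + 1) ∉ S := fun h => hn1 (Or.inl h)
    rw [vertexProd_succ, edgeProd_succ, if_neg hn1, if_neg hn2, mul_one, mul_assoc, mul_assoc]
    congr 1
    refine (commute_edgeProd fun i hi => ?_).symm.eq
    have := h1 _ hi
    exact hc _ _ (by omega)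
  · refine Finset.sum_congr rfl fun S hS => ?_
    obtain ⟨h1, h2⟩ := (mem_pathMatchings _ _ _).1 hS
    have hlt : ∀ i < a + m, i ∈ insert (a + m) S ↔ i ∈ S := fun i hi => by
      rw [Finset.mem_insert]
      exact or_iff_right (by omega)
    have hn1 : a + (m + 1) ∈ insert (a + m) S ∨ ∃ i ∈ insert (a + m) S, i + 1 = a + (m + 1) :=
      Or.inr ⟨a + m, Finset.mem_insert_self _ _, rfl⟩
    have hn2 : a + (m + 1) ∉ insert (a + m) S := by
      rw [Finset.mem_insert]
      rintro (h | h)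
      · omega
      · have := h1 _ h; omega
    rw [vertexProd_succ, vertexProd_succ, edgeProd_succ, edgeProd_succ, if_pos hn1,
      if_neg hn2, if_pos (Or.inl (Finset.mem_insert_self _ _)),
      if_pos (Finset.mem_insert_self _ _), vertexProd_congr x hlt,
      edgeProd_congr s fun i hi _ => hlt i hi, mul_one, mul_one, mul_one, mul_assoc]

theorem commute_pathContinuant {x s : ℕ → R} (hc : ∀ i j, i + 1 < j → Commute (s i) (x j))
    {y : R} {a N : ℕ} (hx : ∀ j, a ≤ j → j < N → Commute y (x j))
    (hs : ∀ j, a ≤ j → j + 1 < N → Commute y (s j)) :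
    ∀ m, a + m ≤ N → Commute y (pathContinuant x s a m)
  | 0, _ => by rw [pathContinuant_zero]; exact Commute.one_right _
  | 1, h => by rw [pathContinuant_one]; exact hx a le_rfl (by omega)
  | m + 2, h => by
    rw [pathContinuant_add_two hc]
    exact ((commute_pathContinuant hc hx hs (m + 1) (by omega)).mul_right
      (hx _ (by omega) (by omega))).add_right
      ((commute_pathContinuant hc hx hs m (by omega)).mul_right (hs _ (by omega) (by omega)))

section Telescope

variable {x s X Y : ℕ → R} {N : ℕ} (hc : ∀ i j, i + 1 < j → Commute (s i) (x j))
  (hx : ∀ j, j + 1 < N → x (j + 1) = X (j + 1) - Y j) (hs : ∀ j, j + 1 < N → s j = X j * Y j)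

include hc hx hs

/-- Under the substitution the second order recursion degenerates: the defect K_{m+1} - K_m X_m is
multiplied by the single factor -Y at each step. This is the source of the telescoping. -/
theorem pathContinuant_sub_step (a m : ℕ) (h : a + m + 1 < N) :
    pathContinuant x s a (m + 2) - pathContinuant x s a (m + 1) * X (a + m + 1) =
      -(pathContinuant x s a (m + 1) - pathContinuant x s a m * X (a + m)) * Y (a + m) := by
  rw [pathContinuant_add_two hc, hx _ h, hs _ h]
  noncomm_ring

theorem pathContinuant_zero_sub {y : R} (h0 : x 0 = X 0 - y) (m : ℕ) (h : m < N) :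
    pathContinuant x s 0 (m + 1) - pathContinuant x s 0 m * X m =
      (-1) ^ (m + 1) * (y * ((List.range m).map Y).prod) := by
  induction m with
  | zero => simp [pathContinuant_zero, pathContinuant_one, h0]
  | succ m ih =>
    have h1 := pathContinuant_sub_step hc hx hs 0 m (by omega)
    simp only [zero_add] at h1
    rw [h1, ih (by omega), List.range_succ]
    simp only [List.map_append, List.map_cons, List.map_nil, List.prod_append, List.prod_cons,
      List.prod_nil, mul_one, pow_succ, mul_assoc, neg_mul, mul_neg]

/-- The defect for the path starting at 1. Here the first vertex itself contributes the factor `Y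
0`, so there is one more Y than there are steps. -/
theorem pathContinuant_one_sub (m : ℕ) (h : m + 1 < N) :
    pathContinuant x s 1 (m + 1) - pathContinuant x s 1 m * X (m + 1) =
      (-1) ^ (m + 1) * ((List.range (m + 1)).map Y).prod := by
  induction m with
  | zero =>
    have := hx 0 h
    simp only [zero_add] at this
    simp [pathContinuant_zero, pathContinuant_one, this]
  | succ m ih =>
    have h1 := pathContinuant_sub_step hc hx hs 1 m (by omega)
    rw [show 1 + m + 1 = m + 1 + 1 by omega, show 1 + m = m + 1 by omega] at h1
    rw [h1, ih (by omega), List.range_succ (n := m + 1)]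
    simp only [List.map_append, List.map_cons, List.map_nil, List.prod_append, List.prod_cons,
      List.prod_nil, mul_one, pow_succ, mul_assoc, neg_mul, mul_neg]

/-- Opening the cycle at vertex 0, with y in the place of the Y of the closing edge. The middle term
is the one that the matchings containing the closing edge will cancel; the outer terms are the two
products of the factorization. -/
theorem pathContinuant_zero_eq {y : R} (h0 : x 0 = X 0 - y) (m : ℕ) (h : m + 1 < N) :
    pathContinuant x s 0 (m + 2) = ((List.range (m + 2)).map X).prod -
      y * pathContinuant x s 1 m * X (m + 1) +
      (-1) ^ m * (y * ((List.range (m + 1)).map Y).prod) := by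
  induction m with
  | zero =>
    have h1 := pathContinuant_zero_sub hc hx hs h0 1 h
    rw [sub_eq_iff_eq_add, pathContinuant_one, h0] at h1
    rw [h1]
    simp [pathContinuant_zero, List.range_succ]
    noncomm_ring
  | succ m ih =>
    have h1 := pathContinuant_zero_sub hc hx hs h0 (m + 2) h
    have h2 := pathContinuant_one_sub hc hx hs m (by omega)
    rw [sub_eq_iff_eq_add] at h1 h2
    rw [h1, ih (by omega), h2, List.range_succ (n := m + 2)]
    simp only [List.map_append, List.map_cons, List.map_nil, List.prod_append, List.prod_cons,
      List.prod_nil, mul_one, pow_succ, mul_assoc, neg_mul, mul_neg, add_mul, sub_mul,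
      mul_add]
    have hcomm : y * ((-1) ^ m * (((List.range (m + 1)).map Y).prod * X (m + 1 + 1))) =
        (-1) ^ m * (y * (((List.range (m + 1)).map Y).prod * X (m + 1 + 1))) := by
      rw [← mul_assoc, ← mul_assoc, ((Commute.neg_one_right y).pow_right m).eq,
        mul_assoc, mul_assoc]
    rw [hcomm]
    noncomm_ring

end Telescope

end Continuant

end TwistedHecke

namespace TwistedHecke

/-! ### Continuants of cycles and their factorization. -/

section CyclicContinuant

variable {n : ℕ}

/-- Extension by zero of a function on `Fin n`. -/
def extendZero {R : Type*} [Zero R] (f : Fin n → R) (j : ℕ) : R :=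
  if h : j < n then f ⟨j, h⟩ else 0

theorem extendZero_of_lt {R : Type*} [Zero R] (f : Fin n → R) {j : ℕ} (h : j < n) :
    extendZero f j = f ⟨j, h⟩ := dif_pos h

theorem extendZero_of_le {R : Type*} [Zero R] (f : Fin n → R) {j : ℕ} (h : n ≤ j) :
    extendZero f j = 0 := dif_neg (by omega)

theorem ofFn_eq_map_range {R : Type*} (f : Fin n → R) (F : ℕ → R) (h : ∀ j, f j = F j) :
    List.ofFn f = (List.range n).map F := by
  apply List.ext_getElem
  · simp
  · intro i h1 h2
    simp [h]

/-- The embedding of finite subsets of `Fin n` into finite subsets of `ℕ`. -/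
def valFinset (n : ℕ) : Finset (Fin n) ↪ Finset ℕ :=
  Finset.mapEmbedding Fin.valEmbedding |>.toEmbedding

theorem mem_valFinset (S : Finset (Fin n)) (i : ℕ) :
    i ∈ valFinset n S ↔ ∃ h : i < n, ⟨i, h⟩ ∈ S := by
  simp only [valFinset, RelEmbedding.coe_toEmbedding, Finset.mapEmbedding_apply, Finset.mem_map,
    Fin.valEmbedding_apply]
  constructor
  · rintro ⟨a, ha, rfl⟩
    exact ⟨a.2, ha⟩
  · rintro ⟨h, h'⟩
    exact ⟨_, h', rfl⟩

variable {R : Type*} [Ring R]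

/-- The sorted product over S is spread over the whole range, with factors 1 outside S, which is the
form in which the path recursion works. -/
theorem prod_sort_map (s : Fin n → R) (S : Finset (Fin n)) :
    (S.sort.map s).prod = edgeProd (extendZero s) 0 n (valFinset n S) := by
  have h1 : S.sort = (List.finRange n).filter (· ∈ S) := by
    refine List.Perm.eq_of_pairwise' (r := (· ≤ ·)) (Finset.pairwise_sort _ _) ?_ ?_
    · exact ((List.pairwise_le_finRange n).filter _)
    · rw [List.perm_ext_iff_of_nodup (Finset.sort_nodup _ _) ((List.nodup_finRange n).filter _)]
      simp
  have h2 : ∀ l : List (Fin n), ((l.filter (· ∈ S)).map s).prod =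
      (l.map fun i => if i ∈ S then s i else 1).prod := fun l => by
    induction l with
    | nil => simp
    | cons a l ih => by_cases h : a ∈ S <;> simp [h, ih]
  rw [h1, h2, edgeProd, ← List.ofFn_eq_map]
  congr 1
  apply ofFn_eq_map_range
  intro j
  rw [zero_add, extendZero_of_lt _ j.2]
  refine if_congr ?_ rfl rfl
  rw [mem_valFinset]
  exact ⟨fun h => ⟨j.2, h⟩, fun ⟨_, h⟩ => h⟩

variable [NeZero n]

theorem deltaSub_toNat (S : Finset (Fin n)) (j : Fin n) :
    (deltaSub S j).toNat = if j ∈ S ∨ ∃ i ∈ S, i + 1 = j then 0 else 1 := by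
  have hsum : ∑ i ∈ S, epsilon i j = ((S.filter fun i => j = i ∨ j = i + 1).card : ℤ) := by
    simp [epsilon]
  rw [deltaSub, hsum]
  split_ifs with h
  · have : 0 < (S.filter fun i => j = i ∨ j = i + 1).card := by
      rw [Finset.card_pos]
      rcases h with h | ⟨i, hi, h⟩
      · exact ⟨j, Finset.mem_filter.2 ⟨h, Or.inl rfl⟩⟩
      · exact ⟨i, Finset.mem_filter.2 ⟨hi, Or.inr h.symm⟩⟩
    omega
  · have : (S.filter fun i => j = i ∨ j = i + 1) = ∅ := by
      rw [Finset.filter_eq_empty_iff]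
      rintro i hi (rfl | h')
      · exact h (Or.inl hi)
      · exact h (Or.inr ⟨i, hi, h'.symm⟩)
    simp [this]

theorem val_add_one_of_lt' {i : Fin n} (h : i.val + 1 < n) : (i + 1).val = i.val + 1 := by
  rw [Fin.val_add, Fin.val_one', Nat.add_mod_mod, Nat.mod_eq_of_lt h]

theorem val_add_one_of_eq {i : Fin n} (h : i.val + 1 = n) : (i + 1).val = 0 := by
  rw [Fin.val_add, Fin.val_one', Nat.add_mod_mod, h, Nat.mod_self]

theorem nonAdjacent_iff (hn : 3 ≤ n) (i j : Fin n) : NonAdjacent i j ↔ i + 1 ≠ j ∧ j + 1 ≠ i := by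
  have hi := i.2
  have hj := j.2
  rw [NonAdjacent, Ne, Ne, Ne, Ne, Fin.ext_iff, Fin.ext_iff]
  rcases Nat.lt_or_ge (i.val + 1) n with h | h <;> rcases Nat.lt_or_ge (j.val + 1) n with h' | h'
  · rw [val_add_one_of_lt' h, val_add_one_of_lt' h']
    rcases abs_cases ((i : ℤ) - (j : ℤ)) with ⟨h1, h2⟩ | ⟨h1, h2⟩ <;> rw [h1] <;> omega
  · rw [val_add_one_of_lt' h, val_add_one_of_eq (by omega)]
    rcases abs_cases ((i : ℤ) - (j : ℤ)) with ⟨h1, h2⟩ | ⟨h1, h2⟩ <;> rw [h1] <;> omega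
  · rw [val_add_one_of_lt' h', val_add_one_of_eq (by omega)]
    rcases abs_cases ((i : ℤ) - (j : ℤ)) with ⟨h1, h2⟩ | ⟨h1, h2⟩ <;> rw [h1] <;> omega
  · rw [val_add_one_of_eq (by omega), val_add_one_of_eq (by omega)]
    rcases abs_cases ((i : ℤ) - (j : ℤ)) with ⟨h1, h2⟩ | ⟨h1, h2⟩ <;> rw [h1] <;> omega

theorem mem_indexJ (hn : 3 ≤ n) (S : Finset (Fin n)) : S ∈ indexJ n ↔ ∀ i ∈ S, i + 1 ∉ S := by
  simp only [indexJ, Finset.mem_filter, Finset.mem_univ, true_and, nonAdjacent_iff hn]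
  constructor
  · intro h i hi hi'
    exact (h i hi _ hi').1 rfl
  · intro h i hi j hj
    exact ⟨fun h' => h i hi (h' ▸ hj), fun h' => h j hj (h' ▸ hi)⟩

/-- Matchings of the cycle are split by the closing edge `n - 1`, which joins the vertices `n - 1`
and 0. If it is absent, the rest is a matching of the path 0, …, n - 1; if it is present, of the
path 1, …, n - 2. -/
theorem map_indexJ (hn : 3 ≤ n) : (indexJ n).map (valFinset n) =
    pathMatchings 0 n ∪ (pathMatchings 1 (n - 2)).image (insert (n - 1)) := by
  ext T
  simp only [Finset.mem_map, Finset.mem_union, Finset.mem_image, mem_pathMatchings, mem_indexJ hn]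
  constructor
  · rintro ⟨S, hS, rfl⟩
    have hsucc : ∀ i ∈ valFinset n S, i + 1 ∉ valFinset n S := fun i hi hi' => by
      obtain ⟨h, hi⟩ := (mem_valFinset _ _).1 hi
      obtain ⟨h', hi'⟩ := (mem_valFinset _ _).1 hi'
      refine hS _ hi ?_
      convert hi'
      exact val_add_one_of_lt' (i := ⟨i, h⟩) h'
    have hlt : ∀ i ∈ valFinset n S, i < n := fun i hi => ((mem_valFinset _ _).1 hi).1
    by_cases hl : n - 1 ∈ valFinset n S
    · right
      have h0 : 0 ∉ valFinset n S := fun h0 => by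
        obtain ⟨h, hl⟩ := (mem_valFinset _ _).1 hl
        obtain ⟨h', h0⟩ := (mem_valFinset _ _).1 h0
        refine hS _ hl ?_
        convert h0
        exact val_add_one_of_eq (i := ⟨n - 1, h⟩) (by simp; omega)
      refine ⟨(valFinset n S).erase (n - 1), ⟨fun i hi => ?_, fun i hi hi' => ?_⟩,
        Finset.insert_erase hl⟩
      · have h1 := Finset.mem_of_mem_erase hi
        have h2 := Finset.ne_of_mem_erase hi
        have h3 := hlt i h1
        have h4 : i ≠ 0 := fun h => h0 (h ▸ h1)
        have h5 : i + 1 ≠ n - 1 := fun h => hsucc i h1 (h ▸ hl)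
        omega
      · exact hsucc i (Finset.mem_of_mem_erase hi) (Finset.mem_of_mem_erase hi')
    · left
      refine ⟨fun i hi => ?_, hsucc⟩
      have h3 := hlt i hi
      have h5 : i ≠ n - 1 := fun h => hl (h ▸ hi)
      omega
  · intro h
    have hT : (∀ i ∈ T, i < n) ∧ (∀ i ∈ T, i + 1 ∉ T) ∧ ¬ (n - 1 ∈ T ∧ 0 ∈ T) := by
      rcases h with ⟨h1, h2⟩ | ⟨U, ⟨h1, h2⟩, rfl⟩
      · refine ⟨fun i hi => by have := h1 i hi; omega, h2, fun h => ?_⟩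
        have := h1 _ h.1
        omega
      · refine ⟨fun i hi => ?_, fun i hi hi' => ?_, fun h => ?_⟩
        · rcases Finset.mem_insert.1 hi with rfl | hi
          · omega
          · have := h1 i hi; omega
        · rcases Finset.mem_insert.1 hi with rfl | hi
          · rcases Finset.mem_insert.1 hi' with h | hi'
            · omega
            · have := h1 _ hi'; omega
          · rcases Finset.mem_insert.1 hi' with h | hi'
            · have := h1 _ hi; omega
            · exact h2 _ hi hi'
        · rcases Finset.mem_insert.1 h.2 with h | h
          · omega
          · have := h1 _ h; omega
    obtain ⟨h1, h2, h3⟩ := hT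
    refine ⟨Finset.univ.filter fun i : Fin n => i.val ∈ T, fun i hi hi' => ?_, ?_⟩
    · simp only [Finset.mem_filter, Finset.mem_univ, true_and] at hi hi'
      rcases Nat.lt_or_ge (i.val + 1) n with h | h
      · rw [val_add_one_of_lt' h] at hi'
        exact h2 _ hi hi'
      · have h' : i.val + 1 = n := by omega
        rw [val_add_one_of_eq h'] at hi'
        exact h3 ⟨by rwa [← h', Nat.add_sub_cancel], hi'⟩
    · ext i
      simp only [mem_valFinset, Finset.mem_filter, Finset.mem_univ, true_and]
      exact ⟨fun ⟨_, h⟩ => h, fun h => ⟨h1 i h, h⟩⟩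

theorem ofFn_pow_deltaSub (x : Fin n → R) (S : Finset (Fin n)) :
    List.ofFn (fun j => x j ^ (deltaSub S j).toNat) = (List.range n).map fun j =>
      if j ∈ valFinset n S ∨ ∃ i ∈ valFinset n S, (i + 1) % n = j then 1 else extendZero x j := by
  apply ofFn_eq_map_range
  intro j
  rw [deltaSub_toNat, extendZero_of_lt _ j.2]
  have hiff : (j ∈ S ∨ ∃ i ∈ S, i + 1 = j) ↔
      (j.val ∈ valFinset n S ∨ ∃ i ∈ valFinset n S, (i + 1) % n = j.val) := by
    refine or_congr ?_ ?_
    · rw [mem_valFinset]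
      exact ⟨fun h => ⟨j.2, h⟩, fun ⟨_, h⟩ => h⟩
    · constructor
      · rintro ⟨i, hi, rfl⟩
        refine ⟨i, (mem_valFinset _ _).2 ⟨i.2, hi⟩, ?_⟩
        rw [Fin.val_add, Fin.val_one', Nat.add_mod_mod]
      · rintro ⟨i, hi, h⟩
        obtain ⟨hi, h'⟩ := (mem_valFinset _ _).1 hi
        refine ⟨_, h', Fin.ext ?_⟩
        rw [Fin.val_add, Fin.val_one', Nat.add_mod_mod, h]
  by_cases h : j ∈ S ∨ ∃ i ∈ S, i + 1 = j
  · rw [if_pos h, if_pos (hiff.1 h), pow_zero]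
  · rw [if_neg h, if_neg (fun h' => h (hiff.2 h')), pow_one]

/-- The continuant of a cycle in terms of continuants of paths. -/
theorem cyclicContinuant_eq (hn : 3 ≤ n) (x s : Fin n → R) :
    ∑ S ∈ indexJ n, (List.ofFn fun j => x j ^ (deltaSub S j).toNat).prod * (S.sort.map s).prod =
      pathContinuant (extendZero x) (extendZero s) 0 n +
        pathContinuant (extendZero x) (extendZero s) 1 (n - 2) * extendZero s (n - 1) := by
  obtain ⟨m, rfl⟩ : ∃ m, n = m + 2 := ⟨n - 2, by omega⟩
  rw [Nat.add_sub_cancel, show m + 2 - 1 = m + 1 by omega]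
  set F : Finset ℕ → R := fun T => ((List.range (m + 2)).map fun j =>
      if j ∈ T ∨ ∃ i ∈ T, (i + 1) % (m + 2) = j then 1 else extendZero x j).prod *
    edgeProd (extendZero s) 0 (m + 2) T with hF
  have hterm : ∀ S : Finset (Fin (m + 2)), (List.ofFn fun j => x j ^ (deltaSub S j).toNat).prod *
      (S.sort.map s).prod = F (valFinset (m + 2) S) := fun S => by
    rw [hF, ofFn_pow_deltaSub, prod_sort_map]
  have hdisj : Disjoint (pathMatchings 0 (m + 2))
      ((pathMatchings 1 m).image (insert (m + 1))) := by
    rw [Finset.disjoint_left]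
    rintro S hS hS'
    obtain ⟨T, -, rfl⟩ := Finset.mem_image.1 hS'
    have := ((mem_pathMatchings _ _ _).1 hS).1 (m + 1) (Finset.mem_insert_self _ _)
    omega
  have hinj : Set.InjOn (insert (m + 1)) (pathMatchings 1 m : Set (Finset ℕ)) := by
    intro S hS T hT h
    have hnot : ∀ U ∈ pathMatchings 1 m, m + 1 ∉ U := fun U hU hm => by
      have := ((mem_pathMatchings _ _ _).1 hU).1 _ hm; omega
    rw [← Finset.erase_insert (hnot S hS), ← Finset.erase_insert (hnot T hT)]
    exact congrArg (fun U => Finset.erase U (m + 1)) h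
  have hmap := map_indexJ hn
  rw [Nat.add_sub_cancel, show m + 2 - 1 = m + 1 by omega] at hmap
  rw [Finset.sum_congr rfl fun S _ => hterm S, ← Finset.sum_map, hmap, Finset.sum_union hdisj,
    Finset.sum_image hinj, pathContinuant, pathContinuant, Finset.sum_mul]
  congr 1
  · refine Finset.sum_congr rfl fun T hT => ?_
    obtain ⟨h1, h2⟩ := (mem_pathMatchings _ _ _).1 hT
    rw [hF, vertexProd]
    dsimp only
    congr 2
    refine List.map_congr_left fun j hj => ?_
    rw [zero_add]
    refine if_congr (or_congr_right (exists_congr fun i => and_congr_right fun hi => ?_)) rfl rfl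
    rw [Nat.mod_eq_of_lt]
    have := h1 i hi; omega
  · refine Finset.sum_congr rfl fun T hT => ?_
    obtain ⟨h1, h2⟩ := (mem_pathMatchings _ _ _).1 hT
    rw [hF]
    dsimp only
    have hins : m + 1 ∈ insert (m + 1) T := Finset.mem_insert_self _ _
    have hedge : edgeProd (extendZero s) 0 (m + 2) (insert (m + 1) T) =
        edgeProd (extendZero s) 1 m T * extendZero s (m + 1) := by
      rw [edgeProd_succ, zero_add, if_pos hins, edgeProd, List.range_succ_eq_map, List.map_cons,
        List.prod_cons, if_neg, one_mul, List.map_map, edgeProd]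
      · congr 2
        refine List.map_congr_left fun j hj => ?_
        rw [List.mem_range] at hj
        simp only [Function.comp, zero_add, Nat.succ_eq_add_one, add_comm 1 j]
        refine if_congr ?_ rfl rfl
        rw [Finset.mem_insert]
        exact or_iff_right (by omega)
      · rw [Finset.mem_insert]
        rintro (h | h)
        · omega
        · have := h1 _ h; omega
    rw [hedge, ← mul_assoc]
    congr 2
    rw [List.range_succ, List.map_append, List.prod_append, List.map_cons, List.map_nil,
      List.prod_cons, List.prod_nil, if_pos (Or.inl hins), mul_one, mul_one,
      List.range_succ_eq_map, List.map_cons, List.prod_cons, if_pos, one_mul, List.map_map,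
      vertexProd]
    · congr 1
      refine List.map_congr_left fun j hj => ?_
      rw [List.mem_range] at hj
      simp only [Function.comp, Nat.succ_eq_add_one, add_comm 1 j]
      refine if_congr (or_congr ?_ ?_) rfl rfl
      · rw [Finset.mem_insert]
        exact or_iff_right (by omega)
      · constructor
        · rintro ⟨i, hi, h⟩
          rcases Finset.mem_insert.1 hi with rfl | hi
          -- The closing edge covers only vertex 0 through its successor, and the vertex considered
          -- here is positive.
          · rw [show m + 1 + 1 = m + 2 by omega, Nat.mod_self] at h
            omega
          · have := h1 i hi
            rw [Nat.mod_eq_of_lt (by omega)] at h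
            exact ⟨i, hi, h⟩
        · rintro ⟨i, hi, h⟩
          refine ⟨i, Finset.mem_insert_of_mem hi, ?_⟩
          rw [Nat.mod_eq_of_lt (by omega), h]
    · exact Or.inr ⟨m + 1, hins, Nat.mod_self _⟩

/-- Factorization of the continuant of a cycle whose weights come from variables `X i`, `Y i`. -/
theorem cyclicContinuant_factor (hn : 3 ≤ n) {x s X Y : Fin n → R}
    (hx : ∀ j, x (j + 1) = X (j + 1) - Y j)
    (hs : ∀ i : Fin n, i.val + 1 ≠ n → s i = X i * Y i)
    (hs' : ∀ i : Fin n, i.val + 1 = n → s i = Y i * X i)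
    (hXX : ∀ i j, Commute (X i) (X j)) (hYY : ∀ i j, Commute (Y i) (Y j))
    (hYX : ∀ i j, j ≠ i → j ≠ i + 1 → Commute (Y i) (X j)) :
    ∑ S ∈ indexJ n, (List.ofFn fun j => x j ^ (deltaSub S j).toNat).prod * (S.sort.map s).prod =
      (List.ofFn X).prod + (-1) ^ n * (List.ofFn Y).prod := by
  have hx1 : ∀ j, ∀ h : j + 1 < n, x ⟨j + 1, h⟩ = X ⟨j + 1, h⟩ - Y ⟨j, by omega⟩ := fun j h => by
    have h1 : (⟨j, by omega⟩ + 1 : Fin n) = ⟨j + 1, h⟩ :=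
      Fin.ext (val_add_one_of_lt' (i := (⟨j, by omega⟩ : Fin n)) h)
    rw [← h1, hx]
  have hYX' : ∀ i j (hi : i < n) (hj : j < n), j ≠ i → j ≠ (i + 1) % n →
      Commute (Y ⟨i, hi⟩) (X ⟨j, hj⟩) := fun i j hi hj h1 h2 => by
    refine hYX _ _ (fun h => h1 (Fin.ext_iff.1 h)) (fun h => h2 ?_)
    have := Fin.ext_iff.1 h
    rwa [Fin.val_add, Fin.val_one', Nat.add_mod_mod] at this
  have hc : ∀ i j, i + 1 < j → Commute (extendZero s i) (extendZero x j) := fun i j hij => by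
    rcases Nat.lt_or_ge j n with hj | hj
    · obtain ⟨j, rfl⟩ : ∃ k, j = k + 1 := ⟨j - 1, by omega⟩
      have hi : i + 1 < n := by omega
      rw [extendZero_of_lt _ hj, extendZero_of_lt _ (show i < n by omega), hx1,
        hs _ (by simp; omega)]
      refine Commute.mul_left (Commute.sub_right (hXX _ _) (hYX' _ _ _ _ ?_ ?_).symm)
        (Commute.sub_right (hYX' _ _ _ _ ?_ ?_) (hYY _ _))
      · omega
      · rw [Nat.mod_eq_of_lt (by omega)]; omega
      · omega
      · rw [Nat.mod_eq_of_lt (by omega)]; omega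
    · rw [extendZero_of_le _ hj]
      exact Commute.zero_right _
  obtain ⟨m, rfl⟩ : ∃ m, n = m + 2 := ⟨n - 2, by omega⟩
  rw [cyclicContinuant_eq hn, Nat.add_sub_cancel, show m + 2 - 1 = m + 1 by omega]
  -- Cyclically, vertex 0 follows the last one, so the element y of `pathContinuant_zero_eq` is the
  -- last Y.
  have hx0 : extendZero x 0 = extendZero X 0 - Y (Fin.last (m + 1)) := by
    rw [extendZero_of_lt _ (by omega), extendZero_of_lt _ (by omega)]
    have := hx (Fin.last (m + 1))
    rwa [Fin.last_add_one] at this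
  have hxS : ∀ j, j + 1 < m + 2 →
      extendZero x (j + 1) = extendZero X (j + 1) - extendZero Y j := fun j h => by
    rw [extendZero_of_lt _ h, extendZero_of_lt _ h, extendZero_of_lt _ (by omega), hx1]
  have hsS : ∀ j, j + 1 < m + 2 → extendZero s j = extendZero X j * extendZero Y j := fun j h => by
    rw [extendZero_of_lt _ (by omega), extendZero_of_lt _ (by omega),
      extendZero_of_lt _ (by omega), hs _ (by simp; omega)]
  rw [pathContinuant_zero_eq hc hxS hsS hx0 m (by omega)]
  -- The last Y can fail to commute only with the X of the last vertex and of vertex 0, and the path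
  -- 1, …, m involves neither. This lets the closing edge term cancel the middle term of
  -- `pathContinuant_zero_eq`.
  have hcomm : Commute (Y (Fin.last (m + 1)))
      (pathContinuant (extendZero x) (extendZero s) 1 m) := by
    refine commute_pathContinuant hc (N := m + 1) (fun j h1 h2 => ?_) (fun j h1 h2 => ?_) m
      (by omega)
    · obtain ⟨j, rfl⟩ : ∃ k, j = k + 1 := ⟨j - 1, by omega⟩
      rw [extendZero_of_lt _ (by omega), hx1]
      refine Commute.sub_right (hYX' _ _ _ _ (by omega) ?_) (hYY _ _)
      rw [show m + 1 + 1 = m + 2 by omega, Nat.mod_self]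
      omega
    · rw [extendZero_of_lt _ (by omega), hs _ (by simp; omega)]
      refine Commute.mul_right (hYX' _ _ _ _ (by omega) ?_) (hYY _ _)
      rw [show m + 1 + 1 = m + 2 by omega, Nat.mod_self]
      omega
  have hlast : extendZero s (m + 1) = Y (Fin.last (m + 1)) * extendZero X (m + 1) := by
    rw [extendZero_of_lt _ (by omega), extendZero_of_lt _ (by omega), hs' _ (by simp)]
    rfl
  have hYprod : ((List.range (m + 2)).map (extendZero Y)).prod =
      Y (Fin.last (m + 1)) * ((List.range (m + 1)).map (extendZero Y)).prod := by
    rw [List.range_succ, List.map_append, List.prod_append, List.map_cons, List.map_nil,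
      List.prod_cons, List.prod_nil, mul_one, extendZero_of_lt _ (show m + 1 < m + 2 by omega)]
    refine (Commute.list_prod_left _ _ fun z hz => ?_).eq
    obtain ⟨j, hj, rfl⟩ := List.mem_map.1 hz
    rw [List.mem_range] at hj
    rw [extendZero_of_lt _ (by omega)]
    exact hYY _ _
  rw [ofFn_eq_map_range X (extendZero X) fun j => (extendZero_of_lt X j.2).symm,
    ofFn_eq_map_range Y (extendZero Y) fun j => (extendZero_of_lt Y j.2).symm,
    hYprod, hlast, hcomm.eq, mul_assoc (pathContinuant _ _ _ _), pow_add]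
  simp only [even_two, Even.neg_pow, one_pow, mul_one]
  abel

end CyclicContinuant

end TwistedHecke

/-! ### The quantum torus. -/

noncomputable section

namespace CrossedProduct

variable {k E G B : Type*} [CommRing k] [Ring E] [Algebra k E] [Group G] [Ring B] [Algebra k B]
  {ρ : G →* (E ≃ₐ[k] E)} {α : NormalizedCocycle k G}

/-- The universal property of the crossed product. -/
def lift (f : E →ₐ[k] B) (u : G → B) (h1 : u 1 = 1)
    (hu : ∀ g h, u g * u h = (α.toFun g h : k) • u (g * h))
    (hf : ∀ g e, u g * f e = f (ρ g e) * u g) : CrossedProduct ρ α →ₐ[k] B :=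
  let F : CrossedProduct ρ α →ₗ[k] B :=
    { toFun := fun a => a.coeff.sum fun g r => f r * u g
      map_add' := fun a b => by
        classical
        rw [coeff_add, Finsupp.sum_add_index'] <;> intros <;> simp [add_mul]
      map_smul' := fun c a => by
        rw [coeff_smul, Finsupp.sum_smul_index' (by simp), RingHom.id_apply, Finsupp.smul_sum]
        simp }
  have hF : ∀ g r, F (single g r) = f r * u g := fun g r => by
    change Finsupp.sum (Finsupp.single g r) (fun g r => f r * u g) = _
    simp
  AlgHom.ofLinearMap F (by rw [one_def, hF, h1, map_one, one_mul]) fun a b => by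
    induction a using induction_on with
    | h0 => simp
    | hadd a a' h h' => simp only [add_mul, map_add, h, h']
    | hs g r =>
    induction b using induction_on with
    | h0 => simp
    | hadd a a' h h' => simp only [mul_add, map_add, h, h']
    | hs h s =>
      rw [single_mul_single, hF, hF, hF, mul_assoc (f r), ← mul_assoc (u g), hf, mul_assoc, hu,
        Units.smul_def, map_smul, map_mul]
      simp [mul_assoc]

theorem lift_single (f : E →ₐ[k] B) (u : G → B) (h1 : u 1 = 1)
    (hu : ∀ g h, u g * u h = (α.toFun g h : k) • u (g * h))
    (hf : ∀ g e, u g * f e = f (ρ g e) * u g) (g : G) (r : E) :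
    lift f u h1 hu hf (single g r) = f r * u g := by
  change Finsupp.sum (Finsupp.single g r) (fun g r => f r * u g) = _
  simp

/-- The coefficients of an element of the crossed product, as a linear map. -/
def coeffLinear : CrossedProduct ρ α →ₗ[k] (G →₀ E) where
  toFun := coeff
  map_add' _ _ := rfl
  map_smul' _ _ := rfl

end CrossedProduct

namespace TwistedHecke

variable {n ℓ : ℕ}

/-- The `j`-th diagonal entry as a homomorphism to the units of `ℂ`. -/
def entryUnit (j : Fin n) : diagGroup n ℓ →* ℂˣ :=
  MonoidHom.toHomUnits
    { toFun := fun g => entry g j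
      map_one' := entry_one j
      map_mul' := fun g h => entry_mul g h j }

theorem coe_entryUnit (j : Fin n) (g : diagGroup n ℓ) : (entryUnit j g : ℂ) = entry g j := rfl

/-- The eigenvalue of `g` on the Laurent monomial with exponent `p`. -/
def weight (p : Fin n → ℤ) : diagGroup n ℓ →* ℂˣ := ∏ j, (entryUnit j) ^ p j

theorem weight_apply (p : Fin n → ℤ) (g : diagGroup n ℓ) :
    weight p g = ∏ j, entryUnit j g ^ p j := by
  simp [weight]

theorem weight_add (p q : Fin n → ℤ) (g : diagGroup n ℓ) :
    weight (p + q) g = weight p g * weight q g := by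
  simp [weight_apply, zpow_add, Finset.prod_mul_distrib]

theorem weight_zero (g : diagGroup n ℓ) : weight 0 g = 1 := by
  simp [weight_apply]

theorem weight_neg (p : Fin n → ℤ) (g : diagGroup n ℓ) : weight (-p) g = (weight p g)⁻¹ := by
  simp [weight_apply]

theorem weight_single (j : Fin n) (g : diagGroup n ℓ) (c : ℤ) :
    weight (Pi.single j c) g = entryUnit j g ^ c := by
  rw [weight_apply, Finset.prod_eq_single j]
  · simp
  · intro i _ hij
    simp [hij]
  · simp

theorem weight_nsmul (m : ℕ) (p : Fin n → ℤ) (g : diagGroup n ℓ) :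
    weight (m • p) g = weight p g ^ m := by
  induction m with
  | zero => simp [weight_zero]
  | succ m ih => rw [succ_nsmul, weight_add, ih, pow_succ]

/-- The product of the lattice of exponents of Laurent monomials with `G`. -/
abbrev TorusGroup (n ℓ : ℕ) : Type := Multiplicative (Fin n → ℤ) × diagGroup n ℓ

variable [NeZero ℓ] {ζ : ℂ}

theorem cocycleFun_one_left (hζ : IsPrimitiveRoot ζ ℓ) (g : diagGroup n ℓ) :
    cocycleFun hζ 1 g = 1 := (cocycle n hζ).map_one_left g

theorem cocycleFun_one_right (hζ : IsPrimitiveRoot ζ ℓ) (g : diagGroup n ℓ) :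
    cocycleFun hζ g 1 = 1 := (cocycle n hζ).map_one_right g

/-- The scalar in the product of a Laurent monomial times `g` with the Laurent monomial of
exponent `q` times `h`. -/
def twist (hζ : IsPrimitiveRoot ζ ℓ) (q : Fin n → ℤ) (h : diagGroup n ℓ) :
    diagGroup n ℓ →* ℂˣ where
  toFun g := cocycleFun hζ g h * weight q g
  map_one' := by rw [cocycleFun_one_left, map_one, one_mul]
  map_mul' g g' := by rw [cocycleFun_mul_left, map_mul, mul_mul_mul_comm]

theorem twist_apply (hζ : IsPrimitiveRoot ζ ℓ) (q : Fin n → ℤ) (g h : diagGroup n ℓ) :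
    twist hζ q h g = cocycleFun hζ g h * weight q g := rfl

theorem twist_add_mul (hζ : IsPrimitiveRoot ζ ℓ) (q q' : Fin n → ℤ) (g h h' : diagGroup n ℓ) :
    twist hζ (q + q') (h * h') g = twist hζ q h g * twist hζ q' h' g := by
  rw [twist_apply, twist_apply, twist_apply, weight_add, cocycleFun_mul_right, mul_mul_mul_comm]

theorem twist_one (hζ : IsPrimitiveRoot ζ ℓ) (q : Fin n → ℤ) (g : diagGroup n ℓ) :
    twist hζ q 1 g = weight q g := by
  rw [twist_apply, cocycleFun_one_right, one_mul]

theorem twist_zero (hζ : IsPrimitiveRoot ζ ℓ) (g h : diagGroup n ℓ) :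
    twist hζ 0 h g = cocycleFun hζ g h := by
  rw [twist_apply, weight_zero, mul_one]

/-- The cocycle of the quantum torus. -/
def torusCocycle (n : ℕ) (hζ : IsPrimitiveRoot ζ ℓ) : NormalizedCocycle ℂ (TorusGroup n ℓ) where
  toFun u v := twist hζ v.1.toAdd v.2 u.2
  map_one_left _ := map_one _
  map_one_right u := by
    change twist hζ 0 1 u.2 = 1
    rw [twist_one, weight_zero]
  cocycle u v w := by
    change twist hζ v.1.toAdd v.2 u.2 * twist hζ w.1.toAdd w.2 (u.2 * v.2) =
      twist hζ w.1.toAdd w.2 v.2 * twist hζ (v.1.toAdd + w.1.toAdd) (v.2 * w.2) u.2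
    rw [twist_add_mul, map_mul, ← mul_assoc, mul_comm]

/-- The quantum torus spanned by the products of Laurent monomials and elements of `G`. -/
abbrev Torus (n : ℕ) (hζ : IsPrimitiveRoot ζ ℓ) : Type :=
  CrossedProduct (1 : TorusGroup n ℓ →* (ℂ ≃ₐ[ℂ] ℂ)) (torusCocycle n hζ)

/-- The Laurent monomial with exponent `p` times `g`. -/
def mon (hζ : IsPrimitiveRoot ζ ℓ) (p : Fin n → ℤ) (g : diagGroup n ℓ) : Torus n hζ :=
  CrossedProduct.single (Multiplicative.ofAdd p, g) 1

/-- The coefficient at the Laurent monomial with exponent `p` times `g`. -/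
def coefAt (hζ : IsPrimitiveRoot ζ ℓ) (p : Fin n → ℤ) (g : diagGroup n ℓ) : Torus n hζ →ₗ[ℂ] ℂ :=
  (Finsupp.lapply (Multiplicative.ofAdd p, g)).comp CrossedProduct.coeffLinear

open Classical in
theorem coefAt_mon (hζ : IsPrimitiveRoot ζ ℓ) (p q : Fin n → ℤ) (g h : diagGroup n ℓ) :
    coefAt hζ p g (mon hζ q h) = if p = q ∧ g = h then 1 else 0 := by
  change (Finsupp.single (Multiplicative.ofAdd q, h) (1 : ℂ)) (Multiplicative.ofAdd p, g) = _
  rw [Finsupp.single_apply]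
  refine if_congr ?_ rfl rfl
  rw [Prod.mk.injEq]
  exact ⟨fun h => ⟨h.1.symm, h.2.symm⟩, fun h => ⟨congrArg _ h.1.symm, h.2.symm⟩⟩

@[elab_as_elim]
theorem torus_induction {hζ : IsPrimitiveRoot ζ ℓ} {P : Torus n hζ → Prop} (a : Torus n hζ)
    (h0 : P 0) (hadd : ∀ a b, P a → P b → P (a + b))
    (hm : ∀ (c : ℂ) p g, P (c • mon hζ p g)) : P a := by
  induction a using CrossedProduct.induction_on with
  | h0 => exact h0
  | hadd a b ha hb => exact hadd a b ha hb
  | hs u r =>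
    have := hm r u.1.toAdd u.2
    rw [mon, CrossedProduct.smul_single, smul_eq_mul, mul_one] at this
    exact this

theorem mon_mul_mon (hζ : IsPrimitiveRoot ζ ℓ) (p q : Fin n → ℤ) (g h : diagGroup n ℓ) :
    mon hζ p g * mon hζ q h = (twist hζ q h g : ℂ) • mon hζ (p + q) (g * h) := by
  rw [mon, mon, CrossedProduct.single_mul_single, mon, CrossedProduct.smul_single]
  rw [map_one, mul_one, Units.smul_def]
  rfl

theorem mon_one_mul_mon (hζ : IsPrimitiveRoot ζ ℓ) (p q : Fin n → ℤ) (h : diagGroup n ℓ) :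
    mon hζ p 1 * mon hζ q h = mon hζ (p + q) h := by
  rw [mon_mul_mon, map_one, Units.val_one, one_smul, one_mul]

theorem mon_mul_mon_one (hζ : IsPrimitiveRoot ζ ℓ) (p q : Fin n → ℤ) (g : diagGroup n ℓ) :
    mon hζ p g * mon hζ q 1 = (weight q g : ℂ) • mon hζ (p + q) g := by
  rw [mon_mul_mon, twist_one, mul_one]

theorem mon_zero_one (hζ : IsPrimitiveRoot ζ ℓ) : mon hζ (0 : Fin n → ℤ) 1 = 1 := rfl

/-- Each of the `k.choose 2` pairs of factors contributes one twist of the monomial with itself. -/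
theorem mon_pow (hζ : IsPrimitiveRoot ζ ℓ) (p : Fin n → ℤ) (g : diagGroup n ℓ) (k : ℕ) :
    mon hζ p g ^ k = ((twist hζ p g g : ℂ) ^ (k.choose 2)) • mon hζ (k • p) (g ^ k) := by
  induction k with
  | zero => simp [mon_zero_one]
  | succ k ih =>
    rw [pow_succ, ih, smul_mul_assoc, mon_mul_mon, smul_smul, map_pow, Units.val_pow_eq_pow_val,
      ← pow_add, succ_nsmul, pow_succ]
    congr 2
    rw [Nat.choose_succ_succ' k 1, Nat.choose_one_right, add_comm]

theorem mon_one_pow (hζ : IsPrimitiveRoot ζ ℓ) (p : Fin n → ℤ) (k : ℕ) :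
    mon hζ p (1 : diagGroup n ℓ) ^ k = mon hζ (k • p) 1 := by
  rw [mon_pow, map_one, Units.val_one, one_pow, one_smul, one_pow]

/-- Laurent monomials commute with each other, so a G-invariant one is central. -/
theorem mem_center_of_weight (hζ : IsPrimitiveRoot ζ ℓ) {p : Fin n → ℤ}
    (h : ∀ g : diagGroup n ℓ, weight p g = 1) :
    mon hζ p 1 ∈ Subalgebra.center ℂ (Torus n hζ) := by
  rw [Subalgebra.mem_center_iff]
  intro b
  induction b using torus_induction with
  | h0 => simp
  | hadd a b ha hb => rw [add_mul, mul_add, ha, hb]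
  | hm c q g =>
    rw [smul_mul_assoc, mul_smul_comm, mon_mul_mon_one, mon_one_mul_mon, h, Units.val_one,
      one_smul, add_comm]

end TwistedHecke

end

/-! ### The elements X_i and Y_i of the torus and the relations of the Hecke algebra. -/

noncomputable section

namespace TwistedHecke

variable {n ℓ : ℕ} [NeZero ℓ] {ζ : ℂ}

/-- `exponent` is an arbitrary natural representative modulo ℓ; this allows any integer
representatives, in particular the exponents -1 of the last generator. -/
theorem cocycleFun_of_exponents (hζ : IsPrimitiveRoot ζ ℓ) {g h : diagGroup n ℓ} {a b : ℕ → ℤ}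
    (ha : ∀ k, k + 1 < n → zetaUnit hζ ^ exponent hζ g k = zetaUnit hζ ^ a k)
    (hb : ∀ k, k + 1 < n → zetaUnit hζ ^ exponent hζ h k = zetaUnit hζ ^ b k) :
    cocycleFun hζ g h = zetaUnit hζ ^ (-∑ k ∈ Finset.range (n - 2), a k * b (k + 1)) := by
  rw [cocycleFun_eq, zpow_neg]
  congr 1
  have hsum : ∀ (s : Finset ℕ) (f : ℕ → ℤ),
      zetaUnit hζ ^ (∑ k ∈ s, f k) = ∏ k ∈ s, zetaUnit hζ ^ f k := fun s f => by
    classical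
    induction s using Finset.induction_on with
    | empty => simp
    | insert a s ha ih => rw [Finset.sum_insert ha, Finset.prod_insert ha, zpow_add, ih]
  rw [hsum]
  refine Finset.prod_congr rfl fun k hk => ?_
  rw [Finset.mem_range] at hk
  rw [pow_mul, ha k (by omega), ← zpow_natCast, ← zpow_mul, mul_comm, zpow_mul, zpow_natCast,
    hb (k + 1) (by omega), ← zpow_mul, mul_comm]

/-- The variable `x_i` of the quantum torus. -/
def torusX (hζ : IsPrimitiveRoot ζ ℓ) (i : Fin n) : Torus n hζ := mon hζ (Pi.single i 1) 1

theorem torusX_commute (hζ : IsPrimitiveRoot ζ ℓ) (i j : Fin n) :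
    Commute (torusX hζ i) (torusX hζ j) := by
  rw [Commute, SemiconjBy, torusX, torusX, mon_one_mul_mon, mon_one_mul_mon, add_comm]

theorem mon_mul_torusX (hζ : IsPrimitiveRoot ζ ℓ) (p : Fin n → ℤ) (g : diagGroup n ℓ) (j : Fin n) :
    mon hζ p g * torusX hζ j = entry g j • (torusX hζ j * mon hζ p g) := by
  rw [torusX, mon_mul_mon_one, mon_one_mul_mon, weight_single, zpow_one, coe_entryUnit, add_comm]

variable [NeZero n]

theorem entryUnit_gen (hζ : IsPrimitiveRoot ζ ℓ) (i j : Fin n) :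
    entryUnit j (gen hζ i) =
      zetaUnit hζ ^ ((if j = i then 1 else 0) - (if j = i + 1 then 1 else 0) : ℤ) := by
  apply Units.ext
  rw [coe_entryUnit, entry_gen, zpow_sub, Units.val_mul]
  split_ifs <;> simp [coe_zetaUnit]

/-- The last generator is the inverse of the product of the others, so all its exponents are -1. -/
theorem zetaUnit_pow_exponent_gen (hζ : IsPrimitiveRoot ζ ℓ) (i : Fin n) {k : ℕ} (hk : k + 1 < n) :
    zetaUnit hζ ^ exponent hζ (gen hζ i) k =
      zetaUnit hζ ^ (if i.val + 1 = n then -1 else if i.val = k then 1 else 0 : ℤ) := by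
  apply Units.ext
  rw [Units.val_pow_eq_pow_val, coe_zetaUnit, zeta_pow_exponent]
  have hi := i.2
  split_ifs with h1 h2
  · have h0 : i + 1 = 0 := Fin.ext (by rw [val_add_one_of_eq h1]; simp)
    simp only [partialProd, entry_gen, Finset.prod_mul_distrib, Finset.prod_ite_eq',
      Finset.mem_filter, Finset.mem_univ, true_and, h0]
    rw [if_neg (by omega), if_pos (by simp)]
    simp [coe_zetaUnit]
  · have : i = Fin.ofNat n i.val := Fin.ext (Nat.mod_eq_of_lt i.2).symm
    rw [this, partialProd_gen hζ (by omega), if_pos h2.symm]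
    simp [coe_zetaUnit]
  · have : i = Fin.ofNat n i.val := Fin.ext (Nat.mod_eq_of_lt i.2).symm
    rw [this, partialProd_gen hζ (by omega), if_neg (Ne.symm h2)]
    simp

/-- The cocycle alone is not symmetric in i and j. Adding the exponent of the eigenvalue of g_i on
x_j makes it symmetric, and this is why the elements x_i⁻¹ g_i commute. -/
theorem sum_exponents (hn : 3 ≤ n) (i j : Fin n) :
    ∑ k ∈ Finset.range (n - 2), (if i.val + 1 = n then -1 else if i.val = k then 1 else 0 : ℤ) *
      (if j.val + 1 = n then -1 else if j.val = k + 1 then 1 else 0 : ℤ) +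
      ((if j = i then 1 else 0) - (if j = i + 1 then 1 else 0)) =
    if i.val + 1 = n then (if j.val + 1 = n then (n : ℤ) - 1 else -1)
      else if j.val + 1 = n then -1 else if j = i then 1 else 0 := by
  have hi := i.2
  have hj := j.2
  simp only [Fin.ext_iff]
  by_cases h1 : i.val + 1 = n <;> by_cases h2 : j.val + 1 = n
  · simp only [h1, h2, if_true, val_add_one_of_eq h1]
    rw [if_pos (by omega), if_neg (by omega)]
    simp
    omega
  · simp only [h1, h2, if_true, if_false, val_add_one_of_eq h1]
    rw [if_neg (by omega)]
    rcases Nat.eq_zero_or_pos j.val with h3 | h3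
    · rw [if_pos h3, Finset.sum_eq_zero]
      · simp
      · intro k _
        rw [if_neg (by omega), mul_zero]
    · rw [if_neg (by omega), Finset.sum_eq_single (j.val - 1)]
      · rw [if_pos (by omega)]; simp
      · intro k _ hk
        rw [if_neg (by omega), mul_zero]
      · intro h
        rw [Finset.mem_range] at h
        omega
  · simp only [h1, h2, if_true, if_false, val_add_one_of_lt' (show i.val + 1 < n by omega)]
    rw [if_neg (show j.val ≠ i.val by omega)]
    by_cases h3 : j.val = i.val + 1
    · rw [if_pos h3, Finset.sum_eq_zero]
      · simp
      · intro k hk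
        rw [Finset.mem_range] at hk
        rw [if_neg (by omega), zero_mul]
    · rw [if_neg h3, Finset.sum_eq_single i.val]
      · simp
      · intro k _ hk
        rw [if_neg (by omega), zero_mul]
      · intro h
        rw [Finset.mem_range] at h
        omega
  · simp only [h1, h2, if_false, val_add_one_of_lt' (show i.val + 1 < n by omega)]
    by_cases h3 : j.val = i.val + 1
    · rw [if_pos h3, if_neg (by omega), Finset.sum_eq_single i.val]
      · simp [h3]
      · intro k _ hk
        rw [if_neg (by omega), zero_mul]
      · intro h
        rw [Finset.mem_range] at h
        omega
    · rw [if_neg h3, Finset.sum_eq_zero]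
      · simp
      · intro k _
        by_cases h4 : i.val = k
        · rw [if_neg (show j.val ≠ k + 1 by omega), mul_zero]
        · rw [if_neg h4, zero_mul]

/-- The scalars in the products of the elements `x_i⁻¹ g_i`. -/
theorem twist_gen (hζ : IsPrimitiveRoot ζ ℓ) (hn : 3 ≤ n) (i j : Fin n) :
    twist hζ (-Pi.single j 1) (gen hζ j) (gen hζ i) = zetaUnit hζ ^ (-
      if i.val + 1 = n then (if j.val + 1 = n then (n : ℤ) - 1 else -1)
        else if j.val + 1 = n then -1 else if j = i then 1 else 0) := by
  rw [twist_apply, weight_neg, weight_single, zpow_one, entryUnit_gen, ← zpow_neg,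
    cocycleFun_of_exponents hζ (fun k hk => zetaUnit_pow_exponent_gen hζ i hk)
      (fun k hk => zetaUnit_pow_exponent_gen hζ j hk), ← zpow_add, ← neg_add, sum_exponents hn]

theorem twist_gen_comm (hζ : IsPrimitiveRoot ζ ℓ) (hn : 3 ≤ n) (i j : Fin n) :
    twist hζ (-Pi.single j 1) (gen hζ j) (gen hζ i) =
      twist hζ (-Pi.single i 1) (gen hζ i) (gen hζ j) := by
  rw [twist_gen hζ hn, twist_gen hζ hn]
  congr 2
  by_cases h1 : i.val + 1 = n <;> by_cases h2 : j.val + 1 = n <;> simp [h1, h2, eq_comm]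

theorem prod_gen (hζ : IsPrimitiveRoot ζ ℓ) : ∏ i : Fin n, gen hζ i = 1 := by
  apply ext_entry
  intro j
  have h : (entryUnit j (∏ i : Fin n, gen hζ i) : ℂ) = 1 := by
    rw [map_prod, Units.coe_prod]
    simp only [coe_entryUnit, entry_gen, Finset.prod_mul_distrib, Finset.prod_ite_eq,
      ← sub_eq_iff_eq_add, Finset.mem_univ, if_true]
    exact mul_inv_cancel₀ (hζ.ne_zero (NeZero.ne ℓ))
  rw [entry_one]
  exact h

section Generators

variable (hζ : IsPrimitiveRoot ζ ℓ) (t : Fin n → ℂ)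

/-- The element `t_i / (ζ - 1) x_i⁻¹ g_i` of the quantum torus. -/
def torusY (i : Fin n) : Torus n hζ := (t i / (ζ - 1)) • mon hζ (-Pi.single i 1) (gen hζ i)

theorem torusY_commute (hn : 3 ≤ n) (i j : Fin n) :
    Commute (torusY hζ t i) (torusY hζ t j) := by
  refine Commute.smul_left (Commute.smul_right ?_ _) _
  rw [Commute, SemiconjBy, mon_mul_mon, mon_mul_mon, twist_gen_comm hζ hn, add_comm, mul_comm]

theorem torusY_mul_torusX (i j : Fin n) :
    torusY hζ t i * torusX hζ j = entry (gen hζ i) j • (torusX hζ j * torusY hζ t i) := by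
  rw [torusY, smul_mul_assoc, mon_mul_torusX, mul_smul_comm, smul_comm]

theorem torusY_commute_torusX (i j : Fin n) (h1 : j ≠ i) (h2 : j ≠ i + 1) :
    Commute (torusY hζ t i) (torusX hζ j) := by
  rw [Commute, SemiconjBy, torusY_mul_torusX, entry_gen, if_neg h1, if_neg h2, one_mul, one_smul]

theorem torusX_mul_torusY (i : Fin n) :
    torusX hζ i * torusY hζ t i = (t i / (ζ - 1)) • mon hζ 0 (gen hζ i) := by
  rw [torusY, mul_smul_comm, torusX, mon_one_mul_mon, add_neg_cancel]

theorem add_one_ne_self (hn : 3 ≤ n) (i : Fin n) : i + 1 ≠ i := by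
  have : Nontrivial (Fin n) := Fin.nontrivial_iff_two_le.2 (by omega)
  simp
  omega

theorem torusY_mul_torusX_self (hn : 3 ≤ n) (i : Fin n) :
    torusY hζ t i * torusX hζ i = (ζ * (t i / (ζ - 1))) • mon hζ 0 (gen hζ i) := by
  rw [torusY_mul_torusX, torusX_mul_torusY, entry_gen, if_pos rfl,
    if_neg (add_one_ne_self hn i).symm, mul_one, smul_smul]

/-- The image of the generator `x_i` of the Hecke algebra in the quantum torus. -/
def torusGen (i : Fin n) : Torus n hζ := torusX hζ i - torusY hζ t (i - 1)

/-- The pure X and pure Y terms cancel, and each mixed commutator is a multiple of X_i Y_{j-1} or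
X_j Y_{i-1}. -/
theorem torusGen_commutator (hn : 3 ≤ n) (i j : Fin n) :
    torusGen hζ t i * torusGen hζ t j - torusGen hζ t j * torusGen hζ t i =
      (entry (gen hζ (j - 1)) i - 1) • (torusX hζ i * torusY hζ t (j - 1)) -
      (entry (gen hζ (i - 1)) j - 1) • (torusX hζ j * torusY hζ t (i - 1)) := by
  have h1 := (torusX_commute hζ i j).eq
  have h2 := (torusY_commute hζ t hn (i - 1) (j - 1)).eq
  simp only [torusGen, mul_sub, sub_mul, torusY_mul_torusX, sub_smul, one_smul, h1, h2]
  abel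

theorem torusGen_adjacent (hn : 3 ≤ n) (h1 : ζ ≠ 1) (i : Fin n) :
    torusGen hζ t i * torusGen hζ t (i + 1) - torusGen hζ t (i + 1) * torusGen hζ t i =
      t i • mon hζ 0 (gen hζ i) := by
  -- Since n ≥ 3, the vertex i + 1 does not lie on the edge i - 1, so the second mixed term
  -- vanishes; the first one has the coefficient ζ - 1, which the denominator in Y_i cancels.
  have h3 : i + 1 ≠ i - 1 := by
    intro h
    have h' : i + 1 + 1 = i := by rw [h, sub_add_cancel]
    have h4 := Fin.ext_iff.1 h'
    have hi := i.2
    rcases Nat.lt_or_ge (i.val + 1) n with h5 | h5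
    · rcases Nat.lt_or_ge (i.val + 1 + 1) n with h6 | h6
      · rw [val_add_one_of_lt' (by rw [val_add_one_of_lt' h5]; omega), val_add_one_of_lt' h5] at h4
        omega
      · rw [val_add_one_of_eq (by rw [val_add_one_of_lt' h5]; omega)] at h4
        omega
    · have h6 := val_add_one_of_eq (i := i) (by omega)
      rw [val_add_one_of_lt' (by omega), h6] at h4
      omega
  rw [torusGen_commutator hζ t hn, add_sub_cancel_right, torusX_mul_torusY, entry_gen, entry_gen,
    if_pos rfl, if_neg (add_one_ne_self hn i).symm, if_neg h3, sub_add_cancel,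
    if_neg (add_one_ne_self hn i), mul_one, mul_one, sub_self, zero_smul, sub_zero, smul_smul,
    mul_div_cancel₀ _ (sub_ne_zero.2 h1)]

theorem torusGen_nonAdjacent (hn : 3 ≤ n) {i j : Fin n} (h : NonAdjacent i j) :
    torusGen hζ t i * torusGen hζ t j - torusGen hζ t j * torusGen hζ t i = 0 := by
  rcases eq_or_ne i j with rfl | hij
  · exact sub_self _
  · obtain ⟨h1, h2⟩ := (nonAdjacent_iff hn i j).1 h
    rw [torusGen_commutator hζ t hn, entry_gen, entry_gen, sub_add_cancel, sub_add_cancel,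
      if_neg hij, if_neg hij.symm, if_neg, if_neg, mul_one, sub_self, zero_smul, zero_smul,
      sub_zero]
    · intro h'; exact h2 (by rw [h', sub_add_cancel])
    · intro h'; exact h1 (by rw [h', sub_add_cancel])

theorem monoidHom_ext_gen {M : Type*} [CommMonoid M] {f f' : diagGroup n ℓ →* M}
    (h : ∀ i, f (gen hζ i) = f' (gen hζ i)) : f = f' := by
  ext g
  rw [← prod_gen_pow_exponent hζ g, map_prod, map_prod]
  exact Finset.prod_congr rfl fun k _ => by rw [map_pow, map_pow, h]

/-- Both sides are characters of g, so it suffices to compare them on the generators g_i. There the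
symmetry `twist_gen_comm` applies, and g_k acts on x_i by the inverse of the scalar by which g_i
acts on x_{k+1}. -/
theorem twist_gen_eq (hn : 3 ≤ n) (k : Fin n) (g : diagGroup n ℓ) :
    twist hζ (-Pi.single k 1) (gen hζ k) g = cocycleFun hζ (gen hζ k) g * entryUnit (k + 1) g := by
  let c : diagGroup n ℓ →* ℂˣ :=
    { toFun := fun g => cocycleFun hζ (gen hζ k) g
      map_one' := cocycleFun_one_right hζ _
      map_mul' := fun g h => cocycleFun_mul_right hζ _ g h }
  have : twist hζ (-Pi.single k 1) (gen hζ k) = c * entryUnit (k + 1) := by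
    refine monoidHom_ext_gen hζ fun i => ?_
    rw [twist_gen_comm hζ hn, twist_apply, MonoidHom.mul_apply, weight_neg, weight_single, zpow_one,
      entryUnit_gen, entryUnit_gen, ← zpow_neg]
    congr 2
    simp only [add_left_inj, eq_comm (a := i), neg_sub]
  rw [this]
  rfl

/-- By `twist_gen_eq`, moving g past Y_{j-1} produces the same scalar as moving it past X_j, so X_j
- Y_{j-1} is an eigenvector just as x_j is. -/
theorem mon_mul_torusGen (hn : 3 ≤ n) (g : diagGroup n ℓ) (j : Fin n) :
    mon hζ 0 g * torusGen hζ t j = entry g j • (torusGen hζ t j * mon hζ 0 g) := by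
  rw [torusGen, mul_sub, sub_mul, smul_sub, mon_mul_torusX, torusY, mul_smul_comm, smul_mul_assoc,
    smul_comm (entry g j), mon_mul_mon, mon_mul_mon, twist_zero, twist_gen_eq hζ hn, sub_add_cancel,
    smul_smul (entry g j), Units.val_mul, coe_entryUnit, mul_comm (entry g j), zero_add, add_zero,
    mul_comm g]

end Generators

end TwistedHecke

end

/-! ### The images of x_i^ℓ and w in the torus. -/

noncomputable section

namespace TwistedHecke

section RootOfUnity

open Polynomial in
theorem prod_one_sub_zeta_pow_mul {ℓ : ℕ} [NeZero ℓ] {ζ : ℂ} (hζ : IsPrimitiveRoot ζ ℓ) :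
    ∏ k ∈ Finset.range ℓ, (1 - C (ζ ^ k) * X : ℂ[X]) = 1 - X ^ ℓ := by
  have h : IsPrimitiveRoot (C ζ : ℂ[X]) ℓ := hζ.map_of_injective (f := C) C_injective
  have h1 := h.pow_sub_pow_eq_prod_sub_mul (1 : ℂ[X]) X (Nat.pos_of_ne_zero (NeZero.ne ℓ))
  rw [one_pow] at h1
  rw [h1]
  refine Finset.prod_bij (fun k _ => C (ζ ^ k)) ?_ ?_ ?_ ?_
  · intro k _
    rw [mem_nthRootsFinset (Nat.pos_of_ne_zero (NeZero.ne ℓ)), ← C_pow, ← pow_mul, mul_comm,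
      pow_mul, hζ.pow_eq_one, one_pow, C_1]
  · intro a ha b hb hab
    exact hζ.pow_inj (Finset.mem_range.1 ha) (Finset.mem_range.1 hb) (C_injective hab)
  · intro b hb
    rw [mem_nthRootsFinset (Nat.pos_of_ne_zero (NeZero.ne ℓ))] at hb
    obtain ⟨i, hi, hi'⟩ := h.eq_pow_of_pow_eq_one hb
    exact ⟨i, Finset.mem_range.2 hi, by rw [C_pow, hi']⟩
  · intro k _
    rfl

-- Moving x to the left replaces T by y in every polynomial in T.
open Polynomial in
theorem aeval_mul_of_mul_eq {A : Type*} [Ring A] [Algebra ℂ A] {x y T : A} (h : T * x = x * y)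
    (p : ℂ[X]) : aeval T p * x = x * aeval y p := by
  induction p using Polynomial.induction_on' with
  | add p q hp hq => rw [map_add, map_add, add_mul, mul_add, hp, hq]
  | monomial m a =>
    have hm : T ^ m * x = x * y ^ m := ((show SemiconjBy x y T from h.symm).pow_right m).eq.symm
    rw [aeval_monomial, aeval_monomial, mul_assoc, hm, ← mul_assoc, ← mul_assoc, Algebra.commutes]

open Polynomial in
/-- The `ℓ`-th power of `x (1 - T)` when `T x = ζ x T`. -/
theorem pow_mul_one_sub {ℓ : ℕ} [NeZero ℓ] {ζ : ℂ} (hζ : IsPrimitiveRoot ζ ℓ) {A : Type*} [Ring A]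
    [Algebra ℂ A] {x T : A} (h : T * x = ζ • (x * T)) :
    (x * (1 - T)) ^ ℓ = x ^ ℓ * (1 - T ^ ℓ) := by
  have key : ∀ k, (x * (1 - T)) ^ k =
      x ^ k * aeval T (∏ j ∈ Finset.range k, (1 - C (ζ ^ j) * X : ℂ[X])) := fun k => by
    induction k with
    | zero => simp
    | succ k ih =>
      have h' : T * x = x * (ζ • T) := by rw [h, mul_smul_comm]
      rw [pow_succ, ih, mul_assoc, ← mul_assoc (aeval T _), aeval_mul_of_mul_eq h', mul_assoc,
        ← mul_assoc, ← pow_succ]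
      congr 1
      have hy : ζ • T = aeval T (C ζ * X : ℂ[X]) := by
        rw [map_mul, aeval_C, aeval_X, Algebra.smul_def]
      rw [Finset.prod_range_succ', map_mul, hy, ← aeval_comp, Polynomial.prod_comp]
      congr 2
      · refine Finset.prod_congr rfl fun j _ => ?_
        simp only [sub_comp, one_comp, mul_comp, C_comp, X_comp, pow_succ, C_mul, mul_assoc]
      · simp
  rw [key, prod_one_sub_zeta_pow_mul hζ]
  simp

/-- For odd ℓ the exponent is a multiple of ℓ; for ℓ = 2k it is k(2k - 1), and ζ^k = -1. This is the
source of the sign in the last τ̃. -/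
theorem zeta_pow_choose_two {ℓ : ℕ} {ζ : ℂ} (hℓ : 2 ≤ ℓ) (hζ : IsPrimitiveRoot ζ ℓ) :
    ζ ^ ℓ.choose 2 = (-1) ^ (ℓ - 1) := by
  rcases Nat.even_or_odd' ℓ with ⟨k, rfl | rfl⟩
  · have h1 : ζ ^ k = -1 := by
      have := hζ.pow (n := 2 * k) (a := k) (b := 2) (by omega) (by ring)
      exact this.eq_neg_one_of_two_right
    have h2 : (2 * k).choose 2 = k * (2 * k - 1) := by
      rw [Nat.choose_two_right, mul_assoc, Nat.mul_div_cancel_left _ (by norm_num)]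
    rw [h2, pow_mul, h1]
  · have h2 : (2 * k + 1).choose 2 = (2 * k + 1) * k := by
      rw [Nat.choose_two_right, Nat.add_sub_cancel, mul_left_comm,
        Nat.mul_div_cancel_left _ (by norm_num)]
    rw [h2, pow_mul, hζ.pow_eq_one, one_pow, Nat.add_sub_cancel, pow_mul]
    norm_num

end RootOfUnity

theorem list_prod_map_smul {ι A : Type*} [Ring A] [Algebra ℂ A] (c : ι → ℂ) (f : ι → A)
    (l : List ι) : (l.map fun i => c i • f i).prod = (l.map c).prod • (l.map f).prod := by
  induction l with
  | nil => simp
  | cons a l ih => rw [List.map_cons, List.prod_cons, ih, smul_mul_smul_comm]; simp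

variable {n ℓ : ℕ} [NeZero ℓ] {ζ : ℂ} [NeZero n]

/-- With T = X_{i+1}⁻¹ Y_i, the generator is X_{i+1}(1 - T) and T X_{i+1} = ζ⁻¹ X_{i+1} T, so
`pow_mul_one_sub` applies to the primitive root ζ⁻¹. What remains is the scalar of T^ℓ. -/
theorem torusGen_pow (hℓ : 2 ≤ ℓ) (hn : 3 ≤ n) (hζ : IsPrimitiveRoot ζ ℓ) (t : Fin n → ℂ)
    (i : Fin n) : torusGen hζ t (i + 1) ^ ℓ = mon hζ (ℓ • Pi.single (i + 1) 1) 1 -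
      tauTilde ℓ ζ t i • mon hζ (-(ℓ • Pi.single i 1)) 1 := by
  set c := t i / (ζ - 1) with hc
  set T := c • mon hζ (-Pi.single (i + 1) 1 + -Pi.single i 1) (gen hζ i) with hT
  have hXT : torusGen hζ t (i + 1) = torusX hζ (i + 1) * (1 - T) := by
    rw [torusGen, add_sub_cancel_right, torusY, mul_sub, mul_one, hT, mul_smul_comm, torusX,
      mon_one_mul_mon, add_neg_cancel_left]
  have hTX : T * torusX hζ (i + 1) = ζ⁻¹ • (torusX hζ (i + 1) * T) := by
    rw [hT, smul_mul_assoc, mon_mul_torusX, mul_smul_comm, smul_comm, entry_gen, if_pos rfl,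
      if_neg (add_one_ne_self hn i), one_mul]
  rw [hXT, pow_mul_one_sub hζ.inv hTX, mul_sub, mul_one, torusX, mon_one_pow, hT, smul_pow, mon_pow,
    smul_smul, mul_smul_comm]
  have hg : gen hζ i ^ ℓ = 1 := Subtype.ext (gen hζ i).2.2
  rw [hg, mon_one_mul_mon]
  congr 2
  -- The twist of T with itself: the factor ζ from X_{i+1}⁻¹ cancels the twist ζ⁻¹ of X_i⁻¹ g_i with
  -- itself, but for the closing edge the latter is ζ^(-(n-1)), and ζ^(-(n-2)) remains.
  · have htw : twist hζ (-Pi.single (i + 1) 1 + -Pi.single i 1) (gen hζ i) (gen hζ i) =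
        zetaUnit hζ ^ (if i.val + 1 = n then -((n : ℤ) - 2) else 0) := by
      have := twist_add_mul hζ (-Pi.single (i + 1) 1) (-Pi.single i 1) (gen hζ i) 1 (gen hζ i)
      rw [one_mul] at this
      rw [this, twist_one, weight_neg, weight_single, zpow_one, entryUnit_gen, twist_gen hζ hn,
        ← zpow_neg, ← zpow_add, if_pos rfl, if_pos rfl, if_neg (add_one_ne_self hn i)]
      congr 1
      split_ifs <;> omega
    rw [htw, tauTilde, tau]
    split_ifs with h
    · have h2 : ((zetaUnit hζ ^ (-((n : ℤ) - 2)) : ℂˣ) : ℂ) ^ ℓ.choose 2 =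
          (-1) ^ (n * (ℓ - 1)) := by
        rw [show (n : ℤ) - 2 = ((n - 2 : ℕ) : ℤ) by omega, zpow_neg, zpow_natCast,
          Units.val_inv_eq_inv_val, Units.val_pow_eq_pow_val, coe_zetaUnit, inv_pow, ← pow_mul, mul_comm, pow_mul,
          zeta_pow_choose_two hℓ hζ, ← pow_mul]
        obtain ⟨m, rfl⟩ : ∃ m, n = m + 2 := ⟨n - 2, by omega⟩
        rw [Nat.add_sub_cancel, add_mul, pow_add, pow_mul (-1 : ℂ) 2, neg_one_sq, one_pow, mul_one,
          mul_comm m, ← inv_pow, inv_neg, inv_one]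
      rw [h2, mul_comm, mul_div_assoc, mul_pow, hζ.pow_eq_one, one_mul]
    · simp [hc]
  · rw [smul_add, smul_neg, smul_neg, add_neg_cancel_left]

/-- The vector with all entries `1`. -/
def deltaVec (n : ℕ) : Fin n → ℤ := fun _ => 1

omit [NeZero ℓ] [NeZero n] in
theorem weight_deltaVec (g : diagGroup n ℓ) : weight (deltaVec n) g = 1 := by
  apply Units.ext
  have h1 := (g : Matrix.SpecialLinearGroup (Fin n) ℂ).2
  rw [coe_eq_diagonal, Matrix.det_diagonal] at h1
  rw [weight_apply, Units.coe_prod]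
  simpa [deltaVec, coe_entryUnit] using h1

theorem sum_range_single (n : ℕ) [NeZero n] :
    ∑ j ∈ Finset.range n, Pi.single (Fin.ofNat n j) (1 : ℤ) = deltaVec n := by
  rw [Finset.sum_range]
  ext k
  simp [Finset.sum_apply, Pi.single_apply, deltaVec]

theorem prod_torusX (hζ : IsPrimitiveRoot ζ ℓ) :
    (List.ofFn (torusX (n := n) hζ)).prod = mon hζ (deltaVec n) 1 := by
  rw [ofFn_eq_map_range _ (fun j => torusX hζ (Fin.ofNat n j)) (fun j => by simp),
    ← sum_range_single]
  have key : ∀ m, ((List.range m).map fun j => torusX hζ (Fin.ofNat n j)).prod =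
      mon hζ (∑ j ∈ Finset.range m, Pi.single (Fin.ofNat n j) (1 : ℤ)) 1 := fun m => by
    induction m with
    | zero => simp [mon_zero_one]
    | succ m ih =>
      rw [List.range_succ, List.map_append, List.prod_append, ih, List.map_cons, List.map_nil,
        List.prod_cons, List.prod_nil, mul_one, torusX, mon_one_mul_mon, Finset.sum_range_succ]
  exact key n

/-- Distinct factors other than the last multiply without a scalar; the last factor picks up one ζ
from each of the n - 1 factors before it. The group part is trivial by `prod_gen`. -/
theorem prod_mon_gen (hn : 3 ≤ n) (hζ : IsPrimitiveRoot ζ ℓ) :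
    (List.ofFn fun i : Fin n => mon hζ (-Pi.single i 1) (gen hζ i)).prod =
      ζ ^ (n - 1) • mon hζ (-deltaVec n) 1 := by
  let g : ℕ → diagGroup n ℓ := fun j => gen hζ (Fin.ofNat n j)
  let e : ℕ → Fin n → ℤ := fun j => -Pi.single (Fin.ofNat n j) 1
  have hval : ∀ j < n, (Fin.ofNat n j).val = j := fun j hj => Nat.mod_eq_of_lt hj
  have key : ∀ m ≤ n - 1, ((List.range m).map fun j => mon hζ (e j) (g j)).prod =
      mon hζ (∑ j ∈ Finset.range m, e j) (∏ j ∈ Finset.range m, g j) := fun m => by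
    induction m with
    | zero => simp [mon_zero_one]
    | succ m ih =>
      intro hm
      rw [List.range_succ, List.map_append, List.prod_append, ih (by omega), List.map_cons,
        List.map_nil, List.prod_cons, List.prod_nil, mul_one, mon_mul_mon, Finset.sum_range_succ,
        Finset.prod_range_succ, map_prod, Finset.prod_eq_one, Units.val_one, one_smul]
      intro j hj
      rw [Finset.mem_range] at hj
      have h1 := hval j (by omega)
      have h2 := hval m (by omega)
      rw [twist_gen hζ hn, if_neg (by omega), if_neg (by omega), if_neg, neg_zero, zpow_zero]
      rw [Fin.ext_iff]
      omega
  have hsum : ∑ j ∈ Finset.range n, e j = -deltaVec n := by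
    rw [Finset.sum_neg_distrib, sum_range_single]
  have hprod : ∏ j ∈ Finset.range n, g j = 1 := by
    rw [Finset.prod_range, ← prod_gen hζ]
    exact Finset.prod_congr rfl fun j _ => by simp [g]
  rw [ofFn_eq_map_range _ (fun j => mon hζ (e j) (g j)) (fun j => by simp [e, g]), ← hsum, ← hprod]
  obtain ⟨m, hm⟩ : ∃ m, n = m + 1 := ⟨n - 1, by omega⟩
  rw [show List.range n = List.range (m + 1) by rw [hm],
    show Finset.range n = Finset.range (m + 1) by rw [hm],
    List.range_succ, List.map_append, List.prod_append, key m (by omega), List.map_cons,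
    List.map_nil, List.prod_cons, List.prod_nil, mul_one, mon_mul_mon, Finset.sum_range_succ,
    Finset.prod_range_succ, map_prod]
  congr 1
  rw [Finset.prod_congr rfl (g := fun _ => zetaUnit hζ), Finset.prod_const, Finset.card_range,
    Units.val_pow_eq_pow_val, coe_zetaUnit]
  · congr 1; omega
  · intro j hj
    rw [Finset.mem_range] at hj
    have h1 := hval j (by omega)
    have h2 := hval m (by omega)
    rw [twist_gen hζ hn, if_neg (by omega), if_pos (by omega), neg_neg, zpow_one]

omit [NeZero ℓ] in
theorem prod_tau (hn : 3 ≤ n) (t : Fin n → ℂ) :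
    ∏ i, tau ζ t i = ζ * ∏ i, t i / (ζ - 1) := by
  obtain ⟨m, rfl⟩ : ∃ m, n = m + 1 := ⟨n - 1, by omega⟩
  rw [Fin.prod_univ_castSucc, Fin.prod_univ_castSucc, tau, if_pos (by simp), mul_left_comm,
    mul_div_assoc]
  congr 1
  refine Finset.prod_congr rfl fun i _ => ?_
  rw [tau, if_neg]
  have := i.2
  simp
  omega

theorem prod_torusY (hn : 3 ≤ n) (hζ : IsPrimitiveRoot ζ ℓ) (t : Fin n → ℂ) :
    (List.ofFn (torusY hζ t)).prod =
      (ζ ^ (n - 2) * ∏ i, tau ζ t i) • mon hζ (-deltaVec n) 1 := by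
  have h : List.ofFn (torusY hζ t) = (List.finRange n).map
      fun i => (t i / (ζ - 1)) • mon hζ (-Pi.single i 1) (gen hζ i) := List.ofFn_eq_map ..
  rw [h, list_prod_map_smul, ← List.ofFn_eq_map, ← List.ofFn_eq_map, List.prod_ofFn,
    prod_mon_gen hn, smul_smul, prod_tau hn, show n - 1 = n - 2 + 1 by omega, pow_succ]
  congr 1
  ring

/-- The image of the element `w` in the quantum torus. -/
def torusW (hζ : IsPrimitiveRoot ζ ℓ) (t : Fin n → ℂ) : Torus n hζ :=
  mon hζ (deltaVec n) 1 +
    ((-1) ^ n * ζ ^ (n - 2) * ∏ i, tau ζ t i) • mon hζ (-deltaVec n) 1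

/-- The factorization of the cyclic continuant for X_i and Y_i. The two cases of `tau` match the two
orders X_i Y_i and Y_i X_i of the edge weights. -/
theorem sum_indexJ_eq_torusW (hn : 3 ≤ n) (hζ : IsPrimitiveRoot ζ ℓ) (t : Fin n → ℂ) :
    ∑ S ∈ indexJ n, (∏ i ∈ S, tau ζ t i) •
      ((List.ofFn fun j => torusGen hζ t j ^ (deltaSub S j).toNat).prod *
        (S.sort.map fun i => mon hζ 0 (gen hζ i)).prod) = torusW hζ t := by
  have hfac := cyclicContinuant_factor hn (x := torusGen hζ t)
    (s := fun i => tau ζ t i • mon hζ 0 (gen hζ i)) (X := torusX hζ) (Y := torusY hζ t)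
    (fun j => by rw [torusGen, add_sub_cancel_right])
    (fun i hi => by rw [torusX_mul_torusY, tau, if_neg hi])
    (fun i hi => by rw [torusY_mul_torusX_self hζ t hn, tau, if_pos hi, mul_div_assoc])
    (torusX_commute hζ) (torusY_commute hζ t hn) (torusY_commute_torusX hζ t)
  rw [prod_torusX, prod_torusY hn] at hfac
  rw [torusW, mul_assoc, mul_smul, Algebra.smul_def ((-1 : ℂ) ^ n), map_pow, map_neg, map_one,
    ← hfac]
  refine Finset.sum_congr rfl fun S _ => ?_
  rw [list_prod_map_smul, mul_smul_comm]
  congr 1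
  rw [← Finset.prod_map_toList, (Finset.sort_perm_toList S _).map _ |>.prod_eq]

end TwistedHecke

end

noncomputable section

namespace TwistedHecke

/-! ### The filtration of the torus by total degree, and leading terms. -/

section Filtration

variable {n ℓ : ℕ} [NeZero ℓ] {ζ : ℂ}

/-- The total degree of a Laurent monomial. -/
def totalDeg (p : Fin n → ℤ) : ℤ := ∑ j, p j

theorem totalDeg_add (p q : Fin n → ℤ) : totalDeg (p + q) = totalDeg p + totalDeg q := by
  simp [totalDeg, Finset.sum_add_distrib]

theorem totalDeg_neg (p : Fin n → ℤ) : totalDeg (-p) = -totalDeg p := by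
  simp [totalDeg]

theorem totalDeg_single (i : Fin n) (c : ℤ) : totalDeg (Pi.single i c) = c := by
  simp [totalDeg]

theorem totalDeg_deltaVec : totalDeg (deltaVec n) = n := by
  simp [totalDeg, deltaVec]

/-- The elements of the quantum torus of total degree at most `d`. -/
def fil (hζ : IsPrimitiveRoot ζ ℓ) (d : ℤ) : Submodule ℂ (Torus n hζ) :=
  Submodule.span ℂ {a | ∃ p g, totalDeg p ≤ d ∧ mon hζ p g = a}

variable {hζ : IsPrimitiveRoot ζ ℓ}

theorem mon_mem_fil {p : Fin n → ℤ} {d : ℤ} (h : totalDeg p ≤ d) (g : diagGroup n ℓ) :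
    mon hζ p g ∈ fil hζ d := Submodule.subset_span ⟨p, g, h, rfl⟩

theorem fil_mono {d e : ℤ} (h : d ≤ e) : fil (n := n) hζ d ≤ fil hζ e :=
  Submodule.span_mono fun _ ⟨p, g, hp, ha⟩ => ⟨p, g, hp.trans h, ha⟩

theorem coefAt_eq_zero {a : Torus n hζ} {d : ℤ} (ha : a ∈ fil hζ d) {p : Fin n → ℤ}
    (hp : d < totalDeg p) (g : diagGroup n ℓ) : coefAt hζ p g a = 0 := by
  induction ha using Submodule.span_induction with
  | mem a ha =>
    obtain ⟨q, h, hq, rfl⟩ := ha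
    rw [coefAt_mon, if_neg]
    rintro ⟨rfl, -⟩
    exact absurd hp (not_lt.2 hq)
  | zero => exact map_zero _
  | add a b _ _ ha hb => rw [map_add, ha, hb, add_zero]
  | smul c a _ ha => rw [map_smul, ha, smul_zero]

theorem eq_sum_mon (a : Torus n hζ) :
    a = ∑ u ∈ a.coeff.support, coefAt hζ u.1.toAdd u.2 a • mon hζ u.1.toAdd u.2 := by
  ext1
  have h := Finsupp.sum_single a.coeff
  have hs : ∀ s : Finset (TorusGroup n ℓ), ∀ f : TorusGroup n ℓ → Torus n hζ,
      (∑ u ∈ s, f u).coeff = ∑ u ∈ s, (f u).coeff := fun s f =>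
    map_sum (CrossedProduct.coeffLinear (k := ℂ)) f s
  rw [hs]
  refine h.symm.trans (Finset.sum_congr rfl fun u _ => ?_)
  rw [CrossedProduct.coeff_smul]
  change _ = _ • Finsupp.single u (1 : ℂ)
  rw [Finsupp.smul_single, smul_eq_mul, mul_one]
  rfl

theorem exists_mem_fil (a : Torus n hζ) : ∃ d : ℕ, a ∈ fil hζ d := by
  refine ⟨∑ u ∈ a.coeff.support, (totalDeg u.1.toAdd).toNat, ?_⟩
  rw [eq_sum_mon a]
  refine Submodule.sum_mem _ fun u hu => Submodule.smul_mem _ _ (mon_mem_fil ?_ _)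
  rw [← eq_sum_mon a]
  have := Finset.single_le_sum (f := fun u : TorusGroup n ℓ => (totalDeg u.1.toAdd).toNat)
    (fun _ _ => Nat.zero_le _) hu
  omega

theorem mul_mem_fil {a b : Torus n hζ} {d e : ℤ} (ha : a ∈ fil hζ d) (hb : b ∈ fil hζ e) :
    a * b ∈ fil hζ (d + e) := by
  have h : fil (n := n) hζ d * fil hζ e ≤ fil hζ (d + e) := by
    rw [fil, fil, Submodule.span_mul_span, Submodule.span_le]
    rintro _ ⟨_, ⟨p, g, hp, rfl⟩, _, ⟨q, h, hq, rfl⟩, rfl⟩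
    dsimp only
    rw [mon_mul_mon]
    refine Submodule.smul_mem _ _ (mon_mem_fil ?_ _)
    rw [totalDeg_add]
    exact add_le_add hp hq
  exact h (Submodule.mul_mem_mul ha hb)

/-- The leading term of `a` is the monomial with exponent `p` times `g`. -/
def HasLead (a : Torus n hζ) (p : Fin n → ℤ) (g : diagGroup n ℓ) : Prop :=
  a - mon hζ p g ∈ fil hζ (totalDeg p - 1)

theorem hasLead_mon (p : Fin n → ℤ) (g : diagGroup n ℓ) : HasLead (mon hζ p g) p g := by
  rw [HasLead, sub_self]
  exact Submodule.zero_mem _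

theorem HasLead.mem_fil {a : Torus n hζ} {p : Fin n → ℤ} {g : diagGroup n ℓ} (h : HasLead a p g) :
    a ∈ fil hζ (totalDeg p) := by
  rw [← sub_add_cancel a (mon hζ p g)]
  exact Submodule.add_mem _ (fil_mono (by omega) h) (mon_mem_fil le_rfl g)

/-- The group part of the left leading term must be 1: otherwise the product of the leading
monomials would carry a twist and the leading coefficient would no longer be 1. -/
theorem HasLead.mul {a b : Torus n hζ} {p q : Fin n → ℤ} {h : diagGroup n ℓ}
    (ha : HasLead a p 1) (hb : HasLead b q h) : HasLead (a * b) (p + q) h := by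
  rw [HasLead, ← mon_one_mul_mon, totalDeg_add]
  have : a * b - mon hζ p 1 * mon hζ q h =
      (a - mon hζ p 1) * b + mon hζ p 1 * (b - mon hζ q h) := by noncomm_ring
  rw [this]
  refine Submodule.add_mem _ ?_ ?_
  · have := mul_mem_fil ha hb.mem_fil
    rwa [show totalDeg p + totalDeg q - 1 = totalDeg p - 1 + totalDeg q by ring]
  · have := mul_mem_fil (mon_mem_fil (hζ := hζ) (le_refl (totalDeg p)) 1) hb
    rwa [show totalDeg p + totalDeg q - 1 = totalDeg p + (totalDeg q - 1) by ring]

theorem HasLead.pow {a : Torus n hζ} {p : Fin n → ℤ} (ha : HasLead a p 1) (k : ℕ) :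
    HasLead (a ^ k) (k • p) 1 := by
  induction k with
  | zero =>
    rw [pow_zero, zero_smul, ← mon_zero_one]
    exact hasLead_mon _ _
  | succ k ih =>
    rw [pow_succ, succ_nsmul]
    exact ih.mul ha

theorem HasLead.coefAt_self {a : Torus n hζ} {p : Fin n → ℤ} {g : diagGroup n ℓ}
    (h : HasLead a p g) : coefAt hζ p g a = 1 := by
  have := coefAt_eq_zero h (p := p) (by omega) g
  rw [map_sub, sub_eq_zero] at this
  rw [this, coefAt_mon, if_pos ⟨rfl, rfl⟩]

theorem HasLead.coefAt_eq_zero {a : Torus n hζ} {p q : Fin n → ℤ} {g h : diagGroup n ℓ}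
    (ha : HasLead a p g) (hne : (q, h) ≠ (p, g)) (hd : totalDeg p ≤ totalDeg q) :
    coefAt hζ q h a = 0 := by
  have := TwistedHecke.coefAt_eq_zero ha (p := q) (by omega) h
  rw [map_sub, sub_eq_zero] at this
  rw [this, coefAt_mon, if_neg]
  rintro ⟨rfl, rfl⟩
  exact hne rfl

variable {I : Type*} {v : I → Torus n hζ} {e : I → (Fin n → ℤ) × diagGroup n ℓ}

/-- Leading terms cannot cancel: take an index of maximal degree in the support; its leading
monomial occurs in no other summand, so its coefficient survives. -/
theorem totalDeg_le_of_linearCombination_mem_fil (he : Function.Injective e)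
    (hv : ∀ i, HasLead (v i) (e i).1 (e i).2) {c : I →₀ ℂ} {d : ℤ}
    (hc : Finsupp.linearCombination ℂ v c ∈ fil hζ d) {i : I} (hi : i ∈ c.support) :
    totalDeg (e i).1 ≤ d := by
  obtain ⟨k, hk, hmax⟩ := c.support.exists_max_image (fun i => totalDeg (e i).1) ⟨i, hi⟩
  by_contra hd
  have hki := hmax i hi
  have h0 := coefAt_eq_zero hc (p := (e k).1) (by omega) (e k).2
  rw [Finsupp.linearCombination_apply, Finsupp.sum, map_sum, Finset.sum_eq_single k] at h0
  · rw [map_smul, (hv k).coefAt_self, smul_eq_mul, mul_one] at h0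
    exact (Finsupp.mem_support_iff.1 hk) h0
  · intro j hj hjk
    rw [map_smul, (hv j).coefAt_eq_zero (fun h => hjk (he h).symm) (hmax j hj), smul_zero]
  · exact fun h => absurd hk h

theorem linearIndependent_of_hasLead (he : Function.Injective e)
    (hv : ∀ i, HasLead (v i) (e i).1 (e i).2) : LinearIndependent ℂ v := by
  rw [linearIndependent_iff]
  intro c hc
  by_contra hne
  obtain ⟨i, hi⟩ := Finsupp.support_nonempty_iff.2 hne
  have := totalDeg_le_of_linearCombination_mem_fil he hv (c := c) (d := totalDeg (e i).1 - 1)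
    (by rw [hc]; exact Submodule.zero_mem _) hi
  omega

/-- The terms of top degree of a linear combination are leading terms of its summands. -/
theorem exists_eq_of_coefAt_ne_zero (he : Function.Injective e)
    (hv : ∀ i, HasLead (v i) (e i).1 (e i).2) {c : I →₀ ℂ} {d : ℤ}
    (hc : Finsupp.linearCombination ℂ v c ∈ fil hζ d) {p : Fin n → ℤ} {g : diagGroup n ℓ}
    (hp : totalDeg p = d) (h : coefAt hζ p g (Finsupp.linearCombination ℂ v c) ≠ 0) :
    ∃ i, e i = (p, g) := by
  by_contra! hne
  apply h
  rw [Finsupp.linearCombination_apply, Finsupp.sum, map_sum]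
  refine Finset.sum_eq_zero fun i hi => ?_
  have := totalDeg_le_of_linearCombination_mem_fil he hv hc hi
  rw [map_smul, (hv i).coefAt_eq_zero (hne i).symm (by omega), smul_zero]

end Filtration

/-! ### A spanning set of the Hecke algebra. -/

section PBW

theorem mulVec_single {n ℓ : ℕ} (g : diagGroup n ℓ) (i : Fin n) :
    Matrix.mulVec ((g : Matrix.SpecialLinearGroup (Fin n) ℂ) : Matrix (Fin n) (Fin n) ℂ)
      (Pi.single i 1) = entry g i • Pi.single i 1 := by
  rw [coe_eq_diagonal]
  ext j
  rw [Matrix.mulVec_diagonal, Pi.smul_apply, smul_eq_mul]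
  rcases eq_or_ne j i with rfl | h
  · rfl
  · simp [h]

variable {n ℓ : ℕ} [NeZero ℓ] {ζ : ℂ} [NeZero n] (hζ : IsPrimitiveRoot ζ ℓ) (t : Fin n → ℂ)

/-- The image of a group element in the Hecke algebra. -/
def heckeGrp (g : diagGroup n ℓ) : Hecke hζ t := RingQuot.mkAlgHom ℂ (HeckeRel hζ t) (preG hζ g)

theorem heckeGrp_mul (g h : diagGroup n ℓ) :
    heckeGrp hζ t g * heckeGrp hζ t h = (cocycleFun hζ g h : ℂ) • heckeGrp hζ t (g * h) := by
  rw [heckeGrp, heckeGrp, heckeGrp, ← map_mul, ← map_smul, preG, preG, preG,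
    CrossedProduct.single_mul_single, CrossedProduct.smul_single, map_one, mul_one, Units.smul_def]
  rfl

theorem heckeGrp_mul_heckeX (g : diagGroup n ℓ) (i : Fin n) :
    heckeGrp hζ t g * heckeX hζ t i = entry g i • (heckeX hζ t i * heckeGrp hζ t g) := by
  rw [heckeGrp, heckeX, ← map_mul, ← map_mul, ← map_smul, preG, preX,
    CrossedProduct.single_mul_single, CrossedProduct.single_mul_single, CrossedProduct.smul_single,
    (cocycle n hζ).map_one_left, (cocycle n hζ).map_one_right, tensorAction_ι, mulVec_single,
    map_smul, map_one, one_mul, mul_one, mul_one, one_mul, one_smul, one_smul]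

theorem exists_heckeX_commutator (hn : 3 ≤ n) (i j : Fin n) : ∃ (c : ℂ) (g : diagGroup n ℓ),
    heckeX hζ t i * heckeX hζ t j - heckeX hζ t j * heckeX hζ t i = c • heckeGrp hζ t g := by
  have hadj : ∀ i : Fin n, heckeX hζ t i * heckeX hζ t (i + 1) -
      heckeX hζ t (i + 1) * heckeX hζ t i = t i • heckeGrp hζ t (gen hζ i) := fun i => by
    have := RingQuot.mkAlgHom_rel ℂ (HeckeRel.adjacent (hζ := hζ) (t := t) i)
    rw [map_sub, map_mul, map_mul, map_smul] at this
    exact this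
  by_cases h : NonAdjacent i j
  · have := RingQuot.mkAlgHom_rel ℂ (HeckeRel.nonAdjacent (hζ := hζ) (t := t) i j h)
    rw [map_sub, map_mul, map_mul, map_zero] at this
    exact ⟨0, 1, by rw [zero_smul]; exact this⟩
  · rw [nonAdjacent_iff hn, not_and_or, not_not, not_not] at h
    rcases h with rfl | rfl
    · exact ⟨_, _, hadj i⟩
    · exact ⟨-t j, gen hζ j, by rw [neg_smul, ← hadj j, neg_sub]⟩

/-- The product of the generators `x_i` along a list of indices. -/
def word (l : List (Fin n)) : Hecke hζ t := (l.map (heckeX hζ t)).prod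

theorem word_cons (i : Fin n) (l : List (Fin n)) :
    word hζ t (i :: l) = heckeX hζ t i * word hζ t l := by
  rw [word, List.map_cons, List.prod_cons, word]

theorem exists_heckeGrp_mul_word (g : diagGroup n ℓ) (l : List (Fin n)) :
    ∃ c : ℂ, heckeGrp hζ t g * word hζ t l = c • (word hζ t l * heckeGrp hζ t g) := by
  induction l with
  | nil => exact ⟨1, by simp [word]⟩
  | cons i l ih =>
    obtain ⟨c, hc⟩ := ih
    refine ⟨entry g i * c, ?_⟩
    rw [word_cons, ← mul_assoc, heckeGrp_mul_heckeX, smul_mul_assoc, mul_assoc, hc, mul_smul_comm,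
      smul_smul, mul_assoc]

/-- The span of the products of words of length less than `d` with group elements. -/
def wordSpan (d : ℕ) : Submodule ℂ (Hecke hζ t) :=
  Submodule.span ℂ {a | ∃ l g, l.length < d ∧ word hζ t l * heckeGrp hζ t g = a}

theorem heckeX_mul_mem_wordSpan (i : Fin n) {d : ℕ} {a : Hecke hζ t} (ha : a ∈ wordSpan hζ t d) :
    heckeX hζ t i * a ∈ wordSpan hζ t (d + 1) := by
  induction ha using Submodule.span_induction with
  | mem a ha =>
    obtain ⟨l, g, hl, rfl⟩ := ha
    refine Submodule.subset_span ⟨i :: l, g, by simpa using hl, ?_⟩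
    rw [word_cons, mul_assoc]
  | zero => rw [mul_zero]; exact Submodule.zero_mem _
  | add a b _ _ ha hb => rw [mul_add]; exact Submodule.add_mem _ ha hb
  | smul c a _ ha => rw [mul_smul_comm]; exact Submodule.smul_mem _ _ ha

theorem mul_heckeGrp_mem_wordSpan (g : diagGroup n ℓ) {d : ℕ} {a : Hecke hζ t}
    (ha : a ∈ wordSpan hζ t d) : a * heckeGrp hζ t g ∈ wordSpan hζ t d := by
  induction ha using Submodule.span_induction with
  | mem a ha =>
    obtain ⟨l, h, hl, rfl⟩ := ha
    rw [mul_assoc, heckeGrp_mul, mul_smul_comm]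
    exact Submodule.smul_mem _ _ (Submodule.subset_span ⟨l, h * g, hl, rfl⟩)
  | zero => rw [zero_mul]; exact Submodule.zero_mem _
  | add a b _ _ ha hb => rw [add_mul]; exact Submodule.add_mem _ ha hb
  | smul c a _ ha => rw [smul_mul_assoc]; exact Submodule.smul_mem _ _ ha

/-- Swapping two neighbouring letters changes a word by a scalar times a group element in their
place, which moves to the right end and leaves a word shorter by two. -/
theorem word_sub_word_mem_wordSpan (hn : 3 ≤ n) {l l' : List (Fin n)} (h : l.Perm l') :
    word hζ t l - word hζ t l' ∈ wordSpan hζ t l.length := by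
  induction h with
  | nil => rw [sub_self]; exact Submodule.zero_mem _
  | cons i _ ih =>
    rw [word_cons, word_cons, ← mul_sub]
    exact heckeX_mul_mem_wordSpan hζ t i ih
  | swap i j l =>
    obtain ⟨c, g, hc⟩ := exists_heckeX_commutator hζ t hn j i
    obtain ⟨c', hc'⟩ := exists_heckeGrp_mul_word hζ t g l
    rw [word_cons, word_cons, word_cons, word_cons, ← mul_assoc, ← mul_assoc, ← sub_mul, hc,
      smul_mul_assoc, hc']
    refine Submodule.smul_mem _ _ (Submodule.smul_mem _ _ (Submodule.subset_span ⟨l, g, ?_, rfl⟩))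
    simp
  | trans h1 _ ih1 ih2 =>
    rw [← h1.length_eq] at ih2
    rw [← sub_add_sub_cancel]
    exact Submodule.add_mem _ ih1 ih2

/-- The elements of the basis of the Hecke algebra. -/
def pbw (u : Multiset (Fin n) × diagGroup n ℓ) : Hecke hζ t :=
  word hζ t u.1.toList * heckeGrp hζ t u.2

/-- Induction on the length. In `pbw` the order of the letters is the arbitrary one of
`Multiset.toList`; this is harmless, since another order changes the element only by shorter words.
-/
theorem wordSpan_le_span_pbw (hn : 3 ≤ n) (d : ℕ) :
    wordSpan hζ t d ≤ Submodule.span ℂ (Set.range (pbw hζ t)) := by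
  induction d with
  | zero =>
    rw [wordSpan, Submodule.span_le]
    rintro _ ⟨l, g, hl, rfl⟩
    exact absurd hl (Nat.not_lt_zero _)
  | succ d ih =>
    rw [wordSpan, Submodule.span_le]
    rintro _ ⟨l, g, hl, rfl⟩
    have hperm : l.Perm (l : Multiset (Fin n)).toList :=
      Multiset.coe_eq_coe.1 (Multiset.coe_toList _).symm
    have h1 := mul_heckeGrp_mem_wordSpan hζ t g (word_sub_word_mem_wordSpan hζ t hn hperm)
    have h2 : wordSpan hζ t l.length ≤ wordSpan hζ t d :=
      Submodule.span_mono fun _ ⟨l', g, hl', ha⟩ => ⟨l', g, by omega, ha⟩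
    have h3 := ih (h2 h1)
    rw [sub_mul] at h3
    rw [SetLike.mem_coe, ← sub_add_cancel (word hζ t l * heckeGrp hζ t g)]
    exact Submodule.add_mem _ h3 (Submodule.subset_span ⟨((l : Multiset (Fin n)), g), rfl⟩)

/-- The span contains the group elements and is stable under left multiplication by the x_i, hence
by the image of TV; the crossed product is generated by G as a left TV-module. -/
theorem span_pbw (hn : 3 ≤ n) : Submodule.span ℂ (Set.range (pbw hζ t)) = ⊤ := by
  set W := Submodule.span ℂ (Set.range (pbw hζ t)) with hW
  have hx : ∀ i, ∀ a ∈ W, heckeX hζ t i * a ∈ W := fun i a ha => by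
    induction ha using Submodule.span_induction with
    | mem a ha =>
      obtain ⟨⟨m, g⟩, rfl⟩ := ha
      refine wordSpan_le_span_pbw hζ t hn _ (heckeX_mul_mem_wordSpan hζ t i
        (Submodule.subset_span ⟨m.toList, g, Nat.lt_succ_self _, rfl⟩))
    | zero => rw [mul_zero]; exact Submodule.zero_mem _
    | add a b _ _ ha hb => rw [mul_add]; exact Submodule.add_mem _ ha hb
    | smul c a _ ha => rw [mul_smul_comm]; exact Submodule.smul_mem _ _ ha
  have hg : ∀ g, heckeGrp hζ t g ∈ W := fun g =>
    Submodule.subset_span ⟨(0, g), by simp [pbw, word]⟩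
  have hE : ∀ r : TensorAlgebra ℂ (Fin n → ℂ), ∀ a ∈ W,
      RingQuot.mkAlgHom ℂ (HeckeRel hζ t) (CrossedProduct.single 1 r) * a ∈ W := fun r => by
    induction r using TensorAlgebra.induction with
    | algebraMap c =>
      intro a ha
      have : (CrossedProduct.single 1 (algebraMap ℂ _ c) : TensorCrossed n hζ) = c • 1 := by
        rw [CrossedProduct.one_def, CrossedProduct.smul_single, Algebra.algebraMap_eq_smul_one]
      rw [this, map_smul, map_one, smul_mul_assoc, one_mul]
      exact Submodule.smul_mem _ _ ha
    | ι v =>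
      intro a ha
      have : (CrossedProduct.single 1 (TensorAlgebra.ι ℂ v) : TensorCrossed n hζ) =
          ∑ i, v i • preX hζ i := by
        have hlin : ∀ v : Fin n → ℂ, v = ∑ i, v i • Pi.single i (1 : ℂ) := fun v => by
          ext j
          simp [Finset.sum_apply, Pi.single_apply]
        let L : TensorAlgebra ℂ (Fin n → ℂ) →ₗ[ℂ] TensorCrossed n hζ :=
          { toFun := CrossedProduct.single 1
            map_add' := CrossedProduct.single_add 1
            map_smul' := fun c r => (CrossedProduct.smul_single c 1 r).symm }
        change L (TensorAlgebra.ι ℂ v) = _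
        conv_lhs => rw [hlin v, map_sum, map_sum]
        refine Finset.sum_congr rfl fun i _ => ?_
        rw [map_smul, map_smul]
        rfl
      rw [this, map_sum, Finset.sum_mul]
      refine Submodule.sum_mem _ fun i _ => ?_
      rw [map_smul, smul_mul_assoc]
      exact Submodule.smul_mem _ _ (hx i a ha)
    | mul r s hr hs =>
      intro a ha
      have : (CrossedProduct.single 1 (r * s) : TensorCrossed n hζ) =
          CrossedProduct.single 1 r * CrossedProduct.single 1 s := by
        rw [CrossedProduct.single_mul_single, map_one, (cocycle n hζ).map_one_left, one_smul,
          one_mul, AlgEquiv.one_apply]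
      rw [this, map_mul, mul_assoc]
      exact hr _ (hs _ ha)
    | add r s hr hs =>
      intro a ha
      rw [CrossedProduct.single_add, map_add, add_mul]
      exact Submodule.add_mem _ (hr a ha) (hs a ha)
  rw [eq_top_iff]
  intro a _
  obtain ⟨b, rfl⟩ := RingQuot.mkAlgHom_surjective ℂ (HeckeRel hζ t) a
  induction b using CrossedProduct.induction_on with
  | h0 => rw [map_zero]; exact Submodule.zero_mem _
  | hadd a b ha hb =>
    rw [map_add]
    exact Submodule.add_mem _ (ha trivial) (hb trivial)
  | hs g r =>
    have : (CrossedProduct.single g r : TensorCrossed n hζ) =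
        CrossedProduct.single 1 r * preG hζ g := by
      rw [preG, CrossedProduct.single_mul_single, map_one, (cocycle n hζ).map_one_left, one_smul,
        one_mul, mul_one]
    rw [this, map_mul]
    exact hE r _ (hg g)

end PBW

/-! ### The embedding of the Hecke algebra in the torus. -/

section Embedding

variable {n ℓ : ℕ} [NeZero ℓ] {ζ : ℂ} [NeZero n]

/-- The homomorphism from `TV #_α G` to the quantum torus. -/
def tensorToTorus (hn : 3 ≤ n) (hζ : IsPrimitiveRoot ζ ℓ) (t : Fin n → ℂ) :
    TensorCrossed n hζ →ₐ[ℂ] Torus n hζ :=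
  CrossedProduct.lift (TensorAlgebra.lift ℂ (Fintype.linearCombination ℂ (torusGen hζ t)))
    (mon hζ 0) (mon_zero_one hζ)
    (fun g h => by rw [mon_mul_mon, twist_zero, add_zero]; rfl)
    (fun g r => by
      induction r using TensorAlgebra.induction with
      | algebraMap c =>
        rw [AlgEquiv.commutes, AlgHom.commutes, Algebra.commutes]
      | ι v =>
        rw [tensorAction_ι, TensorAlgebra.lift_ι_apply, TensorAlgebra.lift_ι_apply,
          Fintype.linearCombination_apply, Fintype.linearCombination_apply, Finset.mul_sum,
          Finset.sum_mul]
        refine Finset.sum_congr rfl fun i _ => ?_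
        rw [coe_eq_diagonal, Matrix.mulVec_diagonal, mul_smul_comm, mon_mul_torusGen hζ t hn,
          smul_mul_assoc, smul_smul, mul_comm]
      | mul r s hr hs => rw [map_mul, map_mul, map_mul, ← mul_assoc, hr, mul_assoc, hs, mul_assoc]
      | add r s hr hs => rw [map_add, map_add, map_add, mul_add, add_mul, hr, hs])

theorem tensorToTorus_preX (hn : 3 ≤ n) (hζ : IsPrimitiveRoot ζ ℓ) (t : Fin n → ℂ) (i : Fin n) :
    tensorToTorus hn hζ t (preX hζ i) = torusGen hζ t i := by
  rw [tensorToTorus, preX, CrossedProduct.lift_single, TensorAlgebra.lift_ι_apply, mon_zero_one,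
    mul_one]
  simp [Fintype.linearCombination_apply, Pi.single_apply]

theorem tensorToTorus_preG (hn : 3 ≤ n) (hζ : IsPrimitiveRoot ζ ℓ) (t : Fin n → ℂ)
    (g : diagGroup n ℓ) : tensorToTorus hn hζ t (preG hζ g) = mon hζ 0 g := by
  rw [tensorToTorus, preG, CrossedProduct.lift_single, map_one, one_mul]

/-- The homomorphism from the Hecke algebra to the quantum torus. -/
def heckeToTorus (hℓ : 2 ≤ ℓ) (hn : 3 ≤ n) (hζ : IsPrimitiveRoot ζ ℓ) (t : Fin n → ℂ) :
    Hecke hζ t →ₐ[ℂ] Torus n hζ :=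
  RingQuot.liftAlgHom ℂ ⟨tensorToTorus hn hζ t, fun x y h => by
    cases h with
    | adjacent i =>
      rw [map_sub, map_mul, map_mul, map_smul, tensorToTorus_preX, tensorToTorus_preX,
        tensorToTorus_preG, torusGen_adjacent hζ t hn (hζ.ne_one (by omega))]
    | nonAdjacent i j h =>
      rw [map_sub, map_mul, map_mul, map_zero, tensorToTorus_preX, tensorToTorus_preX,
        torusGen_nonAdjacent hζ t hn h]⟩

variable (hℓ : 2 ≤ ℓ) (hn : 3 ≤ n) (hζ : IsPrimitiveRoot ζ ℓ) (t : Fin n → ℂ)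

theorem heckeToTorus_heckeX (i : Fin n) :
    heckeToTorus hℓ hn hζ t (heckeX hζ t i) = torusGen hζ t i := by
  rw [heckeToTorus, heckeX, RingQuot.liftAlgHom_mkAlgHom_apply, tensorToTorus_preX]

theorem heckeToTorus_heckeGrp (g : diagGroup n ℓ) :
    heckeToTorus hℓ hn hζ t (heckeGrp hζ t g) = mon hζ 0 g := by
  rw [heckeToTorus, heckeGrp, RingQuot.liftAlgHom_mkAlgHom_apply, tensorToTorus_preG]

theorem heckeToTorus_heckeW : heckeToTorus hℓ hn hζ t (heckeW hζ t) = torusW hζ t := by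
  rw [← sum_indexJ_eq_torusW hn, heckeW, map_sum]
  refine Finset.sum_congr rfl fun S _ => ?_
  rw [map_smul, map_mul, map_list_prod, map_list_prod, List.map_ofFn, List.map_map]
  congr 4
  · funext j
    simp [heckeToTorus_heckeX]
  · funext i
    exact heckeToTorus_heckeGrp hℓ hn hζ t (gen hζ i)

theorem hasLead_torusGen (i : Fin n) : HasLead (torusGen hζ t i) (Pi.single i 1) 1 := by
  rw [HasLead, torusGen, torusX, sub_sub_cancel_left, torusY]
  refine Submodule.neg_mem _ (Submodule.smul_mem _ _ (mon_mem_fil ?_ _))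
  rw [totalDeg_neg, totalDeg_single, totalDeg_single]
  norm_num

theorem hasLead_word (l : List (Fin n)) : HasLead (heckeToTorus hℓ hn hζ t (word hζ t l))
    (fun j => (l.count j : ℤ)) 1 := by
  induction l with
  | nil =>
    have : (fun j : Fin n => (([] : List (Fin n)).count j : ℤ)) = 0 := by ext; simp
    rw [this, word, List.map_nil, List.prod_nil, map_one, ← mon_zero_one]
    exact hasLead_mon _ _
  | cons i l ih =>
    have : (fun j : Fin n => ((i :: l).count j : ℤ)) =
        Pi.single i 1 + fun j => (l.count j : ℤ) := by
      ext j
      rw [List.count_cons, Pi.add_apply, Pi.single_apply, add_comm]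
      push_cast
      congr 1
      simp only [beq_iff_eq, eq_comm (a := i)]
    rw [this, word_cons, map_mul, heckeToTorus_heckeX]
    exact (hasLead_torusGen hζ t i).mul ih

/-- The exponents of the leading terms of the basis elements. -/
def pbwExp (u : Multiset (Fin n) × diagGroup n ℓ) : (Fin n → ℤ) × diagGroup n ℓ :=
  (fun j => (u.1.count j : ℤ), u.2)

omit [NeZero ℓ] [NeZero n] in
theorem pbwExp_injective : Function.Injective (pbwExp (n := n) (ℓ := ℓ)) := by
  rintro ⟨m, g⟩ ⟨m', g'⟩ h
  rw [pbwExp, pbwExp, Prod.mk.injEq] at h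
  obtain ⟨h1, rfl⟩ := h
  congr 1
  ext j
  exact_mod_cast congrFun h1 j

theorem hasLead_pbw (u : Multiset (Fin n) × diagGroup n ℓ) :
    HasLead (heckeToTorus hℓ hn hζ t (pbw hζ t u)) (pbwExp u).1 (pbwExp u).2 := by
  have h := (hasLead_word hℓ hn hζ t u.1.toList).mul (hasLead_mon (hζ := hζ) 0 u.2)
  rw [add_zero, ← heckeToTorus_heckeGrp hℓ hn hζ t, ← map_mul] at h
  have h2 : (fun j => (u.1.toList.count j : ℤ)) = (pbwExp u).1 := by
    ext j
    rw [pbwExp, ← Multiset.coe_count, Multiset.coe_toList]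
  rw [h2] at h
  exact h

include hn in
theorem exists_linearCombination (a : Hecke hζ t) :
    ∃ c, Finsupp.linearCombination ℂ (pbw hζ t) c = a := by
  have : a ∈ Submodule.span ℂ (Set.range (pbw hζ t)) := by rw [span_pbw hζ t hn]; trivial
  rwa [Finsupp.mem_span_range_iff_exists_finsupp] at this

theorem map_linearCombination_pbw (c : Multiset (Fin n) × diagGroup n ℓ →₀ ℂ) :
    heckeToTorus hℓ hn hζ t (Finsupp.linearCombination ℂ (pbw hζ t) c) =
      Finsupp.linearCombination ℂ (fun u => heckeToTorus hℓ hn hζ t (pbw hζ t u)) c := by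
  simp [Finsupp.linearCombination_apply, Finsupp.sum]

/-- A spanning set is mapped to a linearly independent family, because the leading exponents record
the multiset and the group element. -/
theorem heckeToTorus_injective : Function.Injective (heckeToTorus hℓ hn hζ t) := by
  rw [injective_iff_map_eq_zero]
  intro a ha
  obtain ⟨c, rfl⟩ := exists_linearCombination hn hζ t a
  rw [map_linearCombination_pbw] at ha
  rw [linearIndependent_iff.1 (linearIndependent_of_hasLead pbwExp_injective
    (hasLead_pbw hℓ hn hζ t)) c ha, map_zero]

end Embedding

end TwistedHecke

end

noncomputable section

namespace TwistedHecke

/-! ### The coefficients ν_r and the Girard-Waring formula for two variables. -/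

section PowerSums

/-- The coefficients expressing `u ^ m + v ^ m` through `u + v` and `u v`, up to sign. -/
def lucasCoeff : ℕ → ℕ → ℕ
  | 0, 0 => 2
  | _ + 1, 0 => 1
  | 0, _ + 1 => 0
  | 1, _ + 1 => 0
  | m + 2, r + 1 => lucasCoeff (m + 1) (r + 1) + lucasCoeff m r

theorem lucasCoeff_eq_zero : ∀ {m r : ℕ}, m < 2 * r → lucasCoeff m r = 0
  | 0, 0, h => by omega
  | _ + 1, 0, h => by omega
  | 0, _ + 1, _ => rfl
  | 1, _ + 1, _ => rfl
  | m + 2, r + 1, h => by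
    rw [lucasCoeff, lucasCoeff_eq_zero (m := m + 1) (by omega),
      lucasCoeff_eq_zero (m := m) (by omega)]

theorem lucasCoeff_two_mul : ∀ r : ℕ, lucasCoeff (2 * r) r = 2
  | 0 => rfl
  | r + 1 => by
    rw [show 2 * (r + 1) = 2 * r + 2 by ring, lucasCoeff, lucasCoeff_eq_zero (by omega),
      lucasCoeff_two_mul r]

/-- Pascal's rule for both binomials. Writing m as 2(r + 1) + k restricts to the nonzero
coefficients and avoids truncated subtraction. -/
theorem lucasCoeff_eq_choose : ∀ r k : ℕ, lucasCoeff (2 * (r + 1) + k) (r + 1) =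
    (r + 1 + k).choose (r + 1) + (r + k).choose r
  | r, 0 => by rw [add_zero, lucasCoeff_two_mul]; simp
  | 0, k + 1 => by
    have h : lucasCoeff (k + 1) 0 = 1 := rfl
    rw [show 2 * (0 + 1) + (k + 1) = k + 1 + 2 by ring, lucasCoeff, h,
      show k + 1 + 1 = 2 * (0 + 1) + k by ring, lucasCoeff_eq_choose 0 k]
    simp
    ring
  | r + 1, k + 1 => by
    rw [show 2 * (r + 1 + 1) + (k + 1) = 2 * (r + 1) + (k + 1) + 2 by ring, lucasCoeff,
      lucasCoeff_eq_choose r (k + 1),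
      show 2 * (r + 1) + (k + 1) + 1 = 2 * (r + 1 + 1) + k by ring, lucasCoeff_eq_choose (r + 1) k,
      show r + 1 + 1 + (k + 1) = r + 1 + k + 1 + 1 by ring,
      Nat.choose_succ_succ' (r + 1 + k + 1) (r + 1),
      show r + 1 + (k + 1) = r + 1 + k + 1 by ring, Nat.choose_succ_succ' (r + 1 + k) r,
      show r + 1 + 1 + k = r + 1 + k + 1 by ring, show r + (k + 1) = r + 1 + k by ring]
    ring

theorem lucasCoeff_mul {m r : ℕ} (hm : 0 < m) (h : 2 * r ≤ m) :
    (m - r) * lucasCoeff m r = m * (m - r).choose r := by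
  cases r with
  | zero =>
    obtain ⟨m, rfl⟩ : ∃ k, m = k + 1 := ⟨m - 1, by omega⟩
    simp [lucasCoeff]
  | succ r =>
    obtain ⟨k, rfl⟩ : ∃ k, m = 2 * (r + 1) + k := ⟨m - 2 * (r + 1), by omega⟩
    rw [lucasCoeff_eq_choose, show 2 * (r + 1) + k - (r + 1) = r + k + 1 by omega,
      show r + 1 + k = r + k + 1 by ring, mul_add, Nat.add_one_mul_choose_eq]
    ring

theorem nu_eq_lucasCoeff {m r : ℕ} (hm : 0 < m) (h : 2 * r ≤ m) :
    nu m r = (-1) ^ r * (lucasCoeff m r : ℂ) := by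
  have h1 := congrArg (Nat.cast : ℕ → ℂ) (lucasCoeff_mul hm h)
  rw [Nat.cast_mul, Nat.cast_mul, Nat.cast_sub (by omega)] at h1
  have h2 : (m : ℂ) - r ≠ 0 := by
    rw [sub_ne_zero]
    exact_mod_cast (by omega : m ≠ r)
  rw [nu, mul_assoc, div_mul_eq_mul_div, ← h1, mul_div_cancel_left₀ _ h2]

variable {A : Type*} [CommRing A]

/-- The recursion of `lucasCoeff` is that of the power sums, p_{m+2} = (u + v) p_{m+1} - uv p_m. The
bound N is free so that the sums for m + 2 and m + 1 have the same range and the one for m, shifted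
by one, is shorter by one; the surplus coefficients vanish. -/
theorem sum_lucasCoeff (u v : A) : ∀ m N : ℕ, m < N → ∑ r ∈ Finset.range N,
    (-1) ^ r * (lucasCoeff m r : A) * (u * v) ^ r * (u + v) ^ (m - 2 * r) = u ^ m + v ^ m
  | 0, N, h => by
    rw [Finset.sum_eq_single 0]
    · simp [lucasCoeff]; norm_num
    · intro r _ hr
      rw [lucasCoeff_eq_zero (by omega)]
      simp
    · simp; omega
  | 1, N, h => by
    rw [Finset.sum_eq_single 0]
    · simp [lucasCoeff]
    · intro r _ hr
      rw [lucasCoeff_eq_zero (by omega)]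
      simp
    · simp; omega
  | m + 2, 0, h => by omega
  | m + 2, N + 1, h => by
    have h1 := sum_lucasCoeff u v (m + 1) (N + 1) (by omega)
    have h2 := sum_lucasCoeff u v m N (by omega)
    have h3 : u ^ (m + 2) + v ^ (m + 2) =
        (u + v) * (u ^ (m + 1) + v ^ (m + 1)) - u * v * (u ^ m + v ^ m) := by ring
    rw [h3, ← h1, ← h2, Finset.sum_range_succ', Finset.sum_range_succ', mul_add, Finset.mul_sum,
      Finset.mul_sum, add_sub_right_comm, ← Finset.sum_sub_distrib]
    congr 1
    · refine Finset.sum_congr rfl fun r _ => ?_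
      rw [lucasCoeff, show m + 2 - 2 * (r + 1) = m - 2 * r by omega]
      -- In the first case the exponent `m + 1 - 2 * (r + 1)` is truncated, but its coefficient is
      -- zero.
      rcases Nat.lt_or_ge (m + 1) (2 * (r + 1)) with h4 | h4
      · rw [lucasCoeff_eq_zero h4]
        push_cast
        ring
      · rw [show m - 2 * r = m + 1 - 2 * (r + 1) + 1 by omega]
        push_cast
        ring
    · simp [lucasCoeff]
      ring

theorem sum_nu [Algebra ℂ A] {m : ℕ} (hm : 0 < m) (u v : A) : ∑ r ∈ Finset.range (m / 2 + 1),
    algebraMap ℂ A (nu m r) * (u * v) ^ r * (u + v) ^ (m - 2 * r) = u ^ m + v ^ m := by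
  rw [← sum_lucasCoeff u v m (m + 1) (by omega)]
  refine (Finset.sum_congr rfl fun r hr => ?_).trans
    (Finset.sum_subset (Finset.range_mono (by omega)) fun r _ hr => ?_)
  · rw [Finset.mem_range] at hr
    rw [nu_eq_lucasCoeff hm (by omega), map_mul, map_pow, map_neg, map_one, map_natCast]
  · rw [Finset.mem_range] at hr
    rw [lucasCoeff_eq_zero (by omega)]
    simp

end PowerSums

/-! ### Central elements and the maps from the polynomial ring. -/

section Center

variable {n ℓ : ℕ} [NeZero ℓ] {ζ : ℂ}

omit [NeZero ℓ] in
theorem weight_card_nsmul (p : Fin n → ℤ) (g : diagGroup n ℓ) : weight (ℓ • p) g = 1 := by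
  have hg : g ^ ℓ = 1 := Subtype.ext g.2.2
  rw [weight_nsmul, ← map_pow, hg, map_one]

/-- A central monomial of the quantum torus. -/
def centralMon (hζ : IsPrimitiveRoot ζ ℓ) (p : Fin n → ℤ)
    (h : ∀ g : diagGroup n ℓ, weight p g = 1) : Subalgebra.center ℂ (Torus n hζ) :=
  ⟨mon hζ p 1, mem_center_of_weight hζ h⟩

theorem list_prod_mon_one {ι : Type*} (hζ : IsPrimitiveRoot ζ ℓ) (p : ι → Fin n → ℤ)
    (l : List ι) : (l.map fun i => mon hζ (p i) 1).prod = mon hζ (l.map p).sum 1 := by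
  induction l with
  | nil => simp [mon_zero_one]
  | cons a l ih => rw [List.map_cons, List.prod_cons, ih, mon_one_mul_mon, List.map_cons,
      List.sum_cons]

theorem prod_centralMon (hζ : IsPrimitiveRoot ζ ℓ) (p : Fin n → Fin n → ℤ)
    (h : ∀ i, ∀ g : diagGroup n ℓ, weight (p i) g = 1) (q : Fin n → ℤ)
    (hq : ∀ g : diagGroup n ℓ, weight q g = 1) (hpq : ∑ i, p i = q) :
    ∏ i, centralMon hζ (p i) (h i) = centralMon hζ q hq := by
  apply Subtype.ext
  rw [← List.prod_ofFn]
  change (Subalgebra.center ℂ (Torus n hζ)).val _ = mon hζ q 1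
  rw [map_list_prod, List.map_ofFn, ← hpq, ← List.sum_ofFn, List.ofFn_eq_map, List.ofFn_eq_map,
    ← list_prod_mon_one]
  rfl

theorem sum_single_eq_deltaVec (n : ℕ) : ∑ j, Pi.single j (1 : ℤ) = deltaVec n := by
  ext k
  simp [Finset.sum_apply, Pi.single_apply, deltaVec]

/-- This lemma and the next three turn commutation with a monomial or a group element into equations
between coefficients; they are used to find the top degree part of a central element. -/
theorem coefAt_mon_mul (hζ : IsPrimitiveRoot ζ ℓ) (p q : Fin n → ℤ) (g : diagGroup n ℓ)
    (a : Torus n hζ) : coefAt hζ (p + q) g (mon hζ q 1 * a) = coefAt hζ p g a := by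
  induction a using torus_induction with
  | h0 => rw [mul_zero, map_zero, map_zero]
  | hadd a b ha hb => rw [mul_add, map_add, map_add, ha, hb]
  | hm c p' g' =>
    rw [mul_smul_comm, mon_one_mul_mon, map_smul, map_smul, coefAt_mon, coefAt_mon, add_comm q]
    simp only [add_left_inj]

theorem coefAt_mul_mon (hζ : IsPrimitiveRoot ζ ℓ) (p q : Fin n → ℤ) (g : diagGroup n ℓ)
    (a : Torus n hζ) :
    coefAt hζ (p + q) g (a * mon hζ q 1) = weight q g * coefAt hζ p g a := by
  induction a using torus_induction with
  | h0 => rw [zero_mul, map_zero, map_zero, mul_zero]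
  | hadd a b ha hb => rw [add_mul, map_add, map_add, ha, hb, mul_add]
  | hm c p' g' =>
    rw [smul_mul_assoc, mon_mul_mon_one, map_smul, map_smul, map_smul, coefAt_mon, coefAt_mon,
      smul_eq_mul, smul_eq_mul, smul_eq_mul, mul_left_comm]
    simp only [add_left_inj]
    split_ifs with h
    · rw [h.2]
    · simp

theorem coefAt_grp_mul (hζ : IsPrimitiveRoot ζ ℓ) (p : Fin n → ℤ) (h : diagGroup n ℓ)
    (a : Torus n hζ) : coefAt hζ p h (mon hζ 0 h * a) = weight p h * coefAt hζ p 1 a := by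
  induction a using torus_induction with
  | h0 => rw [mul_zero, map_zero, map_zero, mul_zero]
  | hadd a b ha hb => rw [mul_add, map_add, map_add, ha, hb, mul_add]
  | hm c p' g' =>
    rw [mul_smul_comm, mon_mul_mon, map_smul, map_smul, map_smul, coefAt_mon, coefAt_mon,
      zero_add, smul_eq_mul, smul_eq_mul, smul_eq_mul, mul_left_comm]
    simp only [left_eq_mul, eq_comm (a := (1 : diagGroup n ℓ))]
    split_ifs with h
    · rw [h.1, h.2, twist_one]
    · simp

theorem coefAt_mul_grp (hζ : IsPrimitiveRoot ζ ℓ) (p : Fin n → ℤ) (h : diagGroup n ℓ)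
    (a : Torus n hζ) : coefAt hζ p h (a * mon hζ 0 h) = coefAt hζ p 1 a := by
  induction a using torus_induction with
  | h0 => rw [zero_mul, map_zero, map_zero]
  | hadd a b ha hb => rw [add_mul, map_add, map_add, ha, hb]
  | hm c p' g' =>
    rw [smul_mul_assoc, mon_mul_mon, map_smul, map_smul, map_smul, coefAt_mon, coefAt_mon,
      add_zero]
    simp only [right_eq_mul, eq_comm (a := (1 : diagGroup n ℓ))]
    split_ifs with h
    · rw [h.2, map_one, Units.val_one, one_smul]
    · simp

variable [NeZero n]

theorem weight_gen (hζ : IsPrimitiveRoot ζ ℓ) (p : Fin n → ℤ) (i : Fin n) :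
    weight p (gen hζ i) = zetaUnit hζ ^ (p i - p (i + 1)) := by
  have hs : (Finset.univ.prod fun j => zetaUnit hζ ^ (((if j = i then 1 else 0) : ℤ) * p j)) =
      zetaUnit hζ ^ p i := by
    rw [Finset.prod_eq_single i] <;> simp +contextual
  have hs' : (Finset.univ.prod fun j => zetaUnit hζ ^ (((if j = i + 1 then 1 else 0) : ℤ) * p j)) =
      zetaUnit hζ ^ p (i + 1) := by
    rw [Finset.prod_eq_single (i + 1)] <;> simp +contextual
  rw [weight_apply, zpow_sub, ← hs, ← hs', ← div_eq_mul_inv, ← Finset.prod_div_distrib]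
  refine Finset.prod_congr rfl fun j _ => ?_
  rw [entryUnit_gen, ← zpow_mul, sub_mul, zpow_sub, div_eq_mul_inv]

/-- The eigenvalue of g_i is ζ^(p_i - p_{i+1}), so neighbouring entries of an invariant exponent
agree modulo ℓ. -/
theorem emod_eq_of_weight (hζ : IsPrimitiveRoot ζ ℓ) {p : Fin n → ℤ}
    (h : ∀ g : diagGroup n ℓ, weight p g = 1) (j : Fin n) : p j % ℓ = p 0 % ℓ := by
  have hstep : ∀ i, p (i + 1) % ℓ = p i % ℓ := fun i => by
    have h1 := h (gen hζ i)
    rw [weight_gen] at h1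
    have h2 := congrArg Units.val h1
    rw [Units.val_zpow_eq_zpow_val, coe_zetaUnit, Units.val_one, hζ.zpow_eq_one_iff_dvd] at h2
    exact Int.modEq_iff_dvd.2 h2
  obtain ⟨j, hj⟩ := j
  induction j with
  | zero => rfl
  | succ j ih =>
    have h1 := hstep ⟨j, by omega⟩
    have h2 : (⟨j, by omega⟩ + 1 : Fin n) = ⟨j + 1, hj⟩ :=
      Fin.ext (val_add_one_of_lt' (i := (⟨j, by omega⟩ : Fin n)) hj)
    rw [h2] at h1
    rw [h1, ih]

variable (hℓ : 2 ≤ ℓ) (hn : 3 ≤ n) (hζ : IsPrimitiveRoot ζ ℓ) (t : Fin n → ℂ)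

include hℓ hn

theorem torusGen_pow_mem_center (i : Fin n) :
    torusGen hζ t i ^ ℓ ∈ Subalgebra.center ℂ (Torus n hζ) := by
  obtain ⟨j, rfl⟩ : ∃ j, i = j + 1 := ⟨i - 1, by rw [sub_add_cancel]⟩
  rw [torusGen_pow hℓ hn]
  refine Subalgebra.sub_mem _ (mem_center_of_weight hζ (weight_card_nsmul _))
    (Subalgebra.smul_mem _ (mem_center_of_weight hζ fun g => ?_) _)
  rw [weight_neg, weight_card_nsmul, inv_one]

omit hℓ hn [NeZero n] in
theorem torusW_mem_center : torusW hζ t ∈ Subalgebra.center ℂ (Torus n hζ) := by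
  refine Subalgebra.add_mem _ (mem_center_of_weight hζ weight_deltaVec)
    (Subalgebra.smul_mem _ (mem_center_of_weight hζ fun g => ?_) _)
  rw [weight_neg, weight_deltaVec, inv_one]

theorem mem_center_of_map {a : Hecke hζ t}
    (h : heckeToTorus hℓ hn hζ t a ∈ Subalgebra.center ℂ (Torus n hζ)) :
    a ∈ Subalgebra.center ℂ (Hecke hζ t) := by
  rw [Subalgebra.mem_center_iff] at h ⊢
  intro b
  apply heckeToTorus_injective hℓ hn hζ t
  rw [map_mul, map_mul, h]

theorem heckeX_pow_mem_center (i : Fin n) :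
    heckeX hζ t i ^ ℓ ∈ Subalgebra.center ℂ (Hecke hζ t) := by
  apply mem_center_of_map hℓ hn
  rw [map_pow, heckeToTorus_heckeX]
  exact torusGen_pow_mem_center hℓ hn hζ t i

theorem heckeW_mem_center : heckeW hζ t ∈ Subalgebra.center ℂ (Hecke hζ t) := by
  apply mem_center_of_map hℓ hn
  rw [heckeToTorus_heckeW]
  exact torusW_mem_center hζ t

/-- The homomorphism from the polynomial ring to the center of the Hecke algebra. -/
def polyToCenter : MvPolynomial (Option (Fin n)) ℂ →ₐ[ℂ] Subalgebra.center ℂ (Hecke hζ t) :=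
  MvPolynomial.aeval fun o => o.elim ⟨_, heckeW_mem_center hℓ hn hζ t⟩
    fun i => ⟨_, heckeX_pow_mem_center hℓ hn hζ t i⟩

/-- The homomorphism from the polynomial ring to the center of the quantum torus. -/
def polyToTorusCenter : MvPolynomial (Option (Fin n)) ℂ →ₐ[ℂ] Subalgebra.center ℂ (Torus n hζ) :=
  MvPolynomial.aeval fun o => o.elim ⟨_, torusW_mem_center hζ t⟩
    fun i => ⟨_, torusGen_pow_mem_center hℓ hn hζ t i⟩

omit hℓ hn in
theorem polyToCenter_X_some (hℓ : 2 ≤ ℓ) (hn : 3 ≤ n) (i : Fin n) :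
    (polyToCenter hℓ hn hζ t (MvPolynomial.X (some i)) : Hecke hζ t) = heckeX hζ t i ^ ℓ := by
  rw [polyToCenter, MvPolynomial.aeval_X]
  rfl

omit hℓ hn in
theorem polyToCenter_X_none (hℓ : 2 ≤ ℓ) (hn : 3 ≤ n) :
    (polyToCenter hℓ hn hζ t (MvPolynomial.X none) : Hecke hζ t) = heckeW hζ t := by
  rw [polyToCenter, MvPolynomial.aeval_X]
  rfl

-- Relations between the a_i and b can thus be checked in the center of the torus.
omit hℓ hn in
theorem heckeToTorus_polyToCenter (hℓ : 2 ≤ ℓ) (hn : 3 ≤ n) (f : MvPolynomial (Option (Fin n)) ℂ) :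
    heckeToTorus hℓ hn hζ t (polyToCenter hℓ hn hζ t f) = polyToTorusCenter hℓ hn hζ t f := by
  have h : ((heckeToTorus hℓ hn hζ t).comp (Subalgebra.val _)).comp (polyToCenter hℓ hn hζ t) =
      (Subalgebra.val _).comp (polyToTorusCenter hℓ hn hζ t) := by
    apply MvPolynomial.algHom_ext
    rintro (_ | i)
    · simp only [AlgHom.comp_apply, Subalgebra.coe_val, polyToCenter_X_none,
        heckeToTorus_heckeW, polyToTorusCenter, MvPolynomial.aeval_X]
      rfl
    · simp only [AlgHom.comp_apply, Subalgebra.coe_val, polyToCenter_X_some, map_pow,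
        heckeToTorus_heckeX, polyToTorusCenter, MvPolynomial.aeval_X]
      rfl
  exact DFunLike.congr_fun h f

end Center

end TwistedHecke

end

/-! ### The relation F and the kernel of the map to the center. -/

noncomputable section

namespace TwistedHecke

variable {n ℓ : ℕ} [NeZero ℓ] {ζ : ℂ} [NeZero n]

omit [NeZero ℓ] in
theorem prod_tauTilde (hn : 3 ≤ n) (t : Fin n → ℂ) :
    ∏ i, tauTilde ℓ ζ t i = (-1) ^ (n * (ℓ - 1)) * (∏ i, tau ζ t i) ^ ℓ := by
  obtain ⟨m, rfl⟩ : ∃ m, n = m + 1 := ⟨n - 1, by omega⟩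
  rw [Fin.prod_univ_castSucc, Fin.prod_univ_castSucc, tauTilde, if_pos (by simp), mul_left_comm,
    mul_pow, ← Finset.prod_pow]
  congr 2
  refine Finset.prod_congr rfl fun i _ => ?_
  rw [tauTilde, if_neg]
  have := i.2
  simp
  omega

omit [NeZero ℓ] in
/-- The relation `F` holds in a commutative algebra with elements factoring the weights of the
cycle. -/
theorem map_relF_eq_zero (hℓ : 2 ≤ ℓ) (hn : 3 ≤ n) (hζ : IsPrimitiveRoot ζ ℓ) (t : Fin n → ℂ)
    {A : Type*} [CommRing A] [Algebra ℂ A] (f : MvPolynomial (Option (Fin n)) ℂ →ₐ[ℂ] A)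
    {u v : Fin n → A} {U V : A} (huv : ∀ i, u i * v i = 1) (hUV : U * V = 1)
    (hu : ∏ i, u i = U ^ ℓ) (hv : ∏ i, v i = V ^ ℓ)
    (hx : ∀ j, f (MvPolynomial.X (some (j + 1))) = u (j + 1) - tauTilde ℓ ζ t j • v j)
    (hw : f (MvPolynomial.X none) = U + ((-1) ^ n * ζ ^ (n - 2) * ∏ i, tau ζ t i) • V) :
    f (relF ℓ ζ t) = 0 := by
  set c : ℂ := (-1) ^ n * ζ ^ (n - 2) * ∏ i, tau ζ t i with hc
  rw [Algebra.smul_def] at hw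
  have hfac := cyclicContinuant_factor hn (x := fun i => f (MvPolynomial.X (some i)))
    (s := fun i => algebraMap ℂ A (tauTilde ℓ ζ t i)) (X := u)
    (Y := fun i => tauTilde ℓ ζ t i • v i) hx
    (fun i _ => by rw [mul_smul_comm, huv, Algebra.algebraMap_eq_smul_one])
    (fun i _ => by rw [smul_mul_assoc, mul_comm, huv, Algebra.algebraMap_eq_smul_one])
    (fun _ _ => Commute.all _ _) (fun _ _ => Commute.all _ _) (fun _ _ _ _ => Commute.all _ _)
  -- The sign in the last τ̃ makes this hold: (-1)^(nℓ) = (-1)^n (-1)^(n(ℓ-1)). It identifies (cV)^ℓ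
  -- with the second product of the factorization.
  have hcl : c ^ ℓ = (-1) ^ n * ∏ i, tauTilde ℓ ζ t i := by
    rw [prod_tauTilde hn, hc, mul_pow, mul_pow, ← pow_mul ζ, mul_comm (n - 2), pow_mul ζ,
      hζ.pow_eq_one, one_pow, mul_one, ← mul_assoc, ← pow_add, ← pow_mul]
    congr 2
    rw [Nat.mul_sub, mul_one, Nat.add_sub_cancel' (Nat.le_mul_of_pos_right n (by omega))]
  have hy : (∏ i, tauTilde ℓ ζ t i • v i) = algebraMap ℂ A (∏ i, tauTilde ℓ ζ t i) * V ^ ℓ := by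
    rw [← hv, map_prod, ← Finset.prod_mul_distrib]
    exact Finset.prod_congr rfl fun i _ => Algebra.smul_def _ _
  have hsum1 : f (∑ S ∈ indexJ n, MvPolynomial.C (∏ i ∈ S, tauTilde ℓ ζ t i) *
      ∏ j, MvPolynomial.X (some j) ^ (deltaSub S j).toNat) =
      U ^ ℓ + (algebraMap ℂ A c * V) ^ ℓ := by
    rw [List.prod_ofFn, List.prod_ofFn, hu, hy] at hfac
    rw [mul_pow, ← map_pow, hcl, map_mul, map_pow, map_neg, map_one, mul_assoc, ← hfac, map_sum]
    refine Finset.sum_congr rfl fun S _ => ?_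
    rw [map_mul f, map_prod f, List.prod_ofFn, mul_comm, MvPolynomial.algHom_C,
      ((Finset.sort_perm_toList S _).map _).prod_eq, Finset.prod_map_toList,
      map_prod (algebraMap ℂ A)]
    congr 1
    exact Finset.prod_congr rfl fun j _ => map_pow f _ _
  have hsum2 : f (∑ r ∈ Finset.range (ℓ / 2 + 1),
      MvPolynomial.C ((-1) ^ (n * r) * ζ ^ ((n - 2) * r) * nu ℓ r * (∏ i, tau ζ t i) ^ r) *
        MvPolynomial.X none ^ (ℓ - 2 * r)) = U ^ ℓ + (algebraMap ℂ A c * V) ^ ℓ := by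
    rw [← sum_nu (by omega), map_sum]
    refine Finset.sum_congr rfl fun r _ => ?_
    rw [map_mul f, map_pow f, hw, MvPolynomial.algHom_C, mul_left_comm U, hUV, mul_one,
      ← map_pow (algebraMap ℂ A), ← map_mul (algebraMap ℂ A)]
    congr 2
    rw [hc, mul_pow, mul_pow, ← pow_mul, ← pow_mul]
    ring
  rw [relF, map_sub, hsum1, hsum2, sub_self]

section Relation

variable (hℓ : 2 ≤ ℓ) (hn : 3 ≤ n) (hζ : IsPrimitiveRoot ζ ℓ) (t : Fin n → ℂ)

/-- Apply `map_relF_eq_zero` in the center of the torus, a commutative ring, with u_i = X_i^ℓ, v_i =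
X_i^(-ℓ), U = X^δ and V = X^(-δ). -/
theorem polyToTorusCenter_relF : polyToTorusCenter hℓ hn hζ t (relF ℓ ζ t) = 0 := by
  have hwn : ∀ (p : Fin n → ℤ), (∀ g : diagGroup n ℓ, weight p g = 1) →
      ∀ g : diagGroup n ℓ, weight (-p) g = 1 := fun p hp g => by
    rw [weight_neg, hp, inv_one]
  have hinv : ∀ (p : Fin n → ℤ) (hp : ∀ g : diagGroup n ℓ, weight p g = 1),
      centralMon hζ p hp * centralMon hζ (-p) (hwn p hp) = 1 := fun p hp => Subtype.ext <| by
    change mon hζ _ 1 * mon hζ _ 1 = 1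
    rw [mon_one_mul_mon, add_neg_cancel, mon_zero_one]
  refine map_relF_eq_zero hℓ hn hζ t _
    (u := fun i => centralMon hζ (ℓ • Pi.single i 1) (weight_card_nsmul _))
    (v := fun i => centralMon hζ (-(ℓ • Pi.single i 1)) (hwn _ (weight_card_nsmul _)))
    (U := centralMon hζ (deltaVec n) weight_deltaVec)
    (V := centralMon hζ (-deltaVec n) (hwn _ weight_deltaVec))
    (fun i => hinv _ _) (hinv _ _) ?_ ?_ (fun j => ?_) ?_
  · rw [prod_centralMon hζ _ _ (ℓ • deltaVec n) (weight_card_nsmul _)]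
    · apply Subtype.ext
      change mon hζ _ 1 = mon hζ _ 1 ^ ℓ
      rw [mon_one_pow]
    · rw [← Finset.smul_sum, sum_single_eq_deltaVec]
  · rw [prod_centralMon hζ _ _ (-(ℓ • deltaVec n)) (hwn _ (weight_card_nsmul _))]
    · apply Subtype.ext
      change mon hζ _ 1 = mon hζ _ 1 ^ ℓ
      rw [mon_one_pow, smul_neg]
    · rw [Finset.sum_neg_distrib, ← Finset.smul_sum, sum_single_eq_deltaVec]
  · rw [polyToTorusCenter, MvPolynomial.aeval_X]
    exact Subtype.ext (torusGen_pow hℓ hn hζ t j)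
  · rw [polyToTorusCenter, MvPolynomial.aeval_X]
    rfl

theorem polyToCenter_relF : polyToCenter hℓ hn hζ t (relF ℓ ζ t) = 0 := by
  apply Subtype.ext
  apply heckeToTorus_injective hℓ hn hζ t
  rw [heckeToTorus_polyToCenter, polyToTorusCenter_relF]
  exact (map_zero _).symm

/-- The exponent of the leading term of the image of a monomial. -/
def leadExp (ℓ : ℕ) (m : Option (Fin n) →₀ ℕ) : Fin n → ℤ :=
  fun j => ℓ * m (some j) + m none

theorem hasLead_monomial (m : Option (Fin n) →₀ ℕ) :
    HasLead (polyToTorusCenter hℓ hn hζ t (MvPolynomial.monomial m 1) : Torus n hζ)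
      (leadExp ℓ m) 1 := by
  induction m using Finsupp.induction_linear with
  | zero =>
    have h0 : leadExp ℓ (0 : Option (Fin n) →₀ ℕ) = 0 := by ext; simp [leadExp]
    have h1 : (MvPolynomial.monomial (0 : Option (Fin n) →₀ ℕ)) (1 : ℂ) = 1 := rfl
    rw [h0, h1, map_one, OneMemClass.coe_one, ← mon_zero_one]
    exact hasLead_mon _ _
  | add m m' h h' =>
    have h0 : leadExp ℓ (m + m') = leadExp ℓ m + leadExp ℓ m' := by
      ext
      simp [leadExp]
      ring
    have h1 : MvPolynomial.monomial (m + m') (1 : ℂ) =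
        MvPolynomial.monomial m 1 * MvPolynomial.monomial m' 1 := by
      rw [MvPolynomial.monomial_mul, one_mul]
    rw [h0, h1, map_mul, MulMemClass.coe_mul]
    exact h.mul h'
  | single o k =>
    have h1 : MvPolynomial.monomial (Finsupp.single o k) (1 : ℂ) = MvPolynomial.X o ^ k :=
      MvPolynomial.X_pow_eq_monomial.symm
    rw [h1, map_pow, SubmonoidClass.coe_pow, polyToTorusCenter, MvPolynomial.aeval_X]
    cases o with
    | none =>
      have h0 : leadExp ℓ (Finsupp.single none k) = k • deltaVec n := by
        ext
        simp [leadExp, deltaVec]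
      rw [h0]
      refine HasLead.pow ?_ k
      change torusW hζ t - _ ∈ _
      rw [torusW, add_sub_cancel_left]
      refine Submodule.smul_mem _ _ (mon_mem_fil ?_ _)
      rw [totalDeg_neg, totalDeg_deltaVec]
      omega
    | some i =>
      have h0 : leadExp ℓ (Finsupp.single (some i) k) = k • ℓ • Pi.single i 1 := by
        ext j
        simp [leadExp, Finsupp.single_apply, Pi.single_apply, eq_comm (a := i), mul_comm]
      rw [h0]
      exact ((hasLead_torusGen hζ t i).pow ℓ).pow k

-- The exponent of b is the common residue modulo ℓ of the entries of the leading exponent, and the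
-- exponents of the a_j are then the quotients.
omit [NeZero ℓ] in
theorem leadExp_injOn {m m' : Option (Fin n) →₀ ℕ} (h : m none < ℓ) (h' : m' none < ℓ)
    (hm : leadExp ℓ m = leadExp ℓ m') : m = m' := by
  have h1 : ∀ j, ℓ * m (some j) + m none = ℓ * m' (some j) + m' none := fun j => by
    have := congrFun hm j
    rw [leadExp, leadExp] at this
    exact_mod_cast this
  have h2 : m none = m' none := by
    have := congrArg (· % ℓ) (h1 0)
    simpa [Nat.mul_add_mod, Nat.mod_eq_of_lt h, Nat.mod_eq_of_lt h'] using this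
  ext o
  cases o with
  | none => exact h2
  | some j =>
    have := h1 j
    rw [h2, add_left_inj] at this
    exact Nat.eq_of_mul_eq_mul_left (by omega) this

theorem eq_zero_of_polyToTorusCenter_eq_zero {f : MvPolynomial (Option (Fin n)) ℂ}
    (hf : ∀ m ∈ f.support, m none < ℓ) (h : polyToTorusCenter hℓ hn hζ t f = 0) : f = 0 := by
  let v : {m : Option (Fin n) →₀ ℕ // m none < ℓ} → Torus n hζ := fun m =>
    polyToTorusCenter hℓ hn hζ t (MvPolynomial.monomial m.1 1)
  have hli : LinearIndependent ℂ v := by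
    refine linearIndependent_of_hasLead (e := fun m => (leadExp ℓ m.1, 1)) ?_
      fun m => hasLead_monomial hℓ hn hζ t m.1
    rintro ⟨m, hm⟩ ⟨m', hm'⟩ h
    exact Subtype.ext (leadExp_injOn hm hm' (Prod.ext_iff.1 h).1)
  have hsum : ∑ m ∈ f.support.subtype (fun m => m none < ℓ), f.coeff m.1 • v m = 0 := by
    rw [Finset.sum_subtype_of_mem (fun m => f.coeff m •
      (polyToTorusCenter hℓ hn hζ t (MvPolynomial.monomial m 1) : Torus n hζ)) hf]
    have h1 := congrArg (Subalgebra.val _) h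
    rw [f.as_sum, map_sum, map_sum, map_zero] at h1
    rw [← h1]
    refine Finset.sum_congr rfl fun m _ => ?_
    rw [← mul_one (MvPolynomial.coeff m f), ← smul_eq_mul, ← MvPolynomial.smul_monomial, map_smul,
      map_smul, smul_eq_mul, mul_one]
    rfl
  rw [linearIndependent_iff'] at hli
  rw [← MvPolynomial.support_eq_empty, Finset.eq_empty_iff_forall_notMem]
  intro m hm
  exact MvPolynomial.mem_support_iff.1 hm
    (hli _ _ hsum ⟨m, hf m hm⟩ (Finset.mem_subtype.2 hm))

omit [NeZero ℓ] in
theorem nu_zero (hℓ : 2 ≤ ℓ) : nu ℓ 0 = 1 := by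
  have : (ℓ : ℂ) ≠ 0 := by exact_mod_cast (by omega : ℓ ≠ 0)
  simp [nu, this]

-- As a polynomial in b, the term r = 0 of F is -b^ℓ because ν_0 = 1. All other terms have lower
-- degree in b, the continuant having degree at most 0.
open Polynomial in
omit [NeZero ℓ] in
include hℓ in
theorem monic_optionEquivLeft_relF :
    ∃ R : (MvPolynomial (Fin n) ℂ)[X], R.degree < ℓ ∧
      MvPolynomial.optionEquivLeft ℂ (Fin n) (-relF ℓ ζ t) = X ^ ℓ + R := by
  set E := MvPolynomial.optionEquivLeft ℂ (Fin n)
  have hF : -relF ℓ ζ t = MvPolynomial.X none ^ ℓ +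
      ((∑ r ∈ Finset.range (ℓ / 2),
        MvPolynomial.C ((-1) ^ (n * (r + 1)) * ζ ^ ((n - 2) * (r + 1)) * nu ℓ (r + 1) *
          (∏ i, tau ζ t i) ^ (r + 1)) * MvPolynomial.X none ^ (ℓ - 2 * (r + 1))) -
      ∑ S ∈ indexJ n, MvPolynomial.C (∏ i ∈ S, tauTilde ℓ ζ t i) *
        ∏ j, MvPolynomial.X (some j) ^ (deltaSub S j).toNat) := by
    rw [relF, Finset.sum_range_succ', nu_zero hℓ]
    simp only [mul_zero, pow_zero, mul_one, Nat.sub_zero, map_one, one_mul]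
    ring
  refine ⟨_, ?_, by rw [hF, map_add, map_pow, MvPolynomial.optionEquivLeft_X_none]⟩
  rw [← mem_degreeLT, map_sub, map_sum, map_sum]
  refine Submodule.sub_mem _ (Submodule.sum_mem _ fun r hr => ?_)
    (Submodule.sum_mem _ fun S _ => ?_)
  · rw [map_mul, map_pow, MvPolynomial.optionEquivLeft_X_none, MvPolynomial.optionEquivLeft_C,
      mem_degreeLT]
    refine (degree_C_mul_X_pow_le _ _).trans_lt ?_
    exact_mod_cast (by omega : ℓ - 2 * (r + 1) < ℓ)
  · have : E (MvPolynomial.C (∏ i ∈ S, tauTilde ℓ ζ t i) *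
        ∏ j, MvPolynomial.X (some j) ^ (deltaSub S j).toNat) =
        C (MvPolynomial.C (∏ i ∈ S, tauTilde ℓ ζ t i) *
          ∏ j, MvPolynomial.X j ^ (deltaSub S j).toNat) := by
      rw [map_mul, MvPolynomial.optionEquivLeft_C, map_prod E, C_mul, map_prod C]
      congr 1
      refine Finset.prod_congr rfl fun j _ => ?_
      rw [map_pow, MvPolynomial.optionEquivLeft_X_some, C_pow]
    rw [this, mem_degreeLT]
    refine degree_C_le.trans_lt ?_
    exact_mod_cast (by omega : 0 < ℓ)

-- Division with remainder by -F in the variable b: the remainder of an element of the kernel has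
-- degree less than ℓ in b and still maps to 0, so it vanishes because its monomials have distinct
-- leading exponents.
open Polynomial in
theorem ker_polyToCenter :
    RingHom.ker (polyToCenter hℓ hn hζ t) = Ideal.span {relF ℓ ζ t} := by
  apply le_antisymm
  · intro f hf
    rw [RingHom.mem_ker] at hf
    obtain ⟨R, hR, hE⟩ := monic_optionEquivLeft_relF (ζ := ζ) hℓ t
    set E := MvPolynomial.optionEquivLeft ℂ (Fin n)
    have hmonic : (E (-relF ℓ ζ t)).Monic := by rw [hE]; exact monic_X_pow_add hR
    have hdeg : (E (-relF ℓ ζ t)).degree = ℓ := by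
      rw [hE, degree_add_eq_left_of_degree_lt (by rwa [degree_X_pow]), degree_X_pow]
    have hdiv := modByMonic_add_div (E f) (E (-relF ℓ ζ t))
    have hlt := degree_modByMonic_lt (E f) hmonic
    set r := E.symm (E f %ₘ E (-relF ℓ ζ t)) with hr
    set q := E.symm (E f /ₘ E (-relF ℓ ζ t)) with hq
    have hfr : f = r + -relF ℓ ζ t * q := by
      apply E.injective
      rw [map_add, map_mul, hr, hq, E.apply_symm_apply, E.apply_symm_apply, hdiv]
    have hr0 : r = 0 := by
      apply eq_zero_of_polyToTorusCenter_eq_zero hℓ hn hζ t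
      · intro m hm
        by_contra hcon
        rw [MvPolynomial.mem_support_iff,
          ← MvPolynomial.optionEquivLeft_coeff_some_coeff_none] at hm
        apply hm
        rw [coeff_eq_zero_of_degree_lt, MvPolynomial.coeff_zero]
        change (E r).degree < _
        rw [hr, E.apply_symm_apply]
        refine hlt.trans_le ?_
        rw [hdeg]
        exact_mod_cast not_lt.1 hcon
      · have h1 : polyToCenter hℓ hn hζ t r = 0 := by
          rw [hfr, map_add, map_mul, map_neg, polyToCenter_relF, neg_zero, zero_mul,
            add_zero] at hf
          exact hf
        apply Subtype.ext
        rw [← heckeToTorus_polyToCenter, h1]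
        exact map_zero _
    rw [hfr, hr0, zero_add, neg_mul]
    exact neg_mem (Ideal.mul_mem_right _ _ (Ideal.mem_span_singleton_self _))
  · rw [Ideal.span_singleton_le_iff_mem, RingHom.mem_ker]
    exact polyToCenter_relF hℓ hn hζ t

end Relation

/-! ### Generation of the center. -/

section Surjectivity

variable {hℓ : 2 ≤ ℓ} {hn : 3 ≤ n} {hζ : IsPrimitiveRoot ζ ℓ} {t : Fin n → ℂ}

theorem torusY_mem_fil (i : Fin n) : torusY hζ t i ∈ fil hζ (-1) :=
  Submodule.smul_mem _ _ (mon_mem_fil (by rw [totalDeg_neg, totalDeg_single]) _)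

/-- The top degree part of the image of a central element lies in the trivial component. -/
theorem eq_one_of_coefAt_ne_zero {a : Torus n hζ} {d : ℤ} (ha : a ∈ fil hζ d)
    (hc : ∀ i, Commute a (torusGen hζ t i)) {p : Fin n → ℤ} {g : diagGroup n ℓ}
    (hp : totalDeg p = d) (h : coefAt hζ p g a ≠ 0) : g = 1 := by
  apply ext_entry
  intro i
  rw [entry_one]
  have h1 := (hc i).eq
  rw [torusGen, mul_sub, sub_mul, sub_eq_sub_iff_add_eq_add] at h1
  have h2 := congrArg (coefAt hζ (p + Pi.single i 1) g) h1
  have hlt : d + -1 < totalDeg (p + Pi.single i 1) := by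
    rw [totalDeg_add, totalDeg_single]
    omega
  have hlt' : -1 + d < totalDeg (p + Pi.single i 1) := by rw [add_comm]; exact hlt
  -- The Y terms have degree at most d - 1 and do not reach degree d + 1, so only commutation with
  -- X_i remains: the coefficient equals itself times the i-th entry of g.
  rw [map_add, map_add, coefAt_eq_zero (mul_mem_fil ha (torusY_mem_fil _)) hlt,
    coefAt_eq_zero (mul_mem_fil (torusY_mem_fil _) ha) hlt', torusX, coefAt_mul_mon,
    coefAt_mon_mul, weight_single, zpow_one, coe_entryUnit, add_zero, add_zero] at h2
  exact mul_right_cancel₀ h (h2.trans (one_mul _).symm)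

omit [NeZero n] in
theorem weight_eq_one_of_coefAt_ne_zero {a : Torus n hζ} {p : Fin n → ℤ}
    (h : coefAt hζ p 1 a ≠ 0) {g : diagGroup n ℓ} (hc : Commute a (mon hζ 0 g)) :
    weight p g = 1 := by
  have h1 := congrArg (coefAt hζ p g) hc.eq
  rw [coefAt_mul_grp, coefAt_grp_mul] at h1
  exact Units.ext (mul_right_cancel₀ h (h1.symm.trans (one_mul _).symm))

/-- The exponents of the monomial in the `a_i` and `b` with leading term of exponent `p`. -/
def polyExp (ℓ : ℕ) (p : Fin n → ℤ) : Option (Fin n) →₀ ℕ :=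
  Finsupp.equivFunOnFinite.symm fun o => o.elim (p 0 % ℓ).toNat fun j => (p j / ℓ).toNat

theorem leadExp_polyExp {p : Fin n → ℤ} (h0 : ∀ j, 0 ≤ p j) (h : ∀ j, p j % ℓ = p 0 % ℓ) :
    leadExp ℓ (polyExp ℓ p) = p := by
  have hl : (ℓ : ℤ) ≠ 0 := by exact_mod_cast NeZero.ne ℓ
  ext j
  change (ℓ : ℤ) * ((p j / ℓ).toNat : ℤ) + ((p 0 % ℓ).toNat : ℤ) = p j
  rw [Int.toNat_of_nonneg (Int.ediv_nonneg (h0 j) (by omega)),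
    Int.toNat_of_nonneg (Int.emod_nonneg _ hl), ← h j, Int.mul_ediv_add_emod]

/-- Induction on the degree: subtract from a central element a polynomial in the a_i and b with the
same top degree part. The bound d - 1 lets the induction start in degree -1, where only 0 remains
because the basis elements have leading terms of nonnegative degree. -/
theorem mem_range_of_map_mem_fil (d : ℕ) : ∀ z : Subalgebra.center ℂ (Hecke hζ t),
    heckeToTorus hℓ hn hζ t z ∈ fil hζ ((d : ℤ) - 1) →
      z ∈ (polyToCenter hℓ hn hζ t).range := by
  induction d with
  | zero =>
    intro z hz
    obtain ⟨c, hc⟩ := exists_linearCombination hn hζ t z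
    rw [← hc, map_linearCombination_pbw] at hz
    have hc0 : c = 0 := by
      by_contra hne
      obtain ⟨i, hi⟩ := Finsupp.support_nonempty_iff.2 hne
      have h1 := totalDeg_le_of_linearCombination_mem_fil pbwExp_injective
        (hasLead_pbw hℓ hn hζ t) hz hi
      have h2 : 0 ≤ totalDeg (pbwExp i).1 := Finset.sum_nonneg fun j _ => Int.natCast_nonneg _
      simp at h1
      omega
    rw [hc0, map_zero] at hc
    have : z = 0 := Subtype.ext hc.symm
    rw [this]
    exact Subalgebra.zero_mem _
  | succ d ih =>
    intro z hz
    rw [Nat.cast_add, Nat.cast_one, add_sub_cancel_right] at hz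
    set a := heckeToTorus hℓ hn hζ t z with ha
    have hcomm : ∀ b : Hecke hζ t, Commute a (heckeToTorus hℓ hn hζ t b) := fun b => by
      rw [Commute, SemiconjBy, ha, ← map_mul, ← map_mul,
        (Subalgebra.mem_center_iff.1 z.2 b)]
    have htop : ∀ u ∈ a.coeff.support, totalDeg u.1.toAdd = d →
        u.2 = 1 ∧ leadExp ℓ (polyExp ℓ u.1.toAdd) = u.1.toAdd := fun u hu hd => by
      have hne : coefAt hζ u.1.toAdd u.2 a ≠ 0 := Finsupp.mem_support_iff.1 hu
      have h1 : u.2 = 1 := eq_one_of_coefAt_ne_zero (t := t) hz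
        (fun i => by rw [← heckeToTorus_heckeX hℓ hn]; exact hcomm _) hd hne
      refine ⟨h1, leadExp_polyExp ?_ ?_⟩
      -- Nonnegativity of the exponent holds because z comes from the Hecke algebra: a monomial of
      -- top degree is the leading term of a basis element, whose exponent counts letters.
      · obtain ⟨c, hc⟩ := exists_linearCombination hn hζ t z
        rw [ha, ← hc, map_linearCombination_pbw] at hne hz
        obtain ⟨i, hi⟩ := exists_eq_of_coefAt_ne_zero pbwExp_injective (hasLead_pbw hℓ hn hζ t) hz
          hd hne
        intro j
        have := congrFun (congrArg Prod.fst hi) j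
        change _ = u.1.toAdd j at this
        rw [← this]
        exact Int.natCast_nonneg _
      · rw [h1] at hne
        refine emod_eq_of_weight hζ fun g => weight_eq_one_of_coefAt_ne_zero hne ?_
        rw [← heckeToTorus_heckeGrp hℓ hn hζ t]
        exact hcomm _
    set s := a.coeff.support
    set f : MvPolynomial (Option (Fin n)) ℂ := ∑ u ∈ s with totalDeg u.1.toAdd = d,
      coefAt hζ u.1.toAdd u.2 a • MvPolynomial.monomial (polyExp ℓ u.1.toAdd) 1 with hf
    have hmem : z - polyToCenter hℓ hn hζ t f ∈ (polyToCenter hℓ hn hζ t).range := by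
      apply ih
      rw [AddSubgroupClass.coe_sub, map_sub, heckeToTorus_polyToCenter, ← ha]
      have hΘ : (polyToTorusCenter hℓ hn hζ t f : Torus n hζ) =
          ∑ u ∈ s with totalDeg u.1.toAdd = d, coefAt hζ u.1.toAdd u.2 a •
            (polyToTorusCenter hℓ hn hζ t
              (MvPolynomial.monomial (polyExp ℓ u.1.toAdd) 1) : Torus n hζ) := by
        change ((Subalgebra.val _).comp (polyToTorusCenter hℓ hn hζ t)) f = _
        rw [hf, map_sum]
        exact Finset.sum_congr rfl fun u _ => map_smul _ _ _
      have hsum : a = ∑ u ∈ s, coefAt hζ u.1.toAdd u.2 a • mon hζ u.1.toAdd u.2 := eq_sum_mon a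
      rw [← Finset.sum_filter_add_sum_filter_not s (fun u => totalDeg u.1.toAdd = d)] at hsum
      -- The terms of degree d become differences of an element and its leading monomial, hence have
      -- degree at most d - 1; the remaining terms already had smaller degree.
      have heq : a - polyToTorusCenter hℓ hn hζ t f =
          ∑ u ∈ s with totalDeg u.1.toAdd = d, coefAt hζ u.1.toAdd u.2 a •
            (mon hζ u.1.toAdd u.2 - (polyToTorusCenter hℓ hn hζ t
              (MvPolynomial.monomial (polyExp ℓ u.1.toAdd) 1) : Torus n hζ)) +
          ∑ u ∈ s with ¬ totalDeg u.1.toAdd = d,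
            coefAt hζ u.1.toAdd u.2 a • mon hζ u.1.toAdd u.2 := by
        simp only [smul_sub, Finset.sum_sub_distrib]
        rw [hΘ, sub_add_eq_add_sub, ← hsum]
      rw [heq]
      refine Submodule.add_mem _ (Submodule.sum_mem _ fun u hu => Submodule.smul_mem _ _ ?_)
        (Submodule.sum_mem _ fun u hu => ?_)
      · obtain ⟨hus, hud⟩ := Finset.mem_filter.1 hu
        obtain ⟨h1, h2⟩ := htop u hus hud
        have h3 := hasLead_monomial hℓ hn hζ t (polyExp ℓ u.1.toAdd)
        rw [HasLead, h2, hud] at h3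
        rw [h1]
        simpa only [neg_sub] using Submodule.neg_mem _ h3
      · obtain ⟨hus, hud⟩ := Finset.mem_filter.1 hu
        have hne : coefAt hζ u.1.toAdd u.2 a ≠ 0 := Finsupp.mem_support_iff.1 hus
        have hle : totalDeg u.1.toAdd ≤ d := by
          by_contra hlt
          exact hne (coefAt_eq_zero hz (not_le.1 hlt) _)
        exact Submodule.smul_mem _ _ (mon_mem_fil (by omega) _)
    have := Subalgebra.add_mem _ hmem ⟨f, rfl⟩
    rwa [AlgHom.toRingHom_eq_coe, RingHom.coe_coe, sub_add_cancel] at this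

theorem polyToCenter_surjective : Function.Surjective (polyToCenter hℓ hn hζ t) := by
  intro z
  obtain ⟨d, hd⟩ := exists_mem_fil (heckeToTorus hℓ hn hζ t z)
  exact mem_range_of_map_mem_fil (d + 1) z (by push_cast; rwa [add_sub_cancel_right])

end Surjectivity

-- All τ_i and τ̃_i vanish, so only the empty set and r = 0 contribute.
omit [NeZero ℓ] in
theorem relF_zero (hℓ : 2 ≤ ℓ) {t : Fin n → ℂ} (ht : ∀ i, t i = 0) :
    relF ℓ ζ t = (∏ i : Fin n, MvPolynomial.X (some i)) - MvPolynomial.X none ^ ℓ := by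
  have htau : ∀ i, tau ζ t i = 0 := fun i => by simp [tau, ht]
  have htau' : ∀ i, tauTilde ℓ ζ t i = 0 := fun i => by
    simp [tauTilde, htau, show ℓ ≠ 0 by omega]
  rw [relF]
  congr 1
  · rw [Finset.sum_eq_single ∅]
    · simp [deltaSub]
    · intro S _ hS
      obtain ⟨i, hi⟩ := Finset.nonempty_iff_ne_empty.2 hS
      rw [Finset.prod_eq_zero hi (htau' i), map_zero, zero_mul]
    · intro h
      exact absurd (by simp [indexJ]) h
  · have h0 : ∏ i, tau ζ t i = 0 := Finset.prod_eq_zero (Finset.mem_univ (0 : Fin n)) (htau 0)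
    rw [Finset.sum_eq_single 0]
    · simp [nu_zero hℓ]
    · intro r _ hr
      rw [h0, zero_pow hr, mul_zero, map_zero, zero_mul]
    · simp

end TwistedHecke

end

theorem corollary3 (n ℓ : ℕ) [NeZero n] [NeZero ℓ] (hn : 3 ≤ n) (hℓ : 2 ≤ ℓ)
    (ζ : ℂ) (hζ : IsPrimitiveRoot ζ ℓ) (t : Fin n → ℂ) :
    (∃ φ : (MvPolynomial (Option (Fin n)) ℂ ⧸ Ideal.span {TwistedHecke.relF ℓ ζ t}) ≃ₐ[ℂ]
        Subalgebra.center ℂ (TwistedHecke.Hecke hζ t),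
      (∀ i : Fin n, (φ (Ideal.Quotient.mk _ (MvPolynomial.X (some i))) :
          TwistedHecke.Hecke hζ t) = TwistedHecke.heckeX hζ t i ^ ℓ) ∧
      (φ (Ideal.Quotient.mk _ (MvPolynomial.X none)) : TwistedHecke.Hecke hζ t) =
        TwistedHecke.heckeW hζ t) ∧
    ((∀ i, t i = 0) → TwistedHecke.relF ℓ ζ t =
      (∏ i : Fin n, MvPolynomial.X (some i)) - MvPolynomial.X none ^ ℓ) := by
  refine ⟨⟨(Ideal.quotientEquivAlgOfEq ℂ (TwistedHecke.ker_polyToCenter hℓ hn hζ t).symm).trans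
    (Ideal.quotientKerAlgEquivOfSurjective
      (TwistedHecke.polyToCenter_surjective (hℓ := hℓ) (hn := hn))), fun i => ?_, ?_⟩,
    fun ht => TwistedHecke.relF_zero hℓ ht⟩
  · exact TwistedHecke.polyToCenter_X_some hζ t hℓ hn i
  · exact TwistedHecke.polyToCenter_X_none hζ t hℓ hn
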